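/- A knot is the image of an embedding of the circle in $\mathbb{R}^3$; all knots are assumed tame, i.e. ambient isotopic to a simple closed polygon. A diagram of a knot $K$ is the projection to the plane of a simple closed polygon ambient isotopic to $K$, such that there are finitely many crossings, all of them double points and none of them under a vertex, together with the over/under information at each crossing. A diagram is in straight position if the polygon can be divided into two arcs with common ends such that the first arc (the straight strand) is projected, injectively and from left to right, onto a segment $[a,b]\times\{0\}$ of the horizontal axis, $a<b$, and the second arc is projected injectively. (So all crossings are crossings of the straight strand with the second arc, and traversing the knot from the left end of the strand one meets the crossings in an order $1,2,\dots,n,\sigma(1),\dots,\sigma(n)$ with $\sigma\in S_n$.) The extended straight strand is the set of points $(x,0)$ with $x<a$ or $x>b$. A straight diagram is contained if it does not meet the extended straight strand. The contained straight number $\mathtt{cstr}(K)$ is the minimum $n$ such that $K$ has a contained straight diagram with exactly $n$ crossings. **Theorem.** Every (tame) knot $K$ has a contained straight diagram. Hence the minimum defining $\mathtt{cstr}(K)$ exists, and it is an invariant: $\mathtt{cstr}(L)=\mathtt{cstr}(K)$ for every $L$ ambient isotopic to $K$. -/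

import Mathlib

namespace StraightKnots

/-- Three-space, written as (projection plane) times (height). Only its topology and its affine
structure are used. The knot diagrams below are obtained by the projection `Prod.fst` to the
plane; at a double point, the strand with the larger height `Prod.snd` is the overstrand. -/
abbrev Space : Type := (ℝ × ℝ) × ℝ

/-- A knot: the image of an embedding of the circle into three-space. -/
def IsKnot (K : Set Space) : Prop :=
  ∃ f : Circle → Space, Topology.IsEmbedding f ∧ Set.range f = K

/-- Ambient isotopy of subsets of three-space: a continuous family of homeomorphisms of the whole
space (with continuous family of inverses) that starts at the identity and ends at a
homeomorphism carrying `K` onto `L`. -/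
def AmbientIsotopic (K L : Set Space) : Prop :=
  ∃ F : unitInterval → (Space ≃ₜ Space),
    Continuous (fun p : unitInterval × Space => F p.1 p.2) ∧
    Continuous (fun p : unitInterval × Space => (F p.1).symm p.2) ∧
    (∀ x, F 0 x = x) ∧ F 1 '' K = L

section Polygons

variable {m : ℕ} [NeZero m]

/-- The edge from the `i`-th vertex to the next one (cyclically) of a closed polygon. -/
def edge (v : Fin m → Space) (i : Fin m) : Set Space := segment ℝ (v i) (v (i + 1))

/-- The closed polygon with vertices `v 0, …, v (m - 1)`, as a subset of space. -/
def carrier (v : Fin m → Space) : Set Space := ⋃ i, edge v i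

/-- The closed polygon is simple: running once through its edges (each without its terminal
vertex) never visits a point twice. This forces `3 ≤ m`. -/
def IsSimplePolygon (v : Fin m → Space) : Prop :=
  Set.InjOn (fun p : Fin m × ℝ => AffineMap.lineMap (k := ℝ) (v p.1) (v (p.1 + 1)) p.2)
    (Set.univ ×ˢ Set.Ico (0 : ℝ) 1)

end Polygons

/-- A tame knot: a knot that is ambient isotopic to a simple closed polygon. -/
def IsTameKnot (K : Set Space) : Prop :=
  IsKnot K ∧ ∃ (m : ℕ) (_ : NeZero m) (v : Fin m → Space),
    IsSimplePolygon v ∧ AmbientIsotopic K (carrier v)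

/-- The crossings of the projection of `K`: the points of the plane with at least two preimages. -/
def crossings (K : Set Space) : Set (ℝ × ℝ) :=
  {q | (K ∩ Prod.fst ⁻¹' {q}).Nontrivial}

section Diagrams

variable {m : ℕ} [NeZero m]

/-- The projection of the polygon is regular, so that it is a knot diagram: there are finitely many
crossings, each is a double point, and no vertex lies over a crossing. So every crossing is a
transverse intersection of the projections of two edges. -/
def IsRegular (v : Fin m → Space) : Prop :=
  (crossings (carrier v)).Finite ∧
  (∀ q : ℝ × ℝ, (carrier v ∩ Prod.fst ⁻¹' {q}).encard ≤ 2) ∧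
  ∀ i, (v i).1 ∉ crossings (carrier v)

/-- The diagram is in straight position, with the vertices `v 0, …, v k` on the straight strand.
The strand is projected, from left to right, onto a segment of the horizontal axis, and
the rest of the knot, from `v k` back to `v 0`, is projected injectively. So every crossing is a
crossing of the straight strand with the rest of the knot: from `v 0` on, one meets every crossing
once along the strand, and then every crossing once more along the rest. -/
def IsStraight (v : Fin m → Space) (k : Fin m) : Prop :=
  0 < k ∧
  (∀ i, i ≤ k → (v i).1.2 = 0) ∧
  (∀ i j, i < j → j ≤ k → (v i).1.1 < (v j).1.1) ∧
  Set.InjOn (Prod.fst : Space → ℝ × ℝ) (⋃ (i : Fin m) (_ : k ≤ i), edge v i)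

/-- The extended straight strand: the horizontal axis without the straight strand. -/
def extendedStrand (v : Fin m → Space) (k : Fin m) : Set (ℝ × ℝ) :=
  {q | q.2 = 0 ∧ (q.1 < (v 0).1.1 ∨ (v k).1.1 < q.1)}

/-- The diagram does not meet the extended straight strand. -/
def IsContained (v : Fin m → Space) (k : Fin m) : Prop :=
  Disjoint (Prod.fst '' carrier v) (extendedStrand v k)

end Diagrams

/-- `K` has a contained straight diagram with exactly `n` crossings. -/
def HasContainedStraightDiagram (K : Set Space) (n : ℕ) : Prop :=
  ∃ (m : ℕ) (_ : NeZero m) (v : Fin m → Space) (k : Fin m),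
    IsSimplePolygon v ∧ AmbientIsotopic K (carrier v) ∧ IsRegular v ∧
    IsStraight v k ∧ IsContained v k ∧ (crossings (carrier v)).ncard = n

/-- The contained straight number: the least number of crossings of a contained straight diagram
of `K` (a junk value if there is no such diagram). -/
noncomputable def cstr (K : Set Space) : ℕ := sInf {n | HasContainedStraightDiagram K n}

end StraightKnots

namespace StraightKnots

open Set Topology

/-! The knot is first brought into the form of one edge `ab` and a path `T` from `b` to `a` with
injective projection (`IsGeneric.exists_return`). Start from a polygon in general position. The
closing edge alone is such a return path, and the other edges join it one by one, backwards from the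
last. Edge `j`, which ends where the return path begins, can be prepended once their projections
meet only there. The crossings in the way are removed starting with the one nearest to `w j`: a
short piece of the return path is pulled like a finger along the edge, past its start `w j`
(`IsReturn.exists_removal`). The tip is placed very high if the piece passes over the edge and very
low if it passes under, so the triangle swept out misses the rest of the knot and the move is an
isotopy. The finger may cross earlier edges, but neither edge `j` nor the rest of the return path.

The result is straight, but `T` may cross the line `ab` outside the edge. The remedy is to look at
the knot from the side. A vertical shear by a continuous function on the plane can change the
heights at will, as long as the height difference of the two strands is kept at each crossing
(`IsSubdivided.exists_shear`). Give `ab` the height zero, and give `T` the height `H - η(x)`, where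
`H` increases along `T` from `0` to `N`, and `η` is a piecewise linear function of the abscissa `x`,
equal to `N` to the left of `a` and to `0` to the right of `b`. Distinct crossings have distinct
abscissas, so `η` can take there the values which the height differences demand
(`IsSubdivided.exists_heights`). In the view from the side, with coordinates `(x, z)`, the edge `ab`
lies on the horizontal axis. The function `z + η(x)` increases along `T`, so `T` is still projected
injectively. Left of `a` one has `z = H - N < 0`, and right of `b` one has `z = H > 0`, so the
extended strand is avoided (`IsMonotoneReturn.hasContainedStraightDiagram`).

General position is reached by moving the vertices slightly. The displacement, interpolated along
the edges, is Lipschitz with a small constant; it extends to space, and the identity plus this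
extension is the end of an ambient isotopy (`IsSimplePolygon.exists_perturb`). Generic vertices are
dense, since each condition is that an analytic function which is not identically zero does not
vanish. -/

/-! ### Ambient isotopies: pushes, shears, quarter turn, small perturbations -/

theorem AmbientIsotopic.refl (K : Set Space) : AmbientIsotopic K K :=
  ⟨fun _ => Homeomorph.refl _, continuous_snd, continuous_snd, fun _ => rfl, by simp⟩

theorem AmbientIsotopic.symm {K L : Set Space} (h : AmbientIsotopic K L) :
    AmbientIsotopic L K := by
  obtain ⟨F, hF, hF', h0, rfl⟩ := h
  refine ⟨fun t => (F t).symm, hF', hF, fun x => ?_, ?_⟩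
  · rw [Homeomorph.symm_apply_eq, h0]
  · simp [Set.image_image]

theorem AmbientIsotopic.trans {K L M : Set Space} (h : AmbientIsotopic K L)
    (h' : AmbientIsotopic L M) : AmbientIsotopic K M := by
  obtain ⟨F, hF, hF', h0, rfl⟩ := h
  obtain ⟨G, hG, hG', k0, rfl⟩ := h'
  refine ⟨fun t => (F t).trans (G t), ?_, ?_, fun x => by simp [h0, k0], ?_⟩
  · exact hG.comp (continuous_fst.prodMk hF)
  · exact hF'.comp (continuous_fst.prodMk hG')
  · rw [Set.image_image]; rfl

theorem ambientIsotopic_of_family (Φ Ψ : unitInterval → Space → Space)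
    (hΦ : Continuous fun p : unitInterval × Space => Φ p.1 p.2)
    (hΨ : Continuous fun p : unitInterval × Space => Ψ p.1 p.2)
    (hl : ∀ t x, Ψ t (Φ t x) = x) (hr : ∀ t x, Φ t (Ψ t x) = x) (h0 : ∀ x, Φ 0 x = x)
    (K : Set Space) : AmbientIsotopic K (Φ 1 '' K) :=
  ⟨fun t => ⟨⟨Φ t, Ψ t, hl t, hr t⟩, hΦ.comp (Continuous.prodMk_right t),
    hΨ.comp (Continuous.prodMk_right t)⟩, hΦ, hΨ, h0, rfl⟩

/-- Pushing along a fixed direction `u`, by an amount which decreases along `u` at a rate less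
than one, is an ambient isotopy. -/
theorem ambientIsotopic_push (u : Space) (D : Space → ℝ) (hD : Continuous D) (θ : ℝ) (hθ0 : 0 ≤ θ)
    (hθ : θ < 1) (hmono : ∀ p s, 0 ≤ s → D p - θ * s ≤ D (p + s • u)) (K : Set Space) :
    AmbientIsotopic K ((fun p => p + D p • u) '' K) := by
  have hθ' : 0 < 1 - θ := by linarith
  -- On each line parallel to `u`, the map `s ↦ s + t D(p + s u)` has slopes at least `1 - θ`. So it
  -- has exactly one zero `S t p`, which gives the inverse `p ↦ p + S t p • u`; the same slope bound
  -- makes `S` continuous.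
  have key : ∀ (t : unitInterval) (p : Space) (s s' : ℝ), s ≤ s' →
      (1 - θ) * (s' - s) ≤ (s' + t * D (p + s' • u)) - (s + t * D (p + s • u)) := by
    intro t p s s' hs
    have h1 := hmono (p + s • u) (s' - s) (by linarith)
    have h2 : p + s • u + (s' - s) • u = p + s' • u := by
      rw [add_assoc, ← add_smul]; congr 2; ring
    rw [h2] at h1
    have ht0 := t.2.1
    have ht1 := t.2.2
    nlinarith [mul_le_mul_of_nonneg_left h1 ht0, mul_nonneg hθ0 (sub_nonneg.2 hs)]
  have absb : ∀ (t : unitInterval) (p : Space) (s s' : ℝ),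
      (1 - θ) * |s' - s| ≤ |(s' + t * D (p + s' • u)) - (s + t * D (p + s • u))| := by
    intro t p s s'
    rcases le_total s s' with h | h
    · rw [abs_of_nonneg (sub_nonneg.2 h)]
      exact (key t p s s' h).trans (le_abs_self _)
    · rw [abs_sub_comm s', abs_sub_comm (s' + _), abs_of_nonneg (sub_nonneg.2 h)]
      exact (key t p s' s h).trans (le_abs_self _)
  have ex : ∀ (t : unitInterval) (p : Space), ∃ s : ℝ, s + t * D (p + s • u) = 0 := by
    intro t p
    set f : ℝ → ℝ := fun s => s + t * D (p + s • u) with hf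
    have hfc : Continuous f := by fun_prop
    set r := |f 0| / (1 - θ) with hr
    have hr0 : 0 ≤ r := by positivity
    have e : (1 - θ) * r = |f 0| := by rw [hr]; field_simp
    have a1 := key t p 0 r hr0
    have a2 := key t p (-r) 0 (by linarith)
    have b1 := neg_abs_le (f 0)
    have b2 := le_abs_self (f 0)
    have c1 : 0 ≤ f r := by simp only [hf] at *; nlinarith
    have c2 : f (-r) ≤ 0 := by simp only [hf] at *; nlinarith
    obtain ⟨s, -, hs⟩ := intermediate_value_Icc (by linarith : -r ≤ r) hfc.continuousOn ⟨c2, c1⟩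
    exact ⟨s, hs⟩
  choose S hS using ex
  have uniq : ∀ (t : unitInterval) p s, s + t * D (p + s • u) = 0 → S t p = s := by
    intro t p s hs
    have := absb t p s (S t p)
    rw [hS, hs] at this
    have h0 : |S t p - s| ≤ 0 := by
      by_contra h; push Not at h
      have := mul_pos hθ' h
      simp at *; linarith
    exact sub_eq_zero.1 (abs_eq_zero.1 (le_antisymm h0 (abs_nonneg _)))
  have Scont : Continuous fun q : unitInterval × Space => S q.1 q.2 := by
    rw [continuous_iff_continuousAt]
    intro q0
    rw [ContinuousAt, tendsto_iff_dist_tendsto_zero]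
    have hg : Continuous fun q : unitInterval × Space =>
        |S q0.1 q0.2 + q.1 * D (q.2 + S q0.1 q0.2 • u)| / (1 - θ) := by
      fun_prop
    have hg0 := hg.tendsto q0
    simp only [hS, abs_zero, zero_div] at hg0
    refine squeeze_zero (fun _ => dist_nonneg) (fun q => ?_) hg0
    rw [le_div_iff₀ hθ', mul_comm, Real.dist_eq]
    have := absb q.1 q.2 (S q.1 q.2) (S q0.1 q0.2)
    rwa [hS, sub_zero, abs_sub_comm] at this
  have := ambientIsotopic_of_family (fun t p => p + (t * D p : ℝ) • u) (fun t p => p + S t p • u)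
    (by fun_prop) (by fun_prop)
    (fun t p => by
      rw [uniq t (p + ((t : ℝ) * D p) • u) (-(t * D p))]
      · simp
      · simp)
    (fun t p => by
      have := hS t p
      rw [add_assoc, ← add_smul, this]; simp)
    (fun p => by simp) K
  simpa using this

/-- Vertical shear. -/
theorem ambientIsotopic_shear (g : ℝ × ℝ → ℝ) (hg : Continuous g) (K : Set Space) :
    AmbientIsotopic K ((fun p : Space => (p.1, p.2 + g p.1)) '' K) := by
  have := ambientIsotopic_push (0, 1) (fun p => g p.1) (by fun_prop) 0 le_rfl one_pos (by simp) K
  convert this using 2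
  simp [Prod.ext_iff]

/-- The quarter turn about the first horizontal axis. -/
theorem ambientIsotopic_rotate (K : Set Space) :
    AmbientIsotopic K ((fun p : Space => ((p.1.1, p.2), -p.1.2)) '' K) := by
  -- The quarter turn is a product of three shears: `(y, z) ↦ (y + z, z) ↦ (y + z, -y) ↦ (z, -y)`.
  have h1 := ambientIsotopic_push ((0, 1), 0) (fun p => p.2) (by fun_prop) 0 le_rfl one_pos
    (by simp) K
  have h2 := ambientIsotopic_shear (fun q => -q.2) (by fun_prop)
    ((fun p : Space => p + p.2 • (((0, 1), 0) : Space)) '' K)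
  have h3 := ambientIsotopic_push ((0, 1), 0) (fun p => p.2) (by fun_prop) 0 le_rfl one_pos
    (by simp) ((fun p : Space => (p.1, p.2 + -p.1.2)) ''
      ((fun p : Space => p + p.2 • (((0, 1), 0) : Space)) '' K))
  have := (h1.trans h2).trans h3
  rw [Set.image_image, Set.image_image] at this
  convert this using 2
  simp [Prod.ext_iff]

/-- A perturbation of the identity with Lipschitz constant less than one is an ambient isotopy. -/
theorem ambientIsotopic_perturb (D : Space → Space) (c : NNReal) (hc : c < 1)
    (hD : LipschitzWith c D) (K : Set Space) :
    AmbientIsotopic K ((fun p => p + D p) '' K) := by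
  have hc' : (c : ℝ) < 1 := by exact_mod_cast hc
  have anti : ∀ (t : unitInterval) (p q : Space),
      (1 - c) * ‖p - q‖ ≤ ‖(p + (t : ℝ) • D p) - (q + (t : ℝ) • D q)‖ := by
    intro t p q
    have h1 : ‖(t : ℝ) • (D p - D q)‖ ≤ c * ‖p - q‖ := by
      rw [norm_smul, Real.norm_of_nonneg t.2.1]
      have := hD.norm_sub_le p q
      have h0 := norm_nonneg (D p - D q)
      nlinarith [t.2.1, t.2.2, mul_le_mul_of_nonneg_right t.2.2 h0]
    have h2 : (p + (t : ℝ) • D p) - (q + (t : ℝ) • D q) = (p - q) + (t : ℝ) • (D p - D q) := by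
      rw [smul_sub]; abel
    rw [h2]
    have := norm_sub_le_norm_add (p - q) ((t : ℝ) • (D p - D q))
    linarith
  have surj : ∀ t : unitInterval, Function.Surjective fun p : Space => p + (t : ℝ) • D p := by
    intro t
    -- The map differs from the identity by a `c`-Lipschitz map with `c < 1`, so the inverse
    -- function theorem in its quantitative form makes it surjective.
    have hA : ApproximatesLinearOn (fun p : Space => p + (t : ℝ) • D p)
        ((ContinuousLinearEquiv.refl ℝ Space : Space ≃L[ℝ] Space) : Space →L[ℝ] Space) univ c := by
      intro x _ y _
      have h2 : x + (t : ℝ) • D x - (y + (t : ℝ) • D y) -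
          ((ContinuousLinearEquiv.refl ℝ Space : Space ≃L[ℝ] Space) : Space →L[ℝ] Space) (x - y)
          = (t : ℝ) • (D x - D y) := by
        simp [smul_sub]; abel
      rw [h2, norm_smul, Real.norm_of_nonneg t.2.1]
      have := hD.norm_sub_le x y
      have h0 := norm_nonneg (D x - D y)
      nlinarith [t.2.1, t.2.2, mul_le_mul_of_nonneg_right t.2.2 h0]
    apply hA.surjective
    right
    have : ‖(((ContinuousLinearEquiv.refl ℝ Space).symm : Space ≃L[ℝ] Space) :
        Space →L[ℝ] Space)‖₊ = 1 := by
      rw [ContinuousLinearEquiv.refl_symm]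
      exact ContinuousLinearMap.nnnorm_id
    rw [this]; simpa using hc
  choose Ψ hΨ using surj
  have hl : ∀ (t : unitInterval) (x : Space), Ψ t (x + (t : ℝ) • D x) = x := by
    intro t x
    have := anti t (Ψ t (x + (t : ℝ) • D x)) x
    simp only [hΨ, sub_self, norm_zero] at this
    have h0 := norm_nonneg (Ψ t (x + (t : ℝ) • D x) - x)
    have : ‖Ψ t (x + (t : ℝ) • D x) - x‖ = 0 := by nlinarith
    exact sub_eq_zero.1 (norm_eq_zero.1 this)
  have hDc := hD.continuous
  have hc1 : Continuous fun q : unitInterval × Space => Ψ q.1 q.2 := by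
    rw [continuous_iff_continuousAt]
    intro q0
    rw [ContinuousAt, tendsto_iff_dist_tendsto_zero]
    have hg : Continuous fun q : unitInterval × Space =>
        ‖q.2 - (Ψ q0.1 q0.2 + (q.1 : ℝ) • D (Ψ q0.1 q0.2))‖ / (1 - c) := by
      fun_prop
    have hg0 := hg.tendsto q0
    simp only [hΨ, sub_self, norm_zero, zero_div] at hg0
    refine squeeze_zero (fun _ => dist_nonneg) (fun q => ?_) hg0
    rw [le_div_iff₀ (by linarith), mul_comm, dist_eq_norm]
    have := anti q.1 (Ψ q.1 q.2) (Ψ q0.1 q0.2)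
    simpa [hΨ] using this
  have := ambientIsotopic_of_family (fun t p => p + (t : ℝ) • D p) Ψ (by fun_prop) hc1 hl
    (fun t x => hΨ t x) (fun p => by simp) K
  simpa using this

/-- `K` enters the definition only through its isotopy to a polygon. This yields the invariance of
`cstr`. -/
theorem hasContainedStraightDiagram_iff {K L : Set Space} (h : AmbientIsotopic K L) (n : ℕ) :
    HasContainedStraightDiagram K n ↔ HasContainedStraightDiagram L n :=
  ⟨fun ⟨m, hm, v, k, h1, h2, h3⟩ => ⟨m, hm, v, k, h1, h.symm.trans h2, h3⟩,
    fun ⟨m, hm, v, k, h1, h2, h3⟩ => ⟨m, hm, v, k, h1, h.trans h2, h3⟩⟩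

/-! ### Polygonal paths -/

section Paths

variable {E F : Type*} [AddCommGroup E] [Module ℝ E] [AddCommGroup F] [Module ℝ F]

/-- The polygonal path with the given vertices, as a set. -/
def pathSet : List E → Set E
  | [] => ∅
  | [p] => {p}
  | p :: q :: L => segment ℝ p q ∪ pathSet (q :: L)

/-- The polygonal path with the given vertices is simple. -/
def IsArc : List E → Prop
  | [] => True
  | [_] => True
  | p :: q :: L => p ≠ q ∧ segment ℝ p q ∩ pathSet (q :: L) ⊆ {q} ∧ IsArc (q :: L)

@[simp] theorem pathSet_nil : pathSet ([] : List E) = ∅ := rfl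
@[simp] theorem pathSet_singleton (p : E) : pathSet [p] = {p} := rfl
@[simp] theorem pathSet_cons_cons (p q : E) (L : List E) :
    pathSet (p :: q :: L) = segment ℝ p q ∪ pathSet (q :: L) := rfl
@[simp] theorem isArc_singleton (p : E) : IsArc [p] := trivial
theorem isArc_cons_cons {p q : E} {L : List E} :
    IsArc (p :: q :: L) ↔ p ≠ q ∧ segment ℝ p q ∩ pathSet (q :: L) ⊆ {q} ∧ IsArc (q :: L) :=
  Iff.rfl

theorem head_mem_pathSet (p : E) (L : List E) : p ∈ pathSet (p :: L) := by
  cases L with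
  | nil => simp
  | cons q L => exact Or.inl (left_mem_segment ℝ p q)

theorem mem_pathSet_of_mem {p : E} {L : List E} (h : p ∈ L) : p ∈ pathSet L := by
  induction L with
  | nil => simp at h
  | cons q L ih =>
    rcases List.mem_cons.1 h with rfl | h
    · exact head_mem_pathSet _ _
    · cases L with
      | nil => simp at h
      | cons r L => exact Or.inr (ih h)

theorem pathSet_append (L M : List E) (p : E) :
    pathSet (L ++ p :: M) = pathSet (L ++ [p]) ∪ pathSet (p :: M) := by
  induction L with
  | nil =>
    simp only [List.nil_append, pathSet_singleton]
    rw [Set.union_eq_self_of_subset_left]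
    simpa using head_mem_pathSet p M
  | cons q L ih =>
    cases L with
    | nil =>
      simp only [List.nil_append, List.cons_append, pathSet_cons_cons, pathSet_singleton] at ih ⊢
      rw [Set.union_assoc, ← ih]
    | cons r L =>
      simp only [List.cons_append, pathSet_cons_cons] at ih ⊢
      rw [ih, Set.union_assoc]

theorem isArc_append {L M : List E} {p : E} :
    IsArc (L ++ p :: M) ↔ IsArc (L ++ [p]) ∧ IsArc (p :: M) ∧
      pathSet (L ++ [p]) ∩ pathSet (p :: M) ⊆ {p} := by
  induction L with
  | nil => simp
  | cons q L ih =>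
    cases L with
    | nil =>
      simp only [List.nil_append, List.cons_append, isArc_cons_cons, pathSet_cons_cons,
        pathSet_singleton, isArc_singleton, Set.union_inter_distrib_right, Set.union_subset_iff]
      constructor
      · rintro ⟨h1, h2, h3⟩
        exact ⟨⟨h1, inter_subset_right, trivial⟩, h3, h2, inter_subset_left⟩
      · rintro ⟨⟨h1, h2, -⟩, h3, h4, h5⟩
        exact ⟨h1, h4, h3⟩
    | cons r L =>
      have hp := pathSet_append (r :: L) M p
      simp only [List.cons_append] at ih hp ⊢
      simp only [isArc_cons_cons, pathSet_cons_cons, hp, ih, Set.inter_union_distrib_left,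
        Set.union_inter_distrib_right, Set.union_subset_iff]
      constructor
      · rintro ⟨h1, ⟨h2, h2'⟩, h3, h4, h5⟩
        refine ⟨⟨h1, h2, h3⟩, h4, fun x hx => ?_, h5⟩
        have hxr : x = r := h2' hx
        subst hxr
        exact h5 ⟨head_mem_pathSet _ _, hx.2⟩
      · rintro ⟨⟨h1, h2, h3⟩, h4, h5, h6⟩
        refine ⟨h1, ⟨h2, fun x hx => ?_⟩, h3, h4, h6⟩
        have hxp : x = p := h5 hx
        subst hxp
        exact h2 ⟨hx.1, mem_pathSet_of_mem (by simp)⟩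

theorem IsArc.nodup {L : List E} (h : IsArc L) : L.Nodup := by
  induction L with
  | nil => simp
  | cons p L ih =>
    cases L with
    | nil => simp
    | cons q L =>
      obtain ⟨h1, h2, h3⟩ := h
      refine List.nodup_cons.2 ⟨fun hp => h1 ?_, ih h3⟩
      exact h2 ⟨left_mem_segment ℝ p q, mem_pathSet_of_mem hp⟩

theorem pathSet_map (f : E →ₗ[ℝ] F) (L : List E) : pathSet (L.map f) = f '' pathSet L := by
  induction L with
  | nil => simp
  | cons p L ih =>
    cases L with
    | nil => simp
    | cons q L =>
      simp only [List.map_cons, pathSet_cons_cons] at ih ⊢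
      rw [ih, Set.image_union]
      congr 1
      exact (image_segment ℝ f.toAffineMap p q).symm

theorem exists_split_of_mem_pathSet {L : List E} {x : E} (hx : x ∈ pathSet L) (hx' : x ∉ L) :
    ∃ L₁ p q L₂, L = L₁ ++ p :: q :: L₂ ∧ x ∈ segment ℝ p q := by
  induction L with
  | nil => simp at hx
  | cons p L ih =>
    cases L with
    | nil => simp at hx hx'; exact absurd hx hx'
    | cons q L =>
      rcases hx with hx | hx
      · exact ⟨[], p, q, L, rfl, hx⟩
      · obtain ⟨L₁, r, s, L₂, h, h'⟩ := ih hx (fun h => hx' (List.mem_cons_of_mem _ h))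
        exact ⟨p :: L₁, r, s, L₂, by rw [h]; rfl, h'⟩

end Paths

section Topo

variable {E : Type*} [NormedAddCommGroup E] [NormedSpace ℝ E]

theorem isCompact_segment (p q : E) : IsCompact (segment ℝ p q) := by
  rw [segment_eq_image_lineMap]
  exact isCompact_Icc.image AffineMap.lineMap_continuous

theorem isCompact_pathSet (L : List E) : IsCompact (pathSet L) := by
  induction L with
  | nil => simp
  | cons p L ih =>
    cases L with
    | nil => simp
    | cons q L => exact (isCompact_segment p q).union ih

end Topo

/-! ### The triangle move -/

/-- Twice the signed area of a triangle in the plane. -/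
def side (p q x : ℝ × ℝ) : ℝ := (q.1 - p.1) * (x.2 - p.2) - (q.2 - p.2) * (x.1 - p.1)

theorem image_Icc_affine {E : Type*} [AddCommGroup E] [Module ℝ E] (A B : E) {x y : ℝ}
    (h : x ≤ y) : (fun t : ℝ => A + t • B) '' Icc x y = segment ℝ (A + x • B) (A + y • B) := by
  rw [← segment_eq_Icc h]
  have := image_segment ℝ (AffineMap.lineMap (k := ℝ) A (A + B)) x y
  rw [show (fun t : ℝ => A + t • B) = AffineMap.lineMap (k := ℝ) A (A + B) by
    ext t; simp [AffineMap.lineMap_apply, add_comm], this]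
  simp [AffineMap.lineMap_apply, add_comm]

/-- Affine coordinates in space adapted to two vectors with independent projections. -/
theorem exists_coordinates (o X Y : Space) (h : X.1.1 * Y.1.2 - X.1.2 * Y.1.1 ≠ 0) :
    ∃ α β ζ : Space → ℝ, Continuous α ∧ Continuous β ∧ Continuous ζ ∧
      (∀ p : Space, p = o + α p • X + β p • Y + ζ p • ((0, 1) : Space)) ∧
      (∀ (p : Space) (s : ℝ), α (p + s • Y) = α p ∧ β (p + s • Y) = β p + s ∧ ζ (p + s • Y) = ζ p) ∧
      ∀ x : ℝ, α (o + x • X) = x ∧ β (o + x • X) = 0 ∧ ζ (o + x • X) = 0 := by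
  set d := X.1.1 * Y.1.2 - X.1.2 * Y.1.1 with hd
  let α : Space → ℝ := fun p => ((p.1.1 - o.1.1) * Y.1.2 - (p.1.2 - o.1.2) * Y.1.1) / d
  let β : Space → ℝ := fun p => (X.1.1 * (p.1.2 - o.1.2) - X.1.2 * (p.1.1 - o.1.1)) / d
  have hα : ∀ (p : Space) (s : ℝ), α (p + s • Y) = α p := by
    intro p s; simp only [α, Prod.fst_add, Prod.snd_add, Prod.smul_fst, Prod.smul_snd, smul_eq_mul]
    congr 1; ring
  have hβ : ∀ (p : Space) (s : ℝ), β (p + s • Y) = β p + s := by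
    intro p s; simp only [β, Prod.fst_add, Prod.snd_add, Prod.smul_fst, Prod.smul_snd, smul_eq_mul]
    field_simp; rw [hd]; ring
  have hα' : ∀ x : ℝ, α (o + x • X) = x := by
    intro x; simp only [α, Prod.fst_add, Prod.snd_add, Prod.smul_fst, Prod.smul_snd, smul_eq_mul]
    field_simp; rw [hd]; ring
  have hβ' : ∀ x : ℝ, β (o + x • X) = 0 := by
    intro x; simp only [β, Prod.fst_add, Prod.snd_add, Prod.smul_fst, Prod.smul_snd, smul_eq_mul]
    field_simp; ring
  refine ⟨α, β, fun p => p.2 - o.2 - α p * X.2 - β p * Y.2, by fun_prop, by fun_prop,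
    by fun_prop, fun p => ?_, fun p s => ⟨hα p s, hβ p s, ?_⟩, fun x => ⟨hα' x, hβ' x, ?_⟩⟩
  · have e1 : p.1.1 = o.1.1 + α p * X.1.1 + β p * Y.1.1 := by
      simp only [α, β]; field_simp; rw [hd]; ring
    have e2 : p.1.2 = o.1.2 + α p * X.1.2 + β p * Y.1.2 := by
      simp only [α, β]; field_simp; rw [hd]; ring
    refine Prod.ext (Prod.ext ?_ ?_) ?_
    · simpa using e1
    · simpa using e2
    · simp
  · simp only [hα, hβ, Prod.snd_add, Prod.smul_snd, smul_eq_mul]; ring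
  · simp only [hα', hβ', Prod.snd_add, Prod.smul_snd, smul_eq_mul]; ring

/-- The elementary move: a subsegment of an edge is replaced by the other two sides of a triangle
which does not meet the rest of the knot. -/
theorem ambientIsotopic_triangle {r₁ r₂ W : Space} {s s' : ℝ} {K : Set Space}
    (hK : IsCompact K) (hs : s ≤ 0) (hs' : 1 ≤ s') (hW : side r₁.1 r₂.1 W.1 ≠ 0)
    (htri : ∀ a b c : ℝ, 0 ≤ a → 0 ≤ b → 0 ≤ c → a + b + c = 1 → a • r₁ + b • W + c • r₂ ∉ K) :
    AmbientIsotopic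
      (K ∪ segment ℝ (AffineMap.lineMap r₁ r₂ s) (AffineMap.lineMap r₁ r₂ s'))
      (K ∪ (segment ℝ (AffineMap.lineMap r₁ r₂ s) r₁ ∪ segment ℝ r₁ W ∪ segment ℝ W r₂ ∪
        segment ℝ r₂ (AffineMap.lineMap r₁ r₂ s'))) := by
  -- In coordinates `α, β, ζ` with origin at the midpoint of `r₁ r₂` and axes `X`, `Y` and the
  -- vertical, the triangle is `ζ = 0`, `0 ≤ β ≤ 1 - |α|`. The move is a push along `Y`.
  set o : Space := (1 / 2 : ℝ) • (r₁ + r₂) with ho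
  set X : Space := (1 / 2 : ℝ) • (r₂ - r₁) with hX
  set Y : Space := W - o with hY
  have e1 : r₁ = o + (-1 : ℝ) • X := by rw [ho, hX]; module
  have e2 : r₂ = o + (1 : ℝ) • X := by rw [ho, hX]; module
  have e3 : W = o + Y := by rw [hY]; abel
  have el : ∀ t : ℝ, AffineMap.lineMap r₁ r₂ t = o + (2 * t - 1) • X := by
    intro t; rw [AffineMap.lineMap_apply_module', ho, hX]; module
  have hXY : X.1.1 * Y.1.2 - X.1.2 * Y.1.1 ≠ 0 := by
    intro h; apply hW
    rw [e1, e2, e3]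
    simp only [side, Prod.fst_add, Prod.snd_add, Prod.smul_fst, Prod.smul_snd, smul_eq_mul]
    linear_combination 2 * h
  obtain ⟨α, β, ζ, hα, hβ, hζ, hco, hpush, hax⟩ := exists_coordinates o X Y hXY
  -- a uniform gap between the triangle and the rest
  obtain ⟨δ, hδ0, hδ⟩ : ∃ δ : ℝ, 0 < δ ∧ ∀ p ∈ K,
      δ ≤ max |ζ p| (max (-β p) (β p - (1 - |α p|))) := by
    rcases K.eq_empty_or_nonempty with rfl | hne
    · exact ⟨1, one_pos, by simp⟩
    obtain ⟨p, hp, hmin⟩ := hK.exists_isMinOn hne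
      (f := fun p => max |ζ p| (max (-β p) (β p - (1 - |α p|)))) (by fun_prop)
    refine ⟨_, ?_, fun q hq => hmin hq⟩
    by_contra hcon
    push Not at hcon
    simp only [max_le_iff, abs_nonpos_iff] at hcon
    obtain ⟨h1, h2, h3⟩ := hcon
    have h4 := abs_le.1 (show |α p| ≤ 1 - β p by linarith)
    apply htri ((1 - β p - α p) / 2) (β p) ((1 - β p + α p) / 2) (by linarith) (by linarith)
      (by linarith) (by ring)
    convert hp using 1
    conv_rhs => rw [hco p, h1]
    rw [e1, e2, e3]; module
  set η : ℝ := min 1 (δ / 2) with hη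
  have hη0 : 0 < η := by positivity
  have hη1 : η ≤ 1 := min_le_left _ _
  have hη2 : 2 * η ≤ δ := by have := min_le_right 1 (δ / 2); linarith
  -- A tent: `max 0 (1 - |α|)` on the axis, zero outside a small neighbourhood of the triangle. With
  -- descent rate `1 / (1 + η)` along `Y`, it vanishes slightly beyond the sides through `W`;
  -- vanishing exactly on them would require the rate `1`, which a push does not allow.
  set D : Space → ℝ := fun p =>
    max 0 (min (1 - |α p| + β p / η) (1 - |α p| - β p / (1 + η)) - |ζ p| / η) with hD
  have hDc : Continuous D := by fun_prop
  have hDK : ∀ p ∈ K, D p = 0 := by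
    intro p hp
    rw [hD]; apply max_eq_left
    by_contra hcon
    push Not at hcon
    rw [sub_pos, lt_min_iff] at hcon
    obtain ⟨h1, h2⟩ := hcon
    have hz : 0 ≤ |ζ p| / η := by positivity
    have hz' : |ζ p| = η * (|ζ p| / η) := by field_simp
    have hb' : β p = η * (β p / η) := by field_simp
    have hb2 : β p = (1 + η) * (β p / (1 + η)) := by field_simp
    have ha := abs_nonneg (α p)
    set z := |ζ p| / η
    set b1 := β p / η
    set b2 := β p / (1 + η)
    have hm : 0 < 1 - |α p| := by
      by_contra hneg; push Not at hneg
      have : 0 < b1 := by linarith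
      have : b2 < 0 := by linarith
      nlinarith
    have k1 : -β p < η := by nlinarith
    have k2 : β p - (1 - |α p|) < η := by nlinarith
    have k3 : |ζ p| < 2 * η := by
      have : -b2 < η := by nlinarith
      nlinarith
    have := hδ p hp
    have : max |ζ p| (max (-β p) (β p - (1 - |α p|))) < 2 * η :=
      max_lt k3 (max_lt (by linarith) (by linarith))
    linarith
  have hDax : ∀ x : ℝ, D (o + x • X) = max 0 (1 - |x|) := by
    intro x
    obtain ⟨h1, h2, h3⟩ := hax x
    simp [hD, h1, h2, h3]
  have hDmono : ∀ p s, 0 ≤ s → D p - 1 / (1 + η) * s ≤ D (p + s • Y) := by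
    intro p s hs
    obtain ⟨h1, h2, h3⟩ := hpush p s
    simp only [hD, h1, h2, h3]
    have hq : 0 ≤ s / η := by positivity
    have hq' : 0 ≤ 1 / (1 + η) * s := by positivity
    have a1 : (β p + s) / η = β p / η + s / η := by ring
    have a2 : (β p + s) / (1 + η) = β p / (1 + η) + 1 / (1 + η) * s := by ring
    rw [a1, a2]
    have : min (1 - |α p| + β p / η) (1 - |α p| - β p / (1 + η)) - 1 / (1 + η) * s ≤
        min (1 - |α p| + (β p / η + s / η)) (1 - |α p| - (β p / (1 + η) + 1 / (1 + η) * s)) := by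
      refine le_min ?_ ?_
      · linarith [min_le_left (1 - |α p| + β p / η) (1 - |α p| - β p / (1 + η))]
      · linarith [min_le_right (1 - |α p| + β p / η) (1 - |α p| - β p / (1 + η))]
    rw [sub_le_iff_le_add]
    refine max_le ?_ ?_
    · linarith [le_max_left 0 (min (1 - |α p| + (β p / η + s / η))
        (1 - |α p| - (β p / (1 + η) + 1 / (1 + η) * s)) - |ζ p| / η)]
    · linarith [le_max_right 0 (min (1 - |α p| + (β p / η + s / η))
        (1 - |α p| - (β p / (1 + η) + 1 / (1 + η) * s)) - |ζ p| / η)]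
  have hθ : 1 / (1 + η) < 1 := by rw [div_lt_one (by linarith)]; linarith
  have main := ambientIsotopic_push Y D hDc (1 / (1 + η)) (by positivity) hθ hDmono
    (K ∪ segment ℝ (AffineMap.lineMap r₁ r₂ s) (AffineMap.lineMap r₁ r₂ s'))
  convert main using 1
  rw [Set.image_union]
  congr 1
  · ext q
    constructor
    · intro hq; exact ⟨q, hq, by simp [hDK q hq]⟩
    · rintro ⟨p, hp, rfl⟩; simpa [hDK p hp] using hp
  · have hx1 : 2 * s - 1 ≤ -1 := by linarith
    have hx2 : 1 ≤ 2 * s' - 1 := by linarith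
    rw [el s, el s', ← image_Icc_affine o X (by linarith : 2 * s - 1 ≤ 2 * s' - 1),
      Set.image_image]
    -- The axis is cut at `-1, 0, 1`, where the tent bends; the four pieces are mapped to the four
    -- segments of the new path.
    rw [← Icc_union_Icc_eq_Icc (by linarith : 2 * s - 1 ≤ 1) hx2,
      ← Icc_union_Icc_eq_Icc (by linarith : 2 * s - 1 ≤ 0) (zero_le_one' ℝ),
      ← Icc_union_Icc_eq_Icc hx1 (by norm_num : (-1 : ℝ) ≤ 0)]
    simp only [Set.image_union]
    congr 1
    · congr 1
      · congr 1
        · rw [e1, ← image_Icc_affine o X hx1]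
          refine Set.image_congr fun x hx => ?_
          rw [hDax, abs_of_nonpos (by linarith [hx.2]), max_eq_left (by linarith [hx.2])]; simp
        · have h2 := image_Icc_affine (o + Y) (X + Y) (by norm_num : (-1 : ℝ) ≤ 0)
          have e4 : r₁ = (o + Y) + (-1 : ℝ) • (X + Y) := by rw [e1]; module
          have e5 : W = (o + Y) + (0 : ℝ) • (X + Y) := by rw [e3]; module
          rw [← e4, ← e5] at h2
          rw [← h2]
          refine Set.image_congr fun x hx => ?_
          rw [hDax, abs_of_nonpos hx.2, max_eq_right (by linarith [hx.1])]; module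
      · have h2 := image_Icc_affine (o + Y) (X - Y) (zero_le_one' ℝ)
        have e4 : r₂ = (o + Y) + (1 : ℝ) • (X - Y) := by rw [e2]; module
        have e5 : W = (o + Y) + (0 : ℝ) • (X - Y) := by rw [e3]; module
        rw [← e4, ← e5] at h2
        rw [← h2]
        refine Set.image_congr fun x hx => ?_
        rw [hDax, abs_of_nonneg hx.1, max_eq_right (by linarith [hx.2])]; module
    · conv_lhs => rw [e2]
      rw [← image_Icc_affine o X hx2]
      refine Set.image_congr fun x hx => ?_
      rw [hDax, abs_of_nonneg (by linarith [hx.1]), max_eq_left (by linarith [hx.1])]; simp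

/-- On the compact part of `C` where `f ≤ 0`, the function `l` is positive, hence bounded below by a
positive constant, and `f` is bounded below. Elsewhere any `H ≥ 0` will do. -/
theorem exists_large_of_compact {T : Type*} [TopologicalSpace T] {C : Set T} (hC : IsCompact C)
    {f l : T → ℝ} (hf : Continuous f) (hl : Continuous l) (hl0 : ∀ x ∈ C, 0 ≤ l x)
    (h : ∀ x ∈ C, l x = 0 → 0 < f x) : ∃ H : ℝ, ∀ x ∈ C, 0 < f x + l x * H := by
  have hC' : IsCompact (C ∩ {x | f x ≤ 0}) := hC.inter_right (isClosed_le hf continuous_const)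
  rcases (C ∩ {x | f x ≤ 0}).eq_empty_or_nonempty with he | hne
  · refine ⟨0, fun x hx => ?_⟩
    by_contra hcon
    have : x ∈ C ∩ {x | f x ≤ 0} := ⟨hx, by simpa using hcon⟩
    rw [he] at this; exact this
  obtain ⟨x0, hx0, hmin⟩ := hC'.exists_isMinOn hne hl.continuousOn
  obtain ⟨x1, hx1, hmin1⟩ := hC'.exists_isMinOn hne hf.continuousOn
  have hl0' : 0 < l x0 := by
    refine lt_of_le_of_ne (hl0 _ hx0.1) fun h' => ?_
    have := h x0 hx0.1 h'.symm
    exact absurd hx0.2 (not_le.2 this)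
  have hf1 : f x1 ≤ 0 := hx1.2
  refine ⟨(1 - f x1) / l x0, fun x hx => ?_⟩
  have hH : 0 ≤ (1 - f x1) / l x0 := div_nonneg (by linarith) hl0'.le
  by_cases hfx : f x ≤ 0
  · have h1 : l x0 ≤ l x := hmin ⟨hx, hfx⟩
    have h2 : f x1 ≤ f x := hmin1 ⟨hx, hfx⟩
    have h3 : l x0 * ((1 - f x1) / l x0) = 1 - f x1 := by field_simp
    nlinarith [mul_le_mul_of_nonneg_right h1 hH]
  · push Not at hfx
    have := mul_nonneg (hl0 x hx) hH
    linarith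

/-- A triangle with one very high (or very low) vertex avoids a compact set which lies below
(or above) the opposite side. -/
theorem exists_height {K : Set Space} (hK : IsCompact K) (r₁ r₂ : Space) (W : ℝ × ℝ)
    (σ : ℝ) (hσ : σ = 1 ∨ σ = -1)
    (h : ∀ k ∈ K, ∀ a c : ℝ, 0 ≤ a → 0 ≤ c → a + c = 1 → k.1 = a • r₁.1 + c • r₂.1 →
      0 < σ * (a * r₁.2 + c * r₂.2 - k.2)) :
    ∃ H : ℝ, ∀ a b c : ℝ, 0 ≤ a → 0 ≤ b → 0 ≤ c → a + b + c = 1 →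
      a • r₁ + b • ((W, H) : Space) + c • r₂ ∉ K := by
  -- Points of `K` together with barycentric coordinates of their projection in the projected
  -- triangle. The height of the third vertex counts with the factor `b`; where `b = 0`, the point
  -- lies over the opposite side and `h` applies.
  let C : Set (Space × ℝ × ℝ × ℝ) :=
    (K ×ˢ (Icc 0 1 ×ˢ (Icc 0 1 ×ˢ Icc 0 1))) ∩
      {x | x.2.1 + x.2.2.1 + x.2.2.2 = 1 ∧
        x.1.1 = x.2.1 • r₁.1 + x.2.2.1 • W + x.2.2.2 • r₂.1}
  have hC : IsCompact C := by
    refine (hK.prod (isCompact_Icc.prod (isCompact_Icc.prod isCompact_Icc))).inter_right ?_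
    exact (isClosed_eq (by fun_prop) (by fun_prop)).inter (isClosed_eq (by fun_prop) (by fun_prop))
  obtain ⟨H, hH⟩ := exists_large_of_compact hC
    (f := fun x => σ * (x.2.1 * r₁.2 + x.2.2.2 * r₂.2 - x.1.2)) (l := fun x => x.2.2.1)
    (by fun_prop) (by fun_prop) (fun x hx => hx.1.2.2.1.1) (by
      rintro ⟨k, a, b, c⟩ ⟨⟨hk, ha, hb, hc⟩, h1, h2⟩ h0
      dsimp only at *
      subst h0
      refine h k hk a c ha.1 hc.1 (by linarith) (by simpa using h2))
  refine ⟨σ * H, fun a b c ha hb hc habc hk => ?_⟩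
  have := hH (a • r₁ + b • ((W, σ * H) : Space) + c • r₂, a, b, c)
    ⟨⟨hk, ⟨ha, by linarith⟩, ⟨hb, by linarith⟩, ⟨hc, by linarith⟩⟩, habc, by simp⟩
  simp only [Prod.snd_add, Prod.smul_snd, smul_eq_mul] at this
  rcases hσ with rfl | rfl <;> linarith

/-! ### Lines and paths in the plane -/

theorem mem_segment_iff_lineMap {E : Type*} [AddCommGroup E] [Module ℝ E] {p q x : E} :
    x ∈ segment ℝ p q ↔ ∃ t : ℝ, 0 ≤ t ∧ t ≤ 1 ∧ AffineMap.lineMap p q t = x := by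
  rw [segment_eq_image_lineMap]
  simp [and_assoc]

theorem side_lineMap (u v p q : ℝ × ℝ) (t : ℝ) :
    side u v (AffineMap.lineMap p q t) = (1 - t) * side u v p + t * side u v q := by
  simp only [side, AffineMap.lineMap_apply_module', Prod.fst_add, Prod.snd_add, Prod.smul_fst,
    Prod.smul_snd, Prod.fst_sub, Prod.snd_sub, smul_eq_mul]
  ring

@[simp] theorem side_left (u v : ℝ × ℝ) : side u v u = 0 := by simp [side]
@[simp] theorem side_right (u v : ℝ × ℝ) : side u v v = 0 := by simp [side]; ring

theorem side_eq_zero_of_mem {u v x : ℝ × ℝ} (h : x ∈ segment ℝ u v) : side u v x = 0 := by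
  obtain ⟨t, -, -, rfl⟩ := mem_segment_iff_lineMap.1 h
  simp [side_lineMap]

theorem affine_zero_unique {a b t t' : ℝ} (hab : a ≠ 0 ∨ b ≠ 0) (h : (1 - t) * a + t * b = 0)
    (h' : (1 - t') * a + t' * b = 0) : t = t' := by
  have h1 : (t - t') * (b - a) = 0 := by linear_combination h - h'
  rcases mul_eq_zero.1 h1 with h2 | h2
  · linarith
  · exfalso
    have e : b = a := by linarith
    subst e
    have : b = 0 := by linarith
    simp [this] at hab

theorem lineMap_inj {E : Type*} [AddCommGroup E] [Module ℝ E] {p q : E}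
    (h : p ≠ q) {t t' : ℝ} (e : AffineMap.lineMap p q t = AffineMap.lineMap p q t') : t = t' :=
  AffineMap.lineMap_injective ℝ h e

theorem finite_line_inter_pathSet (u v : ℝ × ℝ) (p : ℝ × ℝ) (L : List (ℝ × ℝ))
    (h : ∀ q ∈ L, side u v q ≠ 0) : ({x | side u v x = 0} ∩ pathSet (p :: L)).Finite := by
  induction L generalizing p with
  | nil => exact (Set.finite_singleton p).subset (by simp)
  | cons q L ih =>
    rw [pathSet_cons_cons, Set.inter_union_distrib_left]
    refine Set.Finite.union ?_ (ih q fun r hr => h r (List.mem_cons_of_mem _ hr))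
    apply Set.Subsingleton.finite
    rintro x ⟨hx, hx'⟩ y ⟨hy, hy'⟩
    obtain ⟨t, -, -, rfl⟩ := mem_segment_iff_lineMap.1 hx'
    obtain ⟨t', -, -, rfl⟩ := mem_segment_iff_lineMap.1 hy'
    rw [Set.mem_ofPred_eq, side_lineMap] at hx hy
    rw [affine_zero_unique (Or.inr (h q (by simp))) hx hy]

/-- The point moves along a parabola starting at `W₀`. A line contains only finitely many points of
it, whatever its direction, so finitely many lines exclude only finitely many parameters. -/
theorem exists_small_generic {ι : Type*} (s : Finset ι) (u v : ι → ℝ × ℝ)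
    (h : ∀ i ∈ s, u i ≠ v i) (W₀ : ℝ × ℝ) {ρ : ℝ} (hρ : 0 < ρ) :
    ∃ W, dist W W₀ < ρ ∧ ∀ i ∈ s, side (u i) (v i) W ≠ 0 := by
  have hfin : ∀ i ∈ s, {t : ℝ | side (u i) (v i) (W₀ + (t, t ^ 2)) = 0}.Finite := by
    intro i hi
    set d1 := (v i).1 - (u i).1
    set d2 := (v i).2 - (u i).2
    let P : Polynomial ℝ := Polynomial.C d1 * Polynomial.X ^ 2 + Polynomial.C (-d2) * Polynomial.X
      + Polynomial.C (d1 * (W₀.2 - (u i).2) - d2 * (W₀.1 - (u i).1))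
    have hP : P ≠ 0 := by
      intro h0
      have c2 := congrArg (fun p => Polynomial.coeff p 2) h0
      have c1 := congrArg (fun p => Polynomial.coeff p 1) h0
      simp [P, Polynomial.coeff_C] at c1 c2
      exact h i hi (Prod.ext (by linarith) (by linarith))
    refine (P.roots.toFinset.finite_toSet).subset fun t ht => ?_
    simp only [Finset.mem_coe, Multiset.mem_toFinset, Polynomial.mem_roots hP, Polynomial.IsRoot]
    simp only [side, Set.mem_ofPred_eq, Prod.fst_add, Prod.snd_add] at ht
    simp only [P, Polynomial.eval_add, Polynomial.eval_mul, Polynomial.eval_C, Polynomial.eval_pow,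
      Polynomial.eval_X]
    linear_combination ht
  have hall : (⋃ i ∈ s, {t : ℝ | side (u i) (v i) (W₀ + (t, t ^ 2)) = 0}).Finite :=
    s.finite_toSet.biUnion hfin
  have hr : 0 < min ρ 1 := by positivity
  obtain ⟨t, ht, ht'⟩ := ((Set.Ioo_infinite hr).sdiff hall).nonempty
  refine ⟨W₀ + (t, t ^ 2), ?_, fun i hi h0 => ht' (by simp only [Set.mem_iUnion]; exact ⟨i, hi, h0⟩)⟩
  have h1 : t < 1 := ht.2.trans_le (min_le_right _ _)
  have h2 : t < ρ := ht.2.trans_le (min_le_left _ _)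
  rw [dist_eq_norm, add_sub_cancel_left, Prod.norm_def, max_lt_iff]
  simp only [Real.norm_eq_abs, abs_of_pos ht.1, abs_of_pos (pow_pos ht.1 2)]
  exact ⟨h2, by nlinarith [ht.1]⟩

theorem segment_lineMap_subset {E : Type*} [AddCommGroup E] [Module ℝ E] {p q : E}
    {t t' : ℝ} (h : t ≤ t') {x : E}
    (hx : x ∈ segment ℝ (AffineMap.lineMap p q t) (AffineMap.lineMap p q t')) :
    ∃ s, t ≤ s ∧ s ≤ t' ∧ x = AffineMap.lineMap p q s := by
  obtain ⟨s, hs0, hs1, rfl⟩ := mem_segment_iff_lineMap.1 hx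
  refine ⟨t + s * (t' - t), by nlinarith, by nlinarith, ?_⟩
  simp only [AffineMap.lineMap_apply_module']
  module

/-- Replacing the middle part of an edge of a planar arc by the two other sides of a triangle. -/
theorem isArc_detour {L₁ L₂ : List (ℝ × ℝ)} {P P' W : ℝ × ℝ} {t₁ t₂ : ℝ}
    (h : IsArc (L₁ ++ P :: P' :: L₂)) (h0 : 0 < t₁) (h12 : t₁ < t₂) (h1 : t₂ < 1)
    (hW : side P P' W ≠ 0)
    (hd : ∀ x, x ∈ segment ℝ (AffineMap.lineMap P P' t₁) W ∪
      segment ℝ W (AffineMap.lineMap P P' t₂) →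
      x ∉ pathSet (L₁ ++ [P]) ∪ pathSet (P' :: L₂)) :
    IsArc (L₁ ++ P :: AffineMap.lineMap P P' t₁ :: W :: AffineMap.lineMap P P' t₂ :: P' :: L₂) := by
  obtain ⟨hA1, hA2, hA3⟩ := isArc_append.1 h
  obtain ⟨hne, hA4, hA5⟩ := hA2
  set r₁ := AffineMap.lineMap P P' t₁ with hr₁
  set r₂ := AffineMap.lineMap P P' t₂ with hr₂
  have s0 : P = AffineMap.lineMap P P' (0 : ℝ) := by simp
  have s1 : P' = AffineMap.lineMap P P' (1 : ℝ) := by simp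
  have left_mem : ∀ x ∈ segment ℝ P r₁, ∃ s, 0 ≤ s ∧ s ≤ t₁ ∧ x = AffineMap.lineMap P P' s := by
    intro x hx
    have hx' : x ∈ segment ℝ (AffineMap.lineMap P P' (0 : ℝ)) (AffineMap.lineMap P P' t₁) := by
      rwa [← s0]
    exact segment_lineMap_subset h0.le hx'
  have right_mem : ∀ x ∈ segment ℝ r₂ P', ∃ s, t₂ ≤ s ∧ s ≤ 1 ∧ x = AffineMap.lineMap P P' s := by
    intro x hx
    have hx' : x ∈ segment ℝ (AffineMap.lineMap P P' t₂) (AffineMap.lineMap P P' (1 : ℝ)) := by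
      rwa [← s1]
    exact segment_lineMap_subset h1.le hx'
  have line_mem : ∀ s : ℝ, 0 ≤ s → s ≤ 1 → AffineMap.lineMap P P' s ∈ segment ℝ P P' :=
    fun s hs hs' => mem_segment_iff_lineMap.2 ⟨s, hs, hs', rfl⟩
  have hside : ∀ s : ℝ, side P P' (AffineMap.lineMap P P' s) = 0 := by
    intro s; simp [side_lineMap]
  -- points of the detour
  have n1_mem : ∀ x ∈ segment ℝ r₁ W, side P P' x = 0 → x = r₁ := by
    intro x hx h0
    obtain ⟨t, -, -, rfl⟩ := mem_segment_iff_lineMap.1 hx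
    rw [side_lineMap, hside, mul_zero, zero_add] at h0
    rcases mul_eq_zero.1 h0 with h | h
    · simp [h]
    · exact absurd h hW
  have n2_mem : ∀ x ∈ segment ℝ W r₂, side P P' x = 0 → x = r₂ := by
    intro x hx h0
    rw [segment_symm] at hx
    obtain ⟨t, -, -, rfl⟩ := mem_segment_iff_lineMap.1 hx
    rw [side_lineMap, hside, mul_zero, zero_add] at h0
    rcases mul_eq_zero.1 h0 with h | h
    · simp [h]
    · exact absurd h hW
  have hr12 : r₁ ≠ r₂ := fun e => h12.ne (lineMap_inj hne e)
  have n12 : ∀ x ∈ segment ℝ r₁ W, x ∈ segment ℝ W r₂ → x = W := by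
    intro x hx hx'
    rw [segment_symm] at hx'
    obtain ⟨t, -, -, rfl⟩ := mem_segment_iff_lineMap.1 hx
    obtain ⟨t', -, -, e⟩ := mem_segment_iff_lineMap.1 hx'
    have e' := congrArg (side P P') e
    simp only [side_lineMap, hr₁, hr₂, side_left, side_right, mul_zero, zero_add, add_zero] at e'
    have ett : t' = t := mul_right_cancel₀ hW e'
    subst ett
    have : (1 - t') • (r₂ - r₁) = 0 := by
      simp only [AffineMap.lineMap_apply_module'] at e
      have h3 : (t' • (W - r₂) + r₂) - (t' • (W - r₁) + r₁) = 0 := by rw [e, sub_self]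
      rw [← h3]; module
    rcases smul_eq_zero.1 this with h | h
    · rw [show t' = 1 by linarith]; simp
    · exact absurd (sub_eq_zero.1 h).symm hr12
  have hX2 : ∀ x ∈ pathSet (P' :: L₂), x ∈ segment ℝ P P' → x = P' := fun x hx hx' => hA4 ⟨hx', hx⟩
  have hX1 : ∀ x ∈ pathSet (L₁ ++ [P]), x ∈ segment ℝ P P' → x = P :=
    fun x hx hx' => hA3 ⟨hx, Or.inl hx'⟩
  have hWr1 : r₁ ≠ W := by rintro e; apply hW; rw [← e, hside]
  have hWr2 : W ≠ r₂ := by rintro e; apply hW; rw [e, hside]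
  refine isArc_append.2 ⟨hA1, ?_, ?_⟩
  · refine isArc_cons_cons.2 ⟨?_, ?_, isArc_cons_cons.2 ⟨hWr1, ?_, isArc_cons_cons.2 ⟨hWr2, ?_,
      isArc_cons_cons.2 ⟨?_, ?_, hA5⟩⟩⟩⟩
    · intro e
      have := lineMap_inj hne (s0.symm.trans e)
      linarith
    · rintro x ⟨hx, hx'⟩
      obtain ⟨s, hs0, hs1, rfl⟩ := left_mem x hx
      simp only [pathSet_cons_cons, Set.mem_union] at hx'
      rcases hx' with hx' | hx' | hx' | hx'
      · exact n1_mem _ hx' (hside s)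
      · have := lineMap_inj hne (n2_mem _ hx' (hside s)); linarith
      · obtain ⟨s', h3, h4, h5⟩ := right_mem _ hx'
        have := lineMap_inj hne h5; linarith
      · have := hX2 _ hx' (line_mem s hs0 (by linarith))
        have := lineMap_inj hne (this.trans s1); linarith
    · rintro x ⟨hx, hx'⟩
      simp only [pathSet_cons_cons, Set.mem_union] at hx'
      rcases hx' with hx' | hx' | hx'
      · exact n12 x hx hx'
      · obtain ⟨s', h3, h4, rfl⟩ := right_mem _ hx'
        have := lineMap_inj hne (n1_mem _ hx (hside s')); linarith
      · exact absurd (Or.inr hx') (hd x (Or.inl hx))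
    · rintro x ⟨hx, hx'⟩
      simp only [pathSet_cons_cons, Set.mem_union] at hx'
      rcases hx' with hx' | hx'
      · obtain ⟨s', h3, h4, rfl⟩ := right_mem _ hx'
        exact n2_mem _ hx (hside s')
      · exact absurd (Or.inr hx') (hd x (Or.inr hx))
    · intro e
      have := lineMap_inj hne (e.trans s1)
      linarith
    · rintro x ⟨hx, hx'⟩
      obtain ⟨s', h3, h4, rfl⟩ := right_mem _ hx
      exact hX2 _ hx' (line_mem s' (by linarith) h4)
  · rintro x ⟨hx, hx'⟩
    simp only [pathSet_cons_cons, Set.mem_union] at hx'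
    rcases hx' with hx' | hx' | hx' | hx' | hx'
    · obtain ⟨s, hs0, hs1, rfl⟩ := left_mem x hx'
      exact hX1 _ hx (line_mem s hs0 (by linarith))
    · exact absurd (Or.inl hx) (hd x (Or.inl hx'))
    · exact absurd (Or.inl hx) (hd x (Or.inr hx'))
    · obtain ⟨s', h3, h4, rfl⟩ := right_mem _ hx'
      exact hX1 _ hx (line_mem s' (by linarith) h4)
    · exact hA3 ⟨hx, Or.inr hx'⟩

/-! ### Absorbing the edges into a return path -/

/-- A closed polygon with vertices `w 0, …, w n` in general position with respect to the
projection to the plane. -/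
structure IsGeneric (w : ℕ → Space) (n : ℕ) : Prop where
  two_le : 2 ≤ n
  closed : w (n + 1) = w 0
  off : ∀ i ≤ n, ∀ k ≤ n, k ≠ i → k ≠ i + 1 → ¬(i = n ∧ k = 0) →
    side (w i).1 (w (i + 1)).1 (w k).1 ≠ 0
  triple : ∀ i k l, i < k → k < l → l ≤ n → ∀ x : ℝ × ℝ, x ∈ segment ℝ (w i).1 (w (i + 1)).1 →
    x ∈ segment ℝ (w k).1 (w (k + 1)).1 → x ∉ segment ℝ (w l).1 (w (l + 1)).1
  simple : ∀ i k, i < k → k ≤ n → ∀ x ∈ segment ℝ (w i) (w (i + 1)),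
    x ∈ segment ℝ (w k) (w (k + 1)) → (k = i + 1 ∧ x = w k) ∨ (i = 0 ∧ k = n ∧ x = w 0)

/-- The first `j` edges. -/
def initialEdges (w : ℕ → Space) (j : ℕ) : Set Space := ⋃ i < j, segment ℝ (w i) (w (i + 1))

/-- A path from `w j` back to `w 0` with injective projection, in general position with respect
to the first `j` edges. -/
structure IsReturn (w : ℕ → Space) (j : ℕ) (T : List Space) : Prop where
  head : T.head? = some (w j)
  last : T.getLast? = some (w 0)
  arc : IsArc (T.map Prod.fst)
  off : ∀ p ∈ T, p ≠ w j → p ≠ w 0 → ∀ i < j, side (w i).1 (w (i + 1)).1 p.1 ≠ 0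
  triple : ∀ i k, i < k → k < j → ∀ x : ℝ × ℝ, x ∈ segment ℝ (w i).1 (w (i + 1)).1 →
    x ∈ segment ℝ (w k).1 (w (k + 1)).1 → x ∉ pathSet (T.map Prod.fst)
  disj : ∀ i < j, ∀ x ∈ segment ℝ (w i) (w (i + 1)), x ∈ pathSet T → x = w 0 ∨ x = w j

theorem IsGeneric.ne {w : ℕ → Space} {n : ℕ} (h : IsGeneric w n) {i : ℕ} (hi : i < n) :
    (w i).1 ≠ (w (i + 1)).1 := by
  intro e
  have h2 := h.two_le
  rcases Nat.eq_zero_or_pos i with rfl | hp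
  · refine h.off 0 (by omega) 2 h2 (by omega) (by omega) (by omega) ?_
    rw [e]; simp [side]
  · refine h.off i (by omega) 0 (by omega) (by omega) (by omega) (by omega) ?_
    rw [e]; simp [side]

theorem fst_mem_segment {p q x : Space} (h : x ∈ segment ℝ p q) :
    x.1 ∈ segment ℝ p.1 q.1 := by
  obtain ⟨t, h0, h1, rfl⟩ := mem_segment_iff_lineMap.1 h
  exact mem_segment_iff_lineMap.2 ⟨t, h0, h1, by simp⟩

theorem pathSet_map_fst (L : List Space) : pathSet (L.map Prod.fst) = Prod.fst '' pathSet L :=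
  pathSet_map (LinearMap.fst ℝ (ℝ × ℝ) ℝ) L

theorem finite_initialEdges_isCompact (w : ℕ → Space) (j : ℕ) : IsCompact (initialEdges w j) :=
  (Set.finite_lt_nat j).isCompact_biUnion fun _ _ => isCompact_segment _ _

theorem dist_lineMap_lineMap_le {E : Type*} [NormedAddCommGroup E] [NormedSpace ℝ E]
    {a b a' b' : E} {ρ t : ℝ} (ha : dist a a' < ρ) (hb : dist b b' < ρ) (h0 : 0 ≤ t)
    (h1 : t ≤ 1) : dist (AffineMap.lineMap a b t) (AffineMap.lineMap a' b' t) < ρ := by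
  rw [dist_eq_norm] at *
  have e : AffineMap.lineMap a b t - AffineMap.lineMap a' b' t
      = (1 - t) • (a - a') + t • (b - b') := by
    simp only [AffineMap.lineMap_apply_module']; module
  rw [e]
  refine (norm_add_le _ _).trans_lt ?_
  rw [norm_smul, norm_smul, Real.norm_of_nonneg h0, Real.norm_of_nonneg (by linarith)]
  rcases eq_or_lt_of_le h0 with rfl | h0
  · simpa using ha
  · nlinarith [mul_lt_mul_of_pos_left hb h0, mul_le_mul_of_nonneg_left ha.le (sub_nonneg.2 h1)]

theorem exists_disjoint_gap {E : Type*} [MetricSpace E] {A B : Set E} (hA : IsCompact A)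
    (hB : IsClosed B) (h : ∀ x ∈ A, x ∉ B) :
    ∃ ρ > 0, ∀ x ∈ A, ∀ y, dist y x < ρ → y ∉ B := by
  obtain ⟨ρ, h0, h1⟩ := hA.exists_thickening_subset_open hB.isOpen_compl (fun x hx => h x hx)
  exact ⟨ρ, h0, fun x hx y hy => h1 (Metric.mem_thickening_iff.2 ⟨x, hx, hy⟩)⟩

/-- The crossings of the `j`-th edge with the return path. -/
def edgeCrossings (w : ℕ → Space) (j : ℕ) (T : List Space) : Set (ℝ × ℝ) :=
  (segment ℝ (w j).1 (w (j + 1)).1 ∩ pathSet (T.map Prod.fst)) \ {(w (j + 1)).1}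

section Step

variable {w : ℕ → Space} {n j : ℕ} {T : List Space}

/-- The exceptions left open by `IsReturn.off` are the two ends of the path; general position of `w`
shows which lines these can lie on. -/
theorem IsReturn.eq_of_side_eq_zero (hw : IsGeneric w n) (hT : IsReturn w (j + 1) T)
    (hjn : j + 1 ≤ n) {i : ℕ} (hi : i < j + 1) {p : Space} (hp : p ∈ T)
    (h0 : side (w i).1 (w (i + 1)).1 p.1 = 0) : (i = j ∧ p = w (j + 1)) ∨ (i = 0 ∧ p = w 0) := by
  by_cases h1 : p = w (j + 1)
  · by_cases hij : i = j
    · exact Or.inl ⟨hij, h1⟩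
    · rw [h1] at h0
      exact absurd h0 (hw.off i (by omega) (j + 1) hjn (by omega) (by omega) (by omega))
  by_cases h2 : p = w 0
  · by_cases hi0 : i = 0
    · exact Or.inr ⟨hi0, h2⟩
    · rw [h2] at h0
      exact absurd h0 (hw.off i (by omega) 0 (by omega) (by omega) (by omega) (by omega))
  · exact absurd h0 (hT.off p hp h1 h2 i hi)

theorem IsReturn.finite_edgeCrossings (hw : IsGeneric w n) (hT : IsReturn w (j + 1) T)
    (hj : 1 ≤ j) (hjn : j + 1 ≤ n) : (edgeCrossings w j T).Finite := by
  obtain ⟨L, hL⟩ := List.head?_eq_some_iff.1 hT.head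
  have := finite_line_inter_pathSet (w j).1 (w (j + 1)).1 (w (j + 1)).1 (L.map Prod.fst) (by
    intro q hq
    obtain ⟨p, hp, rfl⟩ := List.mem_map.1 hq
    intro h0
    have hnd := hT.arc.nodup
    rw [hL, List.map_cons, List.nodup_cons] at hnd
    rcases hT.eq_of_side_eq_zero hw hjn (Nat.lt_succ_self j) (by rw [hL]; exact .tail _ hp) h0
      with h | h
    · exact hnd.1 (by rw [← h.2]; exact List.mem_map_of_mem hp)
    · omega)
  refine this.subset ?_
  rintro x ⟨⟨h1, h2⟩, -⟩
  refine ⟨side_eq_zero_of_mem h1, ?_⟩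
  rwa [hL] at h2

-- The finger move. Let `c` be the crossing nearest to the start `o` of edge `j`. A short piece of
-- `T` around `c` is replaced by two sides of a thin triangle which follows the segment `c o` and
-- has its tip just beyond `o`. As `c` is the nearest crossing, nothing else of `T` is in the way.
-- The new sides go around the end `o` of the edge, so `c` disappears and no crossing with edge `j`
-- is created.
set_option maxHeartbeats 1600000 in
theorem IsReturn.exists_removal (hw : IsGeneric w n) (hT : IsReturn w (j + 1) T)
    (hj : 1 ≤ j) (hjn : j + 1 ≤ n) (hX : (edgeCrossings w j T).Nonempty) :
    ∃ T', IsReturn w (j + 1) T' ∧ edgeCrossings w j T' ⊂ edgeCrossings w j T ∧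
      AmbientIsotopic (initialEdges w (j + 1) ∪ pathSet T)
        (initialEdges w (j + 1) ∪ pathSet T') := by
  set o := (w j).1 with ho
  set q := (w (j + 1)).1 with hq
  have hoq : o ≠ q := hw.ne (by omega)
  -- the crossing nearest to the start of the edge
  obtain ⟨c, ⟨⟨hcS, hcT⟩, hcq⟩, hmin⟩ := Set.exists_min_image _ (fun x => dist o x)
    (hT.finite_edgeCrossings hw hj hjn) hX
  replace hcq : c ≠ q := hcq
  replace hcS : c ∈ segment ℝ o q := hcS
  obtain ⟨u, hu0, hu1, hu⟩ := mem_segment_iff_lineMap.1 hcS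
  -- `o` is common to the edges `j - 1` and `j`, and `T` passes through no double point of the
  -- initial edges. This is where `1 ≤ j` is needed.
  have hoT : o ∉ pathSet (T.map Prod.fst) :=
    hT.triple (j - 1) j (by omega) (by omega) o
      (by rw [show j - 1 + 1 = j by omega]; exact right_mem_segment ℝ _ _) (left_mem_segment ℝ _ _)
  have hco : c ≠ o := fun e => hoT (e ▸ hcT)
  have hupos : 0 < u := lt_of_le_of_ne hu0 (by rintro rfl; apply hco; rw [← hu]; simp)
  have hu1' : u < 1 := lt_of_le_of_ne hu1 (by rintro rfl; apply hcq; rw [← hu]; simp)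
  have hocS : ∀ x ∈ segment ℝ o c, x ∈ segment ℝ o q := fun x hx =>
    (convex_segment o q).segment_subset (left_mem_segment ℝ o q) hcS hx
  have hnear : ∀ x ∈ segment ℝ o c, x ∈ pathSet (T.map Prod.fst) → x = c := by
    intro x hx hxT
    obtain ⟨s, hs0, hs1, rfl⟩ := mem_segment_iff_lineMap.1 hx
    have ex : AffineMap.lineMap o c s = AffineMap.lineMap o q (s * u) := by
      rw [← hu]; simp only [AffineMap.lineMap_apply_module']; module
    have hsu : s * u < 1 := by clear * - hs0 hs1 hu0 hu1'; nlinarith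
    have hxq : AffineMap.lineMap o c s ≠ q := by
      intro e
      have := lineMap_inj hoq ((ex.symm.trans e).trans (by simp : q = AffineMap.lineMap o q (1 : ℝ)))
      linarith
    have := hmin _ ⟨⟨hocS _ hx, hxT⟩, hxq⟩
    simp only [dist_left_lineMap, Real.norm_of_nonneg hs0] at this
    have hd : 0 < dist o c := dist_pos.2 hco.symm
    have : s = 1 := by clear * - this hd hs1; nlinarith
    simp [this]
  -- the edge of the return path at the crossing
  have hcT' := hcT
  rw [pathSet_map_fst] at hcT'
  obtain ⟨R, hRT, hRc⟩ := hcT'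
  have hside_c : side o q c = 0 := side_eq_zero_of_mem hcS
  have hcV : ∀ p ∈ T, p.1 ≠ c := by
    intro p hp e
    rcases hT.eq_of_side_eq_zero hw hjn (Nat.lt_succ_self j) hp (by rw [e]; exact hside_c) with h | h
    · exact hcq (by rw [← e, h.2])
    · omega
  obtain ⟨L₁, p, p', L₂, hTL, hRseg⟩ := exists_split_of_mem_pathSet hRT
    (fun h => hcV R h hRc)
  obtain ⟨tc, htc0, htc1, hRtc⟩ := mem_segment_iff_lineMap.1 hRseg
  set P := p.1 with hP
  set P' := p'.1 with hP'
  have hpT : p ∈ T := by rw [hTL]; simp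
  have hpT' : p' ∈ T := by rw [hTL]; simp
  have harc := hT.arc
  rw [hTL, List.map_append, List.map_cons, List.map_cons] at harc
  have hPP : P ≠ P' := (isArc_append.1 harc).2.1.1
  have hctc : AffineMap.lineMap P P' tc = c := by rw [← hRc, ← hRtc]; simp [hP, hP']
  have htc0' : 0 < tc := lt_of_le_of_ne htc0 (by
    rintro rfl; apply hcV p hpT; rw [← hctc]; simp [hP])
  have htc1' : tc < 1 := lt_of_le_of_ne htc1 (by
    rintro rfl; apply hcV p' hpT'; rw [← hctc]; simp [hP'])
  have hzero : ∀ i < j + 1, side (w i).1 (w (i + 1)).1 P ≠ 0 ∨ side (w i).1 (w (i + 1)).1 P' ≠ 0 := by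
    intro i hi
    by_contra hcon
    push Not at hcon
    rcases hT.eq_of_side_eq_zero hw hjn hi hpT hcon.1 with h1 | h1 <;>
    rcases hT.eq_of_side_eq_zero hw hjn hi hpT' hcon.2 with h2 | h2
    · exact hPP (by rw [hP, hP', h1.2, h2.2])
    · omega
    · omega
    · exact hPP (by rw [hP, hP', h1.2, h2.2])
  have hside_tc : (1 - tc) * side o q P + tc * side o q P' = 0 := by
    rw [← side_lineMap, hctc, hside_c]
  have hcseg : c ∈ segment ℝ P P' := mem_segment_iff_lineMap.2 ⟨tc, htc0, htc1, hctc⟩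
  -- the sets to be avoided
  set X₁ := pathSet (L₁.map Prod.fst ++ [P]) with hX₁
  set X₂ := pathSet (P' :: L₂.map Prod.fst) with hX₂
  have hX₁T : X₁ ⊆ pathSet (T.map Prod.fst) := by
    rw [hTL, List.map_append, List.map_cons, List.map_cons, pathSet_append]
    exact subset_union_left
  have hX₂T : X₂ ⊆ pathSet (T.map Prod.fst) := by
    rw [hTL, List.map_append, List.map_cons, List.map_cons, pathSet_append, pathSet_cons_cons]
    exact subset_union_right.trans subset_union_right
  have hcX₁ : c ∉ X₁ := fun h => hcV p hpT ((isArc_append.1 harc).2.2 ⟨h, Or.inl hcseg⟩).symm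
  have hcX₂ : c ∉ X₂ := fun h => hcV p' hpT' ((isArc_append.1 harc).2.1.2.1 ⟨hcseg, h⟩).symm
  set D : Set (ℝ × ℝ) := ⋃ k < j, ⋃ i < k,
    segment ℝ (w i).1 (w (i + 1)).1 ∩ segment ℝ (w k).1 (w (k + 1)).1 with hD
  have hDc : IsClosed D := (Set.finite_lt_nat j).isClosed_biUnion fun k _ =>
    (Set.finite_lt_nat k).isClosed_biUnion fun i _ =>
      (isCompact_segment _ _).isClosed.inter (isCompact_segment _ _).isClosed
  -- Two safety distances: within `ρ₁` of the segment `o c` there is nothing of the rest of `T` and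
  -- no double point of earlier edges; within `ρ₂` of `c` there is no earlier edge.
  obtain ⟨ρ₁, hρ₁, hgap₁⟩ := exists_disjoint_gap (isCompact_segment o c)
    (((isCompact_pathSet (L₁.map Prod.fst ++ [P])).isClosed.union
      (isCompact_pathSet (P' :: L₂.map Prod.fst)).isClosed).union hDc) (by
    rintro x hx ((h | h) | h)
    · exact hcX₁ (hnear x hx (hX₁T h) ▸ h)
    · exact hcX₂ (hnear x hx (hX₂T h) ▸ h)
    · simp only [hD, Set.mem_iUnion] at h
      obtain ⟨k, hk, i, hi, h1, h2⟩ := h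
      exact hw.triple i k j hi hk (by omega) x h1 h2 (hocS x hx))
  obtain ⟨ρ₂, hρ₂, hgap₂⟩ := exists_disjoint_gap (isCompact_singleton (x := c))
    ((Set.finite_lt_nat j).isClosed_biUnion fun i _ =>
      (isCompact_segment (w i).1 (w (i + 1)).1).isClosed) (by
    rintro x rfl h
    simp only [Set.mem_iUnion] at h
    obtain ⟨i, hi, h1⟩ := h
    exact hT.triple i j hi (by omega) x h1 hcS hcT)
  set ρ := min ρ₁ ρ₂ with hρdef
  have hρ : 0 < ρ := lt_min hρ₁ hρ₂
  -- the end points of the subsegment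
  have hPPd : 0 < dist P P' := dist_pos.2 hPP
  set δ₀ := min (min tc (1 - tc)) (ρ / dist P P') with hδ₀
  have hδ₀pos : 0 < δ₀ := lt_min (lt_min htc0' (by linarith)) (by positivity)
  have hbad : (⋃ i < j + 1, {t : ℝ | side (w i).1 (w (i + 1)).1 (AffineMap.lineMap P P' (tc - t)) = 0}
      ∪ {t : ℝ | side (w i).1 (w (i + 1)).1 (AffineMap.lineMap P P' (tc + t)) = 0}).Finite := by
    refine (Set.finite_lt_nat (j + 1)).biUnion fun i hi => Set.Finite.union ?_ ?_
    · apply Set.Subsingleton.finite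
      intro t ht t' ht'
      rw [Set.mem_ofPred_eq, side_lineMap] at ht ht'
      have := affine_zero_unique (hzero i hi) ht ht'
      linarith
    · apply Set.Subsingleton.finite
      intro t ht t' ht'
      rw [Set.mem_ofPred_eq, side_lineMap] at ht ht'
      have := affine_zero_unique (hzero i hi) ht ht'
      linarith
  obtain ⟨δ, ⟨hδ0, hδ1⟩, hδ⟩ := ((Set.Ioo_infinite hδ₀pos).sdiff hbad).nonempty
  have hδtc : δ < tc := hδ1.trans_le ((min_le_left _ _).trans (min_le_left _ _))
  have hδtc' : δ < 1 - tc := hδ1.trans_le ((min_le_left _ _).trans (min_le_right _ _))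
  have hδρ : δ * dist P P' < ρ := by
    have := hδ1.trans_le (min_le_right (min tc (1 - tc)) (ρ / dist P P'))
    rwa [lt_div_iff₀ hPPd] at this
  simp only [Set.mem_iUnion, not_exists, Set.mem_union, Set.mem_ofPred_eq, not_or] at hδ
  have hclose : ∀ s : ℝ, |s| ≤ δ → dist (AffineMap.lineMap P P' (tc + s)) c < ρ := by
    intro s hs
    rw [← hctc, dist_lineMap_lineMap, Real.dist_eq, add_sub_cancel_left]
    exact (mul_le_mul_of_nonneg_right hs dist_nonneg).trans_lt hδρ
  set ra := AffineMap.lineMap P P' (tc - δ) with hra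
  set rb := AffineMap.lineMap P P' (tc + δ) with hrb
  have hrac : dist ra c < ρ := by
    rw [hra, sub_eq_add_neg]; exact hclose _ (by rw [abs_neg, abs_of_pos hδ0])
  have hrbc : dist rb c < ρ := hclose _ (by rw [abs_of_pos hδ0])
  have hra_side : side o q ra ≠ 0 := (hδ j (by omega)).1
  have hrb_side : side o q rb ≠ 0 := (hδ j (by omega)).2
  -- the tip
  have hocd : 0 < dist o c := dist_pos.2 hco.symm
  set ε := ρ / 2 / dist o c with hε
  have hε0 : 0 < ε := by positivity
  -- On the line of the edge, at distance `ρ / 2` beyond `o`. A generic tip within `ρ / 2` of `W₀`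
  -- is still within `ρ` of `o`.
  set W₀ := AffineMap.lineMap o c (-ε) with hW₀
  have hW₀o : dist W₀ o = ρ / 2 := by
    rw [hW₀, dist_lineMap_left, norm_neg, Real.norm_of_nonneg hε0.le, hε]; field_simp
  have hW₀side : side o q W₀ = 0 := by rw [hW₀, side_lineMap, hside_c]; simp
  have hW₀S : W₀ ∉ segment ℝ o q := by
    intro h
    obtain ⟨s, hs0, hs1, e⟩ := mem_segment_iff_lineMap.1 h
    have ex : W₀ = AffineMap.lineMap o q (-ε * u) := by
      rw [hW₀, ← hu]; simp only [AffineMap.lineMap_apply_module']; module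
    have := lineMap_inj hoq (e.trans ex)
    clear * - this hs0 hε0 hupos
    nlinarith
  have hseg_disj : ∀ r, side o q r ≠ 0 → ∀ x ∈ segment ℝ r W₀, x ∉ segment ℝ o q := by
    intro r hr x hx hxS
    obtain ⟨t, -, -, rfl⟩ := mem_segment_iff_lineMap.1 hx
    have h0 := side_eq_zero_of_mem hxS
    rw [side_lineMap, hW₀side, mul_zero, add_zero] at h0
    rcases mul_eq_zero.1 h0 with h | h
    · apply hW₀S; rw [show t = 1 by linarith] at hxS; simpa using hxS
    · exact hr h
  -- The sides from `ra` and `rb` to `W₀` meet the line of the edge only at `W₀`, off the edge. By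
  -- compactness they still miss the edge when the tip moves a little.
  obtain ⟨ρ₃, hρ₃, hgap₃⟩ := exists_disjoint_gap (isCompact_segment ra W₀)
    (isCompact_segment o q).isClosed (hseg_disj ra hra_side)
  obtain ⟨ρ₄, hρ₄, hgap₄⟩ := exists_disjoint_gap (isCompact_segment rb W₀)
    (isCompact_segment o q).isClosed (hseg_disj rb hrb_side)
  -- The extra index `j + 1` stands for the line `P P'`, which the tip must also avoid for the
  -- triangle to be nondegenerate.
  obtain ⟨W, hWd, hW⟩ := exists_small_generic (Finset.range (j + 2))
    (fun i => if i = j + 1 then P else (w i).1) (fun i => if i = j + 1 then P' else (w (i + 1)).1)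
    (by
      intro i hi
      rw [Finset.mem_range] at hi
      by_cases h : i = j + 1
      · simpa [h] using hPP
      · simp only [h, if_false]; exact hw.ne (by omega)) W₀
    (ρ := min (ρ / 2) (min ρ₃ ρ₄)) (by positivity)
  have hWW₀ : dist W W₀ < ρ / 2 := hWd.trans_le (min_le_left _ _)
  have hW3 : dist W W₀ < ρ₃ := hWd.trans_le ((min_le_right _ _).trans (min_le_left _ _))
  have hW4 : dist W W₀ < ρ₄ := hWd.trans_le ((min_le_right _ _).trans (min_le_right _ _))
  have hWo : dist W o < ρ := by
    have := dist_triangle W W₀ o; linarith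
  have hWP : side P P' W ≠ 0 := by
    have := hW (j + 1) (by simp); simpa using this
  have hWi : ∀ i < j + 1, side (w i).1 (w (i + 1)).1 W ≠ 0 := by
    intro i hi
    have := hW i (by rw [Finset.mem_range]; omega)
    simpa [hi.ne] using this
  have hn1S : ∀ x ∈ segment ℝ ra W, x ∉ segment ℝ o q := by
    intro x hx
    obtain ⟨t, h0, h1, rfl⟩ := mem_segment_iff_lineMap.1 hx
    exact hgap₃ (AffineMap.lineMap ra W₀ t) (mem_segment_iff_lineMap.2 ⟨t, h0, h1, rfl⟩) _
      (dist_lineMap_lineMap_le (by simpa using hρ₃) hW3 h0 h1)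
  have hn2S : ∀ x ∈ segment ℝ W rb, x ∉ segment ℝ o q := by
    intro x hx
    rw [segment_symm] at hx
    obtain ⟨t, h0, h1, rfl⟩ := mem_segment_iff_lineMap.1 hx
    exact hgap₄ (AffineMap.lineMap rb W₀ t) (mem_segment_iff_lineMap.2 ⟨t, h0, h1, rfl⟩) _
      (dist_lineMap_lineMap_le (by simpa using hρ₄) hW4 h0 h1)
  -- A point of a new side is within `ρ` of the point of the segment `c o` with the same parameter,
  -- since `ra`, `rb` are that close to `c` and `W` to `o`.
  have hnZ : ∀ x ∈ segment ℝ ra W ∪ segment ℝ W rb, x ∉ X₁ ∪ X₂ ∪ D := by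
    intro x hx
    have : ∃ r, dist r c < ρ ∧ x ∈ segment ℝ r W := by
      rcases hx with hx | hx
      · exact ⟨ra, hrac, hx⟩
      · exact ⟨rb, hrbc, by rwa [segment_symm] at hx⟩
    obtain ⟨r, hr, hx⟩ := this
    obtain ⟨t, h0, h1, rfl⟩ := mem_segment_iff_lineMap.1 hx
    refine hgap₁ (AffineMap.lineMap c o t) ?_ _ ((dist_lineMap_lineMap_le hr hWo h0 h1).trans_le
      (min_le_left _ _))
    rw [segment_symm]
    exact mem_segment_iff_lineMap.2 ⟨t, h0, h1, rfl⟩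
  -- the move in space
  set r₁ := AffineMap.lineMap p p' (tc - δ) with hr₁
  set r₂ := AffineMap.lineMap p p' (tc + δ) with hr₂
  have hr₁a : r₁.1 = ra := by simp [hr₁, hra, hP, hP']
  have hr₂b : r₂.1 = rb := by simp [hr₂, hrb, hP, hP']
  set K := initialEdges w (j + 1) ∪ (pathSet (L₁ ++ [p]) ∪ pathSet (p' :: L₂)) with hK
  have hKc : IsCompact K := (finite_initialEdges_isCompact w (j + 1)).union
    ((isCompact_pathSet _).union (isCompact_pathSet _))
  have hX₁' : ∀ x ∈ pathSet (L₁ ++ [p]), x.1 ∈ X₁ := by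
    intro x hx
    have := pathSet_map_fst (L₁ ++ [p])
    rw [List.map_append] at this
    rw [hX₁]
    exact this ▸ mem_image_of_mem _ hx
  have hX₂' : ∀ x ∈ pathSet (p' :: L₂), x.1 ∈ X₂ := by
    intro x hx
    have := pathSet_map_fst (p' :: L₂)
    rw [List.map_cons] at this
    rw [hX₂]
    exact this ▸ mem_image_of_mem _ hx
  set k₀ := AffineMap.lineMap (w j) (w (j + 1)) u with hk₀
  have hk₀c : k₀.1 = c := by rw [← hu]; simp [hk₀, ho, hq]
  have hk₀seg : k₀ ∈ segment ℝ (w j) (w (j + 1)) := mem_segment_iff_lineMap.2 ⟨u, hu0, hu1, rfl⟩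
  -- Equal heights would give a common point of `T` and edge `j` in space, but these meet only in `w
  -- 0` or `w (j + 1)`, and neither projects to `c`.
  have hRk : R.2 ≠ k₀.2 := by
    intro e
    have hRk' : R = k₀ := Prod.ext (by rw [hRc, hk₀c]) e
    rcases hT.disj j (by omega) R (hRk' ▸ hk₀seg) hRT with h | h
    · have := hw.off j (by omega) 0 (by omega) (by omega) (by omega) (by omega)
      rw [← h, hRc] at this
      exact this hside_c
    · exact hcq (by rw [← hRc, h])
  obtain ⟨σ, hσ, hσR⟩ : ∃ σ : ℝ, (σ = 1 ∨ σ = -1) ∧ 0 < σ * (R.2 - k₀.2) := by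
    rcases lt_or_gt_of_ne hRk with h | h
    · exact ⟨-1, Or.inr rfl, by linarith⟩
    · exact ⟨1, Or.inl rfl, by linarith⟩
  -- Over the short segment from `ra` to `rb`, the only point of `K` is the point `k₀` of edge `j`
  -- over `c`: the safety distances exclude everything else. There the sign `σ` tells which strand
  -- is on top.
  have hfibre : ∀ k ∈ K, ∀ a c' : ℝ, 0 ≤ a → 0 ≤ c' → a + c' = 1 →
      k.1 = a • r₁.1 + c' • r₂.1 → 0 < σ * (a * r₁.2 + c' * r₂.2 - k.2) := by
    intro k hk a c' ha hc' hac hkeq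
    have hk1 : k.1 = AffineMap.lineMap P P' (tc + (c' - a) * δ) := by
      rw [hkeq, hr₁a, hr₂b, hra, hrb, show a = 1 - c' by linarith]
      simp only [AffineMap.lineMap_apply_module']; module
    have hkc : dist k.1 c < ρ := by
      rw [hk1]; apply hclose
      rw [abs_mul, abs_of_pos hδ0]
      have : |c' - a| ≤ 1 := abs_le.2 ⟨by linarith, by linarith⟩
      exact mul_le_of_le_one_left hδ0.le this
    have hk2 := hgap₁ c (right_mem_segment ℝ o c) k.1 (hkc.trans_le (min_le_left _ _))
    rcases hk with hk | hk | hk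
    · simp only [initialEdges, Set.mem_iUnion] at hk
      obtain ⟨i, hi, hki⟩ := hk
      have hki' := fst_mem_segment hki
      rcases Nat.lt_succ_iff_lt_or_eq.1 hi with hi | rfl
      · exact (hgap₂ c rfl k.1 (hkc.trans_le (min_le_right _ _)) (Set.mem_biUnion hi hki')).elim
      · have h0 := side_eq_zero_of_mem hki'
        rw [hk1, side_lineMap] at h0
        have h1 := affine_zero_unique (hzero i (by omega)) h0 hside_tc
        have h2 : c' = a := by
          have : (c' - a) * δ = 0 := by linarith
          rcases mul_eq_zero.1 this with h | h
          · linarith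
          · exact absurd h hδ0.ne'
        have h3 : k.1 = c := by rw [hk1, h1, hctc]
        obtain ⟨s, -, -, rfl⟩ := mem_segment_iff_lineMap.1 hki
        have h4 : s = u := by
          apply lineMap_inj hoq
          rw [hu, ← h3]; simp [ho, hq]
        have h5 : a * r₁.2 + c' * r₂.2 = R.2 := by
          rw [← hRtc, hr₁, hr₂, h2, show a = 1 / 2 by linarith]
          simp only [AffineMap.lineMap_apply_module', Prod.snd_add, Prod.smul_snd, Prod.snd_sub,
            smul_eq_mul]
          ring
        rw [h5, h4]; exact hσR
    · exact absurd (Or.inl (Or.inl (hX₁' k hk))) hk2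
    · exact absurd (Or.inl (Or.inr (hX₂' k hk))) hk2
  obtain ⟨H, hH⟩ := exists_height hKc r₁ r₂ W σ hσ hfibre
  set Q : Space := (W, H) with hQ
  -- The triangle move wants the ends of the edge in the parameter of the line `r₁ r₂`, in which
  -- `r₁` is at `0` and `r₂` at `1`.
  have hPr : AffineMap.lineMap r₁ r₂ (-(tc - δ) / (2 * δ)) = p := by
    rw [hr₁, hr₂]; simp only [AffineMap.lineMap_apply_module']
    have : -(tc - δ) / (2 * δ) * (2 * δ) = -(tc - δ) := by field_simp
    have e : p = p + ((-(tc - δ) / (2 * δ) * (2 * δ)) + (tc - δ)) • (p' - p) := by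
      rw [this]; module
    conv_rhs => rw [e]
    module
  have hPr' : AffineMap.lineMap r₁ r₂ ((1 - (tc - δ)) / (2 * δ)) = p' := by
    rw [hr₁, hr₂]; simp only [AffineMap.lineMap_apply_module']
    have : (1 - (tc - δ)) / (2 * δ) * (2 * δ) = 1 - (tc - δ) := by field_simp
    have e : p' = p + (((1 - (tc - δ)) / (2 * δ) * (2 * δ)) + (tc - δ)) • (p' - p) := by
      rw [this]; module
    conv_rhs => rw [e]
    module
  have hWr : side r₁.1 r₂.1 Q.1 ≠ 0 := by
    have e : side r₁.1 r₂.1 Q.1 = (2 * δ) * side P P' W := by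
      rw [hr₁a, hr₂b, hra, hrb]
      simp only [side, hQ, AffineMap.lineMap_apply_module', Prod.fst_add, Prod.snd_add,
        Prod.smul_fst, Prod.smul_snd, Prod.fst_sub, Prod.snd_sub, smul_eq_mul]
      ring
    rw [e]; exact mul_ne_zero (by positivity) hWP
  have hmove := ambientIsotopic_triangle (s := -(tc - δ) / (2 * δ))
    (s' := (1 - (tc - δ)) / (2 * δ)) hKc
    (div_nonpos_of_nonpos_of_nonneg (by linarith) (by positivity))
    (by rw [le_div_iff₀ (by positivity)]; linarith) hWr hH
  rw [hPr, hPr'] at hmove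
  set T' := L₁ ++ p :: r₁ :: Q :: r₂ :: p' :: L₂ with hT'
  have hmapT' : T'.map Prod.fst = L₁.map Prod.fst ++ P :: ra :: W :: rb :: P' :: L₂.map Prod.fst := by
    simp [hT', hr₁a, hr₂b, hP, hP', hQ]
  have hpr1 : ∀ s : ℝ, 0 ≤ s → s ≤ 1 → AffineMap.lineMap p p' s ∈ segment ℝ p p' :=
    fun s h0 h1 => mem_segment_iff_lineMap.2 ⟨s, h0, h1, rfl⟩
  have hsegl : segment ℝ p r₁ ⊆ segment ℝ p p' :=
    (convex_segment p p').segment_subset (left_mem_segment ℝ _ _)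
      (hpr1 _ (by linarith) (by linarith))
  have hsegr : segment ℝ r₂ p' ⊆ segment ℝ p p' :=
    (convex_segment p p').segment_subset (hpr1 _ (by linarith) (by linarith))
      (right_mem_segment ℝ _ _)
  have hQK : ∀ x ∈ segment ℝ r₁ Q ∪ segment ℝ Q r₂, x ∉ K := by
    rintro x (⟨a, b, ha, hb, hab, rfl⟩ | ⟨a, b, ha, hb, hab, rfl⟩)
    · simpa using hH a b 0 ha hb le_rfl (by linarith)
    · simpa using hH 0 a b le_rfl ha hb (by linarith)
  have hpathT : pathSet T = pathSet (L₁ ++ [p]) ∪ (segment ℝ p p' ∪ pathSet (p' :: L₂)) := by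
    rw [hTL, pathSet_append, pathSet_cons_cons]
  have hpathT' : pathSet T' = pathSet (L₁ ++ [p]) ∪ (segment ℝ p r₁ ∪ (segment ℝ r₁ Q ∪
      (segment ℝ Q r₂ ∪ (segment ℝ r₂ p' ∪ pathSet (p' :: L₂))))) := by
    rw [hT', pathSet_append]; simp only [pathSet_cons_cons]
  have hT'sub : pathSet T' ⊆ pathSet T ∪ (segment ℝ r₁ Q ∪ segment ℝ Q r₂) := by
    rw [hpathT, hpathT']
    rintro x (h | h | h | h | h | h)
    · exact Or.inl (Or.inl h)
    · exact Or.inl (Or.inr (Or.inl (hsegl h)))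
    · exact Or.inr (Or.inl h)
    · exact Or.inr (Or.inr h)
    · exact Or.inl (Or.inr (Or.inl (hsegr h)))
    · exact Or.inl (Or.inr (Or.inr h))
  have hplane : ∀ x ∈ pathSet (T'.map Prod.fst),
      x ∈ pathSet (T.map Prod.fst) ∨ x ∈ segment ℝ ra W ∪ segment ℝ W rb := by
    intro x hx
    rw [pathSet_map_fst] at hx ⊢
    obtain ⟨y, hy, rfl⟩ := hx
    rcases hT'sub hy with h | h | h
    · exact Or.inl ⟨y, h, rfl⟩
    · exact Or.inr (Or.inl (by simpa [hr₁a, hQ] using fst_mem_segment h))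
    · exact Or.inr (Or.inr (by simpa [hr₂b, hQ] using fst_mem_segment h))
  refine ⟨T', ⟨?_, ?_, ?_, ?_, ?_, ?_⟩, ?_, ?_⟩
  · have := hT.head
    rw [hTL] at this
    rw [hT', ← this]; cases L₁ <;> simp
  · have := hT.last
    rw [hTL] at this
    rw [hT', ← this]; simp [List.getLast?_append]
  · rw [hmapT']
    refine isArc_detour harc (by linarith) (by linarith) (by linarith) hWP fun x hx h => ?_
    exact hnZ x hx (Or.inl h)
  · intro y hy h1 h2 i hi
    have : y ∈ T ∨ y = r₁ ∨ y = Q ∨ y = r₂ := by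
      rw [hT'] at hy; rw [hTL]
      simp only [List.mem_append, List.mem_cons] at hy ⊢
      clear * - hy
      tauto
    rcases this with h | rfl | rfl | rfl
    · exact hT.off y h h1 h2 i hi
    · rw [hr₁a]; exact (hδ i hi).1
    · exact hWi i hi
    · rw [hr₂b]; exact (hδ i hi).2
  · intro i k hik hk x hx1 hx2 hx
    rcases hplane x hx with h | h
    · exact hT.triple i k hik hk x hx1 hx2 h
    · rcases Nat.lt_succ_iff_lt_or_eq.1 hk with hk | rfl
      · exact hnZ x h (Or.inr (by simp only [hD, Set.mem_iUnion]; exact ⟨k, hk, i, hik, hx1, hx2⟩))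
      · rcases h with h | h
        · exact hn1S x h hx2
        · exact hn2S x h hx2
  · intro i hi x hx hxT
    rcases hT'sub hxT with h | h
    · exact hT.disj i hi x hx h
    · exact (hQK x h (Or.inl (Set.mem_iUnion₂.2 ⟨i, hi, hx⟩))).elim
  · have hcT'' : c ∉ pathSet (T'.map Prod.fst) := by
      rw [hmapT', pathSet_append]
      simp only [pathSet_cons_cons]
      have line_ne : ∀ s s' : ℝ, s ≤ s' → (s' < tc ∨ tc < s) →
          c ∉ segment ℝ (AffineMap.lineMap P P' s) (AffineMap.lineMap P P' s') := by
        intro s s' hss h hc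
        obtain ⟨y, h1, h2, h3⟩ := segment_lineMap_subset hss hc
        have := lineMap_inj hPP (hctc.trans h3)
        rcases h with h | h <;> linarith
      rintro (h | h | h | h | h | h)
      · exact hcX₁ h
      · refine line_ne 0 (tc - δ) (by linarith) (Or.inl (by linarith)) ?_
        rwa [AffineMap.lineMap_apply_zero]
      · exact hn1S c h hcS
      · exact hn2S c h hcS
      · refine line_ne (tc + δ) 1 (by linarith) (Or.inr (by linarith)) ?_
        rwa [AffineMap.lineMap_apply_one]
      · exact hcX₂ h
    refine ⟨?_, fun h => ?_⟩
    · rintro x ⟨⟨h1, h2⟩, h3⟩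
      refine ⟨⟨h1, ?_⟩, h3⟩
      rcases hplane x h2 with h | h | h
      · exact h
      · exact absurd h1 (hn1S x h)
      · exact absurd h1 (hn2S x h)
    · exact hcT'' (h ⟨⟨hcS, hcT⟩, hcq⟩).1.2
  · convert hmove using 1
    · rw [hpathT, hK]; ac_rfl
    · rw [hpathT', hK]; ac_rfl

theorem IsReturn.exists_clear (hw : IsGeneric w n) (hT : IsReturn w (j + 1) T)
    (hj : 1 ≤ j) (hjn : j + 1 ≤ n) :
    ∃ T', IsReturn w (j + 1) T' ∧ edgeCrossings w j T' = ∅ ∧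
      AmbientIsotopic (initialEdges w (j + 1) ∪ pathSet T)
        (initialEdges w (j + 1) ∪ pathSet T') := by
  induction hN : (edgeCrossings w j T).ncard using Nat.strong_induction_on generalizing T with
  | _ N ih =>
    rcases (edgeCrossings w j T).eq_empty_or_nonempty with h | h
    · exact ⟨T, hT, h, AmbientIsotopic.refl _⟩
    · obtain ⟨T₁, h1, h2, h3⟩ := hT.exists_removal hw hj hjn h
      have hlt := Set.ncard_lt_ncard h2 (hT.finite_edgeCrossings hw hj hjn)
      obtain ⟨T', h4, h5, h6⟩ := ih _ (hN ▸ hlt) h1 rfl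
      exact ⟨T', h4, h5, h3.trans h6⟩

/-- With its crossings cleared, edge `j` and the return path have only `w (j + 1)` in common in the
projection, so the longer path still has injective projection. The conditions on it come from those
on `T'` and from the general position of edge `j` relative to the earlier ones. -/
theorem IsReturn.exists_step (hw : IsGeneric w n) (hT : IsReturn w (j + 1) T)
    (hj : 1 ≤ j) (hjn : j + 1 ≤ n) :
    ∃ T', IsReturn w j T' ∧
      AmbientIsotopic (initialEdges w (j + 1) ∪ pathSet T) (initialEdges w j ∪ pathSet T') := by
  obtain ⟨T', hT', hX, hiso⟩ := hT.exists_clear hw hj hjn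
  obtain ⟨L, hL⟩ := List.head?_eq_some_iff.1 hT'.head
  subst hL
  refine ⟨w j :: w (j + 1) :: L, ⟨rfl, ?_, ?_, ?_, ?_, ?_⟩, ?_⟩
  · rw [List.getLast?_cons_cons]; exact hT'.last
  · have harc := hT'.arc
    rw [List.map_cons] at harc
    rw [List.map_cons, List.map_cons]
    refine ⟨hw.ne (by omega), fun x hx => ?_, harc⟩
    by_contra hne
    have : x ∈ edgeCrossings w j (w (j + 1) :: L) := ⟨hx, hne⟩
    rw [hX] at this
    exact this
  · intro p hp h1 h2 i hi
    by_cases h3 : p = w (j + 1)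
    · rw [h3]; exact hw.off i (by omega) (j + 1) hjn (by omega) (by omega) (by omega)
    · rcases List.mem_cons.1 hp with h | h
      · exact absurd h h1
      · exact hT'.off p h h3 h2 i (by omega)
  · intro i k hik hk x h1 h2 h3
    rw [List.map_cons, List.map_cons, pathSet_cons_cons] at h3
    rcases h3 with h3 | h3
    · exact hw.triple i k j hik hk (by omega) x h1 h2 h3
    · exact hT'.triple i k hik (by omega) x h1 h2 h3
  · intro i hi x h1 h2
    rw [pathSet_cons_cons] at h2
    rcases h2 with h2 | h2
    · rcases hw.simple i j hi (by omega) x h1 h2 with h | h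
      · exact Or.inr h.2
      · omega
    · rcases hT'.disj i (by omega) x h1 h2 with h | h
      · exact Or.inl h
      · exfalso
        rw [h] at h1
        refine hw.off i (by omega) (j + 1) hjn (by omega) (by omega) (by omega)
          (side_eq_zero_of_mem (fst_mem_segment h1))
  · convert hiso using 1
    rw [pathSet_cons_cons, ← Set.union_assoc]
    congr 1
    simp only [initialEdges, Nat.lt_succ_iff_lt_or_eq]
    ext x
    simp only [Set.mem_union, Set.mem_iUnion]
    constructor
    · rintro (⟨i, hi, h⟩ | h)
      · exact ⟨i, Or.inl hi, h⟩
      · exact ⟨j, Or.inr rfl, h⟩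
    · rintro ⟨i, hi | rfl, h⟩
      · exact Or.inl ⟨i, hi, h⟩
      · exact Or.inr h

end Step

/-- Every polygon in general position is isotopic to the union of its first edge and a path with
injective projection. -/
theorem IsGeneric.exists_return {w : ℕ → Space} {n : ℕ} (hw : IsGeneric w n) :
    ∃ T, IsReturn w 1 T ∧
      AmbientIsotopic (initialEdges w (n + 1)) (initialEdges w 1 ∪ pathSet T) := by
  have h2 := hw.two_le
  -- `d` counts the edges which have joined the closing edge; `d = n - 1` leaves only edge `0`.
  have main : ∀ d, d < n → ∃ T, IsReturn w (n - d) T ∧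
      AmbientIsotopic (initialEdges w (n + 1)) (initialEdges w (n - d) ∪ pathSet T) := by
    intro d
    induction d with
    | zero =>
      intro _
      refine ⟨[w n, w 0], ⟨rfl, rfl, ?_, ?_, ?_, ?_⟩, ?_⟩
      · refine ⟨fun e => ?_, ?_, trivial⟩
        · refine hw.off 0 (by omega) n le_rfl (by omega) (by omega) (by omega) ?_
          rw [e]; simp
        · simp
      · intro p hp h1 h3
        simp at hp
        rcases hp with h | h
        · exact absurd h h1
        · exact absurd h h3
      · intro i k hik hk x h1 h3 h4
        refine hw.triple i k n hik hk le_rfl x h1 h3 ?_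
        rw [hw.closed]
        simp only [List.map_cons, List.map_nil, pathSet_cons_cons, pathSet_singleton] at h4
        rcases h4 with h4 | rfl
        · exact h4
        · exact right_mem_segment ℝ _ _
      · intro i hi x h1 h3
        simp only [pathSet_cons_cons, pathSet_singleton] at h3
        rcases h3 with h3 | h3
        · rcases hw.simple i n hi le_rfl x h1 (by rwa [hw.closed]) with h | h
          · exact Or.inr h.2
          · exact Or.inl h.2.2
        · exact Or.inl h3
      · convert AmbientIsotopic.refl _ using 1
        simp only [initialEdges, pathSet_cons_cons, pathSet_singleton, Nat.sub_zero,
          Nat.lt_succ_iff_lt_or_eq]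
        ext x
        simp only [Set.mem_union, Set.mem_iUnion, Set.mem_singleton_iff]
        constructor
        · rintro ((⟨i, hi, h⟩) | h | h)
          · exact ⟨i, Or.inl hi, h⟩
          · exact ⟨n, Or.inr rfl, by rwa [hw.closed]⟩
          · exact ⟨n, Or.inr rfl, by rw [hw.closed, h]; exact right_mem_segment ℝ _ _⟩
        · rintro ⟨i, hi | rfl, h⟩
          · exact Or.inl ⟨i, hi, h⟩
          · rw [hw.closed] at h; exact Or.inr (Or.inl h)
    | succ d ih =>
      intro hd
      obtain ⟨T, hT, hiso⟩ := ih (by omega)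
      obtain ⟨j, hj⟩ : ∃ j, n - d = j + 1 := ⟨n - d - 1, by omega⟩
      rw [hj] at hT hiso
      obtain ⟨T', hT', hiso'⟩ := hT.exists_step hw (by omega) (by omega)
      rw [show n - (d + 1) = j by omega]
      exact ⟨T', hT', hiso.trans hiso'⟩
  have := main (n - 1) (by omega)
  rwa [show n - (n - 1) = 1 by omega] at this

/-! ### Simple polygons and perturbation of their vertices -/

theorem fin_add_two_ne {m : ℕ} [NeZero m] (hm : 3 ≤ m) (i : Fin m) : i + 1 + 1 ≠ i := by
  intro h
  have h7 : i + (1 + 1) = i + 0 := by rw [← add_assoc, h, add_zero]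
  have h8 := congrArg Fin.val (add_left_cancel h7)
  rw [Fin.val_add, Fin.val_one', Nat.mod_eq_of_lt (by omega : 1 < m),
    Nat.mod_eq_of_lt (by omega)] at h8
  simp at h8

section Simple

variable {m : ℕ} [NeZero m] {v : Fin m → Space}

theorem IsSimplePolygon.ne_succ (hv : IsSimplePolygon v) (i : Fin m) : v i ≠ v (i + 1) := by
  intro e
  have h := @hv (i, 0) ⟨mem_univ _, by norm_num⟩ (i, 1 / 2) ⟨mem_univ _, by norm_num⟩
    (by simp [← e])
  have := congrArg Prod.snd h
  norm_num at this

theorem IsSimplePolygon.inter_edge (hv : IsSimplePolygon v) {i k : Fin m} (hik : i ≠ k) {x : Space}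
    (hi : x ∈ edge v i) (hk : x ∈ edge v k) :
    (k = i + 1 ∧ x = v k) ∨ (i = k + 1 ∧ x = v i) := by
  obtain ⟨t, ht0, ht1, ht⟩ := mem_segment_iff_lineMap.1 hi
  obtain ⟨s, hs0, hs1, hs⟩ := mem_segment_iff_lineMap.1 hk
  have key : ∀ (a b : Fin m) (t s : ℝ), 0 ≤ t → t < 1 → 0 ≤ s → s < 1 →
      AffineMap.lineMap (v a) (v (a + 1)) t = AffineMap.lineMap (v b) (v (b + 1)) s → a = b := by
    intro a b t s h1 h2 h3 h4 h5
    have := @hv (a, t) ⟨mem_univ _, h1, h2⟩ (b, s) ⟨mem_univ _, h3, h4⟩ h5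
    exact congrArg Prod.fst this
  rcases lt_or_eq_of_le ht1 with ht1 | rfl <;> rcases lt_or_eq_of_le hs1 with hs1 | rfl
  · exact absurd (key i k t s ht0 ht1 hs0 hs1 (ht.trans hs.symm)) hik
  · rw [AffineMap.lineMap_apply_one] at hs
    have := key i (k + 1) t 0 ht0 ht1 le_rfl one_pos (by simp [ht, hs])
    exact Or.inr ⟨this, by rw [this, hs]⟩
  · rw [AffineMap.lineMap_apply_one] at ht
    have := key (i + 1) k 0 s le_rfl one_pos hs0 hs1 (by simp [ht, hs])
    exact Or.inl ⟨this.symm, by rw [← this, ht]⟩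
  · rw [AffineMap.lineMap_apply_one] at ht hs
    have := key (i + 1) (k + 1) 0 0 le_rfl one_pos le_rfl one_pos (by simp [ht, hs])
    exact absurd (add_right_cancel this) hik

theorem isSimplePolygon_of_inter_edge (hne : ∀ i, v i ≠ v (i + 1))
    (h : ∀ i k, i ≠ k → ∀ x ∈ edge v i, x ∈ edge v k →
      (k = i + 1 ∧ x = v k) ∨ (i = k + 1 ∧ x = v i)) : IsSimplePolygon v := by
  rintro ⟨i, t⟩ ⟨-, ht0, ht1⟩ ⟨k, s⟩ ⟨-, hs0, hs1⟩ e
  dsimp only at *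
  by_cases hik : i = k
  · subst hik
    rw [lineMap_inj (hne i) e]
  · exfalso
    have hi : AffineMap.lineMap (v i) (v (i + 1)) t ∈ edge v i :=
      mem_segment_iff_lineMap.2 ⟨t, ht0, ht1.le, rfl⟩
    have hk : AffineMap.lineMap (v i) (v (i + 1)) t ∈ edge v k :=
      mem_segment_iff_lineMap.2 ⟨s, hs0, hs1.le, e.symm⟩
    rcases h i k hik _ hi hk with ⟨h1, h2⟩ | ⟨h1, h2⟩
    · have : t = 1 := lineMap_inj (hne i) (by rw [h2, h1]; simp)
      linarith
    · have : s = 1 := lineMap_inj (hne k) (by rw [← e, h2, h1]; simp)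
      linarith

theorem IsSimplePolygon.three_le (hv : IsSimplePolygon v) : 3 ≤ m := by
  by_contra hcon
  have h0 := NeZero.pos m
  have h2 : (0 : Fin m) + 1 + 1 = 0 ∨ (0 : Fin m) + 1 = 0 := by
    obtain rfl | rfl : m = 1 ∨ m = 2 := by omega
    · right; rfl
    · left; rfl
  rcases h2 with h2 | h2
  · have hmid : (0 : Fin m) ≠ 0 + 1 := fun e => hv.ne_succ 0 (by rw [← e])
    have e0 := hv.ne_succ (0 : Fin m)
    set x := AffineMap.lineMap (v 0) (v (0 + 1)) (1 / 2 : ℝ) with hx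
    have hx0 : x ∈ edge v 0 := mem_segment_iff_lineMap.2 ⟨1 / 2, by norm_num, by norm_num, rfl⟩
    have hx1 : x ∈ edge v (0 + 1) := by
      rw [edge, h2, segment_symm]; exact hx0
    rcases hv.inter_edge hmid hx0 hx1 with h | h
    · have : (1 / 2 : ℝ) = 1 := lineMap_inj e0 (by rw [← hx, h.2]; simp)
      norm_num at this
    · have : (1 / 2 : ℝ) = 0 := lineMap_inj e0 (by rw [← hx, h.2]; simp)
      norm_num at this
  · exact hv.ne_succ 0 (by rw [h2])

end Simple

section ChordArc

/-- By homogeneity it suffices to treat `α + β = 1`, where the right-hand side is a continuous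
positive function on a compact interval. The hypothesis says that the segments from the origin to
`A` and `B` meet only at the origin. -/
theorem exists_angle_bound {A B : Space}
    (h : ∀ α β : ℝ, 0 ≤ α → α ≤ 1 → 0 ≤ β → β ≤ 1 → α • A = β • B → α = 0) (hB : B ≠ 0) :
    ∃ c > 0, ∀ α β : ℝ, 0 ≤ α → 0 ≤ β → c * (α + β) ≤ ‖α • A - β • B‖ := by
  obtain ⟨α₀, hα₀, hmin⟩ := isCompact_Icc.exists_isMinOn (s := Icc (0 : ℝ) 1) ⟨0, by simp⟩
    (f := fun α : ℝ => ‖α • A - (1 - α) • B‖) (by fun_prop)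
  refine ⟨‖α₀ • A - (1 - α₀) • B‖, ?_, fun α β hα hβ => ?_⟩
  · refine norm_pos_iff.2 fun h0 => ?_
    have h1 := h α₀ (1 - α₀) hα₀.1 hα₀.2 (by linarith [hα₀.2]) (by linarith [hα₀.1])
      (sub_eq_zero.1 h0)
    rw [h1] at h0
    simp at h0
    exact hB h0
  · rcases eq_or_lt_of_le (add_nonneg hα hβ) with h0 | h0
    · rw [← h0]; simp
    · have h1 := hmin (show α / (α + β) ∈ Icc (0 : ℝ) 1 from
        ⟨by positivity, by rw [div_le_one h0]; linarith⟩)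
      have e : α • A - β • B = (α + β) •
          ((α / (α + β)) • A - (1 - α / (α + β)) • B) := by
        rw [smul_sub, smul_smul, smul_smul]
        congr 2
        · field_simp
        · field_simp; ring
      rw [e, norm_smul, Real.norm_of_nonneg h0.le, mul_comm]
      exact mul_le_mul_of_nonneg_left h1 h0.le

variable {m : ℕ} [NeZero m] {v : Fin m → Space}

theorem norm_lineMap_sub_le {m : ℕ} (d : Fin m → Space) (i k : Fin m) (t : ℝ) (ht : 0 ≤ t) :
    ‖AffineMap.lineMap (d i) (d k) t - d i‖ ≤ t * (2 * ‖d‖) := by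
  have : AffineMap.lineMap (d i) (d k) t - d i = t • (d k - d i) := by
    rw [AffineMap.lineMap_apply_module']; abel
  rw [this, norm_smul, Real.norm_of_nonneg ht]
  have h1 := norm_sub_le (d k) (d i)
  have h2 := norm_le_pi_norm d k
  have h3 := norm_le_pi_norm d i
  exact mul_le_mul_of_nonneg_left (by linarith) ht

theorem norm_lineMap_le {m : ℕ} (d : Fin m → Space) (i k : Fin m) (t : ℝ) (ht : 0 ≤ t)
    (ht1 : t ≤ 1) : ‖AffineMap.lineMap (d i) (d k) t‖ ≤ ‖d‖ := by
  rw [AffineMap.lineMap_apply_module]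
  refine (norm_add_le _ _).trans ?_
  rw [norm_smul, norm_smul, Real.norm_of_nonneg ht, Real.norm_of_nonneg (by linarith)]
  nlinarith [norm_le_pi_norm d k, norm_le_pi_norm d i]

theorem IsSimplePolygon.adjacent_bound (hv : IsSimplePolygon v) (i : Fin m) :
    ∃ C, 0 ≤ C ∧ ∀ (d : Fin m → Space) (t s : ℝ), 0 ≤ t → t ≤ 1 → 0 ≤ s → s ≤ 1 →
      ‖AffineMap.lineMap (d i) (d (i + 1)) t -
          AffineMap.lineMap (d (i + 1)) (d (i + 1 + 1)) s‖ ≤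
        C * ‖d‖ * ‖AffineMap.lineMap (v i) (v (i + 1)) t -
          AffineMap.lineMap (v (i + 1)) (v (i + 1 + 1)) s‖ := by
  have hne : i ≠ i + 1 := fun e => hv.ne_succ i (by rw [← e])
  obtain ⟨c, hc0, hc⟩ := exists_angle_bound (A := v i - v (i + 1))
    (B := v (i + 1 + 1) - v (i + 1)) (by
      intro α β h1 h2 h3 h4 h5
      have hx : AffineMap.lineMap (v i) (v (i + 1)) (1 - α) =
          AffineMap.lineMap (v (i + 1)) (v (i + 1 + 1)) β := by
        rw [AffineMap.lineMap_apply_module', AffineMap.lineMap_apply_module', ← h5]; module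
      rcases hv.inter_edge hne (x := AffineMap.lineMap (v i) (v (i + 1)) (1 - α))
        (mem_segment_iff_lineMap.2 ⟨1 - α, by linarith, by linarith, rfl⟩)
        (mem_segment_iff_lineMap.2 ⟨β, h3, h4, hx.symm⟩) with h | h
      · have : 1 - α = 1 := lineMap_inj (hv.ne_succ i) (by rw [h.2]; simp)
        linarith
      · have : β = 1 := lineMap_inj (hv.ne_succ (i + 1)) (by
          rw [← hx, h.2]; simp [← h.1])
        exact absurd h.1.symm (fin_add_two_ne hv.three_le i))
    (sub_ne_zero.2 (hv.ne_succ (i + 1)).symm)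
  refine ⟨2 / c, by positivity, fun d t s ht0 ht1 hs0 hs1 => ?_⟩
  have e : AffineMap.lineMap (v i) (v (i + 1)) t - AffineMap.lineMap (v (i + 1)) (v (i + 1 + 1)) s
      = (1 - t) • (v i - v (i + 1)) - s • (v (i + 1 + 1) - v (i + 1)) := by
    rw [AffineMap.lineMap_apply_module', AffineMap.lineMap_apply_module']; module
  have h1 := hc (1 - t) s (by linarith) hs0
  rw [← e] at h1
  have h2 := norm_lineMap_sub_le d (i + 1) i (1 - t) (by linarith)
  rw [AffineMap.lineMap_apply_one_sub] at h2
  have h3 := norm_lineMap_sub_le d (i + 1) (i + 1 + 1) s hs0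
  have h4 := norm_sub_le (AffineMap.lineMap (d i) (d (i + 1)) t - d (i + 1))
    (AffineMap.lineMap (d (i + 1)) (d (i + 1 + 1)) s - d (i + 1))
  rw [sub_sub_sub_cancel_right] at h4
  have h5 : 2 / c * ‖d‖ * (c * (1 - t + s)) = (1 - t) * (2 * ‖d‖) + s * (2 * ‖d‖) := by
    field_simp
  have h6 := mul_le_mul_of_nonneg_left h1 (show 0 ≤ 2 / c * ‖d‖ by positivity)
  linarith

/-- Adjacent edges form a nonzero angle, equal edges are handled by linearity, and all other pairs
of edges have positive distance. -/
theorem IsSimplePolygon.pair_bound (hv : IsSimplePolygon v) (i k : Fin m) :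
    ∃ C, 0 ≤ C ∧ ∀ (d : Fin m → Space) (t s : ℝ), 0 ≤ t → t ≤ 1 → 0 ≤ s → s ≤ 1 →
      ‖AffineMap.lineMap (d i) (d (i + 1)) t - AffineMap.lineMap (d k) (d (k + 1)) s‖ ≤
        C * ‖d‖ * ‖AffineMap.lineMap (v i) (v (i + 1)) t -
          AffineMap.lineMap (v k) (v (k + 1)) s‖ := by
  by_cases h1 : k = i + 1
  · subst h1; exact hv.adjacent_bound i
  by_cases h2 : i = k + 1
  · subst h2
    obtain ⟨C, h0, hC⟩ := hv.adjacent_bound k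
    refine ⟨C, h0, fun d t s a b e f => ?_⟩
    rw [norm_sub_rev, norm_sub_rev (AffineMap.lineMap (v (k + 1)) _ _)]
    exact hC d s t e f a b
  by_cases h3 : i = k
  · subst h3
    have hpos : 0 < ‖v (i + 1) - v i‖ := norm_pos_iff.2 (sub_ne_zero.2 (hv.ne_succ i).symm)
    refine ⟨2 / ‖v (i + 1) - v i‖, by positivity, fun d t s _ _ _ _ => ?_⟩
    have e : ∀ u : Fin m → Space, AffineMap.lineMap (u i) (u (i + 1)) t -
        AffineMap.lineMap (u i) (u (i + 1)) s = (t - s) • (u (i + 1) - u i) := by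
      intro u; simp only [AffineMap.lineMap_apply_module']; module
    rw [e d, e v, norm_smul, norm_smul]
    have h4 : ‖d (i + 1) - d i‖ ≤ 2 * ‖d‖ := by
      have := norm_sub_le (d (i + 1)) (d i)
      linarith [norm_le_pi_norm d (i + 1), norm_le_pi_norm d i]
    have h5 : 2 / ‖v (i + 1) - v i‖ * ‖d‖ * (‖t - s‖ * ‖v (i + 1) - v i‖) = ‖t - s‖ * (2 * ‖d‖) := by
      field_simp
    rw [h5]
    exact mul_le_mul_of_nonneg_left h4 (norm_nonneg _)
  · obtain ⟨ρ, hρ, hgap⟩ := exists_disjoint_gap (isCompact_segment (v i) (v (i + 1)))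
      (isCompact_segment (v k) (v (k + 1))).isClosed (fun x hx hx' => by
        rcases hv.inter_edge h3 hx hx' with h | h
        · exact h1 h.1
        · exact h2 h.1)
    refine ⟨2 / ρ, by positivity, fun d t s a b e f => ?_⟩
    have h4 : ρ ≤ ‖AffineMap.lineMap (v i) (v (i + 1)) t -
        AffineMap.lineMap (v k) (v (k + 1)) s‖ := by
      by_contra hcon
      push Not at hcon
      refine hgap _ (mem_segment_iff_lineMap.2 ⟨t, a, b, rfl⟩) _ ?_
        (mem_segment_iff_lineMap.2 ⟨s, e, f, rfl⟩)
      rwa [dist_comm, dist_eq_norm]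
    have h5 := norm_sub_le (AffineMap.lineMap (d i) (d (i + 1)) t)
      (AffineMap.lineMap (d k) (d (k + 1)) s)
    have h6 := norm_lineMap_le d i (i + 1) t a b
    have h7 := norm_lineMap_le d k (k + 1) s e f
    have h8 : 2 / ρ * ‖d‖ * ρ = 2 * ‖d‖ := by field_simp
    have h9 := mul_le_mul_of_nonneg_left h4 (show 0 ≤ 2 / ρ * ‖d‖ by positivity)
    linarith

/-- In other words: the displacement obtained by interpolating `d` along the edges is a well-defined
function on the polygon, Lipschitz with constant `C * ‖d‖`. -/
theorem IsSimplePolygon.chord_arc (hv : IsSimplePolygon v) :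
    ∃ C, 0 ≤ C ∧ ∀ (i k : Fin m) (d : Fin m → Space) (t s : ℝ), 0 ≤ t → t ≤ 1 → 0 ≤ s → s ≤ 1 →
      ‖AffineMap.lineMap (d i) (d (i + 1)) t - AffineMap.lineMap (d k) (d (k + 1)) s‖ ≤
        C * ‖d‖ * ‖AffineMap.lineMap (v i) (v (i + 1)) t -
          AffineMap.lineMap (v k) (v (k + 1)) s‖ := by
  choose C h0 hC using fun p : Fin m × Fin m => hv.pair_bound p.1 p.2
  refine ⟨∑ p, C p, Finset.sum_nonneg fun p _ => h0 p, fun i k d t s a b e f => ?_⟩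
  refine (hC (i, k) d t s a b e f).trans ?_
  have := Finset.single_le_sum (fun p _ => h0 p) (Finset.mem_univ (i, k))
  gcongr

/-- A small perturbation of the vertices of a simple polygon is an ambient isotopy. -/
theorem IsSimplePolygon.exists_perturb (hv : IsSimplePolygon v) :
    ∃ ε > 0, ∀ d : Fin m → Space, ‖d‖ < ε →
      IsSimplePolygon (v + d) ∧ AmbientIsotopic (carrier v) (carrier (v + d)) := by
  obtain ⟨C, hC0, hC⟩ := hv.chord_arc
  set L := lipschitzExtensionConstant Space with hL
  -- Extending a Lipschitz map from the polygon to space multiplies its constant by at most `L`;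
  -- this bound on `‖d‖` makes the result less than one.
  refine ⟨1 / (L * C + 1), by positivity, fun d hd => ?_⟩
  have hpar : ∀ x ∈ carrier v, ∃ p : Fin m × ℝ, 0 ≤ p.2 ∧ p.2 ≤ 1 ∧
      AffineMap.lineMap (v p.1) (v (p.1 + 1)) p.2 = x := by
    intro x hx
    obtain ⟨i, hi⟩ := Set.mem_iUnion.1 hx
    obtain ⟨t, h0, h1, h2⟩ := mem_segment_iff_lineMap.1 hi
    exact ⟨(i, t), h0, h1, h2⟩
  choose! par hp0 hp1 hp using hpar
  set D₀ : Space → Space := fun x =>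
    AffineMap.lineMap (d (par x).1) (d ((par x).1 + 1)) (par x).2 with hD₀
  have hlip : LipschitzOnWith (Real.toNNReal (C * ‖d‖)) D₀ (carrier v) := by
    refine LipschitzOnWith.of_dist_le_mul fun x hx y hy => ?_
    rw [dist_eq_norm, dist_eq_norm, Real.coe_toNNReal _ (by positivity)]
    have := hC (par x).1 (par y).1 d (par x).2 (par y).2 (hp0 x hx) (hp1 x hx) (hp0 y hy) (hp1 y hy)
    rwa [hp x hx, hp y hy] at this
  obtain ⟨D, hDlip, hDeq⟩ := hlip.extend_finite_dimension
  set c := L * Real.toNNReal (C * ‖d‖) with hc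
  have hc1 : c < 1 := by
    rw [← NNReal.coe_lt_coe, hc]
    push_cast
    rw [Real.coe_toNNReal _ (by positivity)]
    rw [lt_div_iff₀ (by positivity)] at hd
    have := norm_nonneg d
    nlinarith
  have hmem : ∀ i (t : ℝ), 0 ≤ t → t ≤ 1 → AffineMap.lineMap (v i) (v (i + 1)) t ∈ carrier v :=
    fun i t h0 h1 => Set.mem_iUnion.2 ⟨i, mem_segment_iff_lineMap.2 ⟨t, h0, h1, rfl⟩⟩
  have hDval : ∀ i (t : ℝ), 0 ≤ t → t ≤ 1 → D (AffineMap.lineMap (v i) (v (i + 1)) t) =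
      AffineMap.lineMap (d i) (d (i + 1)) t := by
    intro i t h0 h1
    have hx := hmem i t h0 h1
    set x := AffineMap.lineMap (v i) (v (i + 1)) t with hxdef
    rw [← hDeq hx]
    -- Two parameters of the same point have distance zero in space, so the chord-arc bound forces
    -- equal displacements; the choice made by `par` is immaterial.
    have := hC (par x).1 i d (par x).2 t (hp0 x hx) (hp1 x hx) h0 h1
    rw [hp x hx, ← hxdef, sub_self, norm_zero, mul_zero] at this
    exact sub_eq_zero.1 (norm_le_zero_iff.1 this)
  have hF : ∀ i (t : ℝ), 0 ≤ t → t ≤ 1 →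
      AffineMap.lineMap (v i) (v (i + 1)) t + D (AffineMap.lineMap (v i) (v (i + 1)) t) =
      AffineMap.lineMap ((v + d) i) ((v + d) (i + 1)) t := by
    intro i t h0 h1
    rw [hDval i t h0 h1]
    simp only [AffineMap.lineMap_apply_module', Pi.add_apply]; module
  have hinj : ∀ x y, x + D x = y + D y → x = y := by
    intro x y e
    have h1 : x - y = D y - D x := by
      rw [sub_eq_sub_iff_add_eq_add, e, add_comm]
    have h2 := hDlip.norm_sub_le y x
    rw [← h1, norm_sub_rev y x] at h2
    have hc1' : (c : ℝ) < 1 := by exact_mod_cast hc1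
    have h0 := norm_nonneg (x - y)
    have h3 : ‖x - y‖ ≤ c * ‖x - y‖ := h2
    have : ‖x - y‖ = 0 := by nlinarith
    exact sub_eq_zero.1 (norm_eq_zero.1 this)
  refine ⟨?_, ?_⟩
  · rintro ⟨i, t⟩ ⟨-, ht0, ht1⟩ ⟨k, s⟩ ⟨-, hs0, hs1⟩ e
    dsimp only at *
    refine hv ⟨mem_univ _, ht0, ht1⟩ ⟨mem_univ _, hs0, hs1⟩ (hinj _ _ ?_)
    dsimp only
    rw [hF i t ht0 ht1.le, hF k s hs0 hs1.le, e]
  · have := ambientIsotopic_perturb D c hc1 hDlip (carrier v)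
    convert this using 1
    ext x
    constructor
    · intro hx
      obtain ⟨i, hi⟩ := Set.mem_iUnion.1 hx
      obtain ⟨t, h0, h1, rfl⟩ := mem_segment_iff_lineMap.1 hi
      exact ⟨_, hmem i t h0 h1, hF i t h0 h1⟩
    · rintro ⟨y, hy, rfl⟩
      obtain ⟨i, hi⟩ := Set.mem_iUnion.1 hy
      obtain ⟨t, h0, h1, rfl⟩ := mem_segment_iff_lineMap.1 hi
      exact Set.mem_iUnion.2 ⟨i, mem_segment_iff_lineMap.2 ⟨t, h0, h1, (hF i t h0 h1).symm⟩⟩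

end ChordArc

/-! ### General position is dense -/

/-- The determinant of the equations of three lines in the plane, given by pairs of points. -/
def concur (a b c d e f : ℝ × ℝ) : ℝ :=
  -(b.2 - a.2) * ((d.1 - c.1) * (-(f.1 - e.1) * e.2 + (f.2 - e.2) * e.1) -
    (f.1 - e.1) * (-(d.1 - c.1) * c.2 + (d.2 - c.2) * c.1)) +
  (d.2 - c.2) * ((b.1 - a.1) * (-(f.1 - e.1) * e.2 + (f.2 - e.2) * e.1) -
    (f.1 - e.1) * (-(b.1 - a.1) * a.2 + (b.2 - a.2) * a.1)) -
  (f.2 - e.2) * ((b.1 - a.1) * (-(d.1 - c.1) * c.2 + (d.2 - c.2) * c.1) -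
    (d.1 - c.1) * (-(b.1 - a.1) * a.2 + (b.2 - a.2) * a.1))

/-- A common point is a nontrivial solution, in homogeneous coordinates, of the three equations, so
their determinant vanishes. The coefficients of the combination are cofactors. -/
theorem concur_eq_zero {a b c d e f x : ℝ × ℝ} (h1 : side a b x = 0) (h2 : side c d x = 0)
    (h3 : side e f x = 0) : concur a b c d e f = 0 := by
  simp only [side, concur] at *
  linear_combination (-(d.2 - c.2) * (f.1 - e.1) + (f.2 - e.2) * (d.1 - c.1)) * h1 +
    ((b.2 - a.2) * (f.1 - e.1) - (f.2 - e.2) * (b.1 - a.1)) * h2 +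
    (-(b.2 - a.2) * (d.1 - c.1) + (d.2 - c.2) * (b.1 - a.1)) * h3

/-- If the zero set had an interior point, the identity theorem would make `f` vanish everywhere. -/
theorem dense_ne_zero_of_analytic {E : Type*} [NormedAddCommGroup E] [NormedSpace ℝ E]
    {f : E → ℝ} (hf : ∀ x, AnalyticAt ℝ f x) {x₀ : E} (h0 : f x₀ ≠ 0) :
    Dense {x | f x ≠ 0} := by
  have : {x | f x ≠ 0} = {x | f x = 0}ᶜ := rfl
  rw [this, ← interior_eq_empty_iff_dense_compl, Set.eq_empty_iff_forall_notMem]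
  intro x hx
  have h1 : f =ᶠ[𝓝 x] 0 := Filter.mem_of_superset (mem_interior_iff_mem_nhds.1 hx) fun _ h => h
  exact h0 (AnalyticOnNhd.eqOn_zero_of_preconnected_of_eventuallyEq_zero
    (U := univ) (fun x _ => hf x) isPreconnected_univ (mem_univ x) h1 (mem_univ x₀))

section Generic

variable {m : ℕ}

theorem analyticAt_coord_fst (i : Fin m) (v : Fin m → Space) :
    AnalyticAt ℝ (fun v : Fin m → Space => (v i).1.1) v :=
  ((ContinuousLinearMap.fst ℝ ℝ ℝ).comp ((ContinuousLinearMap.fst ℝ (ℝ × ℝ) ℝ).comp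
    (ContinuousLinearMap.proj (R := ℝ) (φ := fun _ : Fin m => Space) i))).analyticAt v

theorem analyticAt_coord_snd (i : Fin m) (v : Fin m → Space) :
    AnalyticAt ℝ (fun v : Fin m → Space => (v i).1.2) v :=
  ((ContinuousLinearMap.snd ℝ ℝ ℝ).comp ((ContinuousLinearMap.fst ℝ (ℝ × ℝ) ℝ).comp
    (ContinuousLinearMap.proj (R := ℝ) (φ := fun _ : Fin m => Space) i))).analyticAt v

theorem analyticAt_side (a b c : Fin m) (v : Fin m → Space) :
    AnalyticAt ℝ (fun v : Fin m → Space => side (v a).1 (v b).1 (v c).1) v := by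
  have hx := fun i => analyticAt_coord_fst (m := m) i v
  have hy := fun i => analyticAt_coord_snd (m := m) i v
  exact (((hx b).sub (hx a)).mul ((hy c).sub (hy a))).sub
    (((hy b).sub (hy a)).mul ((hx c).sub (hx a)))

theorem analyticAt_concur (a b c d e f : Fin m) (v : Fin m → Space) :
    AnalyticAt ℝ
      (fun v : Fin m → Space => concur (v a).1 (v b).1 (v c).1 (v d).1 (v e).1 (v f).1) v := by
  have hx := fun i => analyticAt_coord_fst (m := m) i v
  have hy := fun i => analyticAt_coord_snd (m := m) i v
  have hX := fun i k => (hx i).sub (hx k)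
  have hY := fun i k => (hy i).sub (hy k)
  have hC := fun i k => (((hX i k).neg).mul (hy k)).add ((hY i k).mul (hx k))
  exact ((((hY b a).neg).mul (((hX d c).mul (hC f e)).sub ((hX f e).mul (hC d c)))).add
    ((hY d c).mul (((hX b a).mul (hC f e)).sub ((hX f e).mul (hC b a))))).sub
    ((hY f e).mul (((hX b a).mul (hC d c)).sub ((hX d c).mul (hC b a))))

theorem dense_side_ne_zero {a b c : Fin m} (h1 : b ≠ a) (h2 : c ≠ a) (h3 : c ≠ b) :
    Dense {v : Fin m → Space | side (v a).1 (v b).1 (v c).1 ≠ 0} := by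
  refine dense_ne_zero_of_analytic (analyticAt_side a b c)
    (x₀ := fun i => if i = b then ((1, 0), 0) else if i = c then ((0, 1), 0) else 0) ?_
  simp [side, h1.symm, h2.symm, h3]

theorem dense_concur_ne_zero {a b c d e f : Fin m} (hab : a ≠ b) (had : a ≠ d)
    (hae : a ≠ e) (haf : a ≠ f) (hbc : b ≠ c) (hbd : b ≠ d) (hbf : b ≠ f)
    (hcd : c ≠ d) (hce : c ≠ e) (hcf : c ≠ f) (hde : d ≠ e) (hef : e ≠ f) :
    Dense {v : Fin m → Space |
      concur (v a).1 (v b).1 (v c).1 (v d).1 (v e).1 (v f).1 ≠ 0} := by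
  -- At this point the three lines are the sides of a triangle: `a`, `c` at the origin, `b`, `e` at
  -- `(1, 0)`, and `d`, `f` at `(0, 1)`.
  refine dense_ne_zero_of_analytic (analyticAt_concur a b c d e f)
    (x₀ := fun i => if i = b ∨ i = e then ((1, 0), 0) else
      if i = d ∨ i = f then ((0, 1), 0) else 0) ?_
  simp [concur, hab, had, hae, haf, hbc.symm, hbd.symm, hbf.symm, hcd, hce, hcf, hde, hef.symm]

variable [NeZero m]

/-- General position of the vertices of a closed polygon. -/
structure IsGeneralPosition (v : Fin m → Space) : Prop where
  off : ∀ i k : Fin m, k ≠ i → k ≠ i + 1 → side (v i).1 (v (i + 1)).1 (v k).1 ≠ 0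
  concur : ∀ i k l : Fin m, i ≠ k → i ≠ l → k ≠ l → i ≠ k + 1 → k ≠ i + 1 → i ≠ l + 1 →
    l ≠ i + 1 → k ≠ l + 1 → l ≠ k + 1 →
    concur (v i).1 (v (i + 1)).1 (v k).1 (v (k + 1)).1 (v l).1 (v (l + 1)).1 ≠ 0
  ne : (v 0).1.1 ≠ (v 1).1.1

theorem dense_isGeneralPosition (hm : 3 ≤ m) :
    Dense {v : Fin m → Space | IsGeneralPosition v} := by
  have h1 : ∀ i : Fin m, i + 1 ≠ i := by
    intro i h
    have h2 : i + 1 = i + 0 := by rw [h, add_zero]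
    have h3 := congrArg Fin.val (add_left_cancel h2)
    rw [Fin.val_one', Nat.mod_eq_of_lt (by omega)] at h3
    simp at h3
  have open_of : ∀ f : (Fin m → Space) → ℝ, (∀ v, AnalyticAt ℝ f v) → IsOpen {v | f v ≠ 0} :=
    fun f hf => isOpen_ne_fun (continuous_iff_continuousAt.2 fun v => (hf v).continuousAt)
      continuous_const
  let A : {p : Fin m × Fin m // p.2 ≠ p.1 ∧ p.2 ≠ p.1 + 1} → Set (Fin m → Space) :=
    fun p => {v | side (v p.1.1).1 (v (p.1.1 + 1)).1 (v p.1.2).1 ≠ 0}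
  let B : {p : Fin m × Fin m × Fin m // p.1 ≠ p.2.1 ∧ p.1 ≠ p.2.2 ∧ p.2.1 ≠ p.2.2 ∧
      p.1 ≠ p.2.1 + 1 ∧ p.2.1 ≠ p.1 + 1 ∧ p.1 ≠ p.2.2 + 1 ∧ p.2.2 ≠ p.1 + 1 ∧
      p.2.1 ≠ p.2.2 + 1 ∧ p.2.2 ≠ p.2.1 + 1} → Set (Fin m → Space) :=
    fun p => {v | concur (v p.1.1).1 (v (p.1.1 + 1)).1 (v p.1.2.1).1 (v (p.1.2.1 + 1)).1
      (v p.1.2.2).1 (v (p.1.2.2 + 1)).1 ≠ 0}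
  have hAo : ∀ p, IsOpen (A p) := fun p => open_of _ (analyticAt_side _ _ _)
  have hBo : ∀ p, IsOpen (B p) := fun p => open_of _ (analyticAt_concur _ _ _ _ _ _)
  have hA : Dense (⋂ p, A p) := dense_iInter_of_isOpen hAo fun p =>
    dense_side_ne_zero (h1 _) p.2.1 p.2.2
  have hB : Dense (⋂ p, B p) := dense_iInter_of_isOpen hBo fun p => by
    obtain ⟨⟨i, k, l⟩, a, b, c, d, e, f, g, h, j⟩ := p
    exact dense_concur_ne_zero (h1 i).symm d b f (Ne.symm e) (fun h => a (add_right_cancel h))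
      (fun h => b (add_right_cancel h)) (h1 k).symm c h (Ne.symm j) (h1 l).symm
  have hC : Dense {v : Fin m → Space | (v 0).1.1 - (v 1).1.1 ≠ 0} := by
    have h01 : (0 : Fin m) ≠ 1 := fun h => h1 0 (by rw [zero_add]; exact h.symm)
    refine dense_ne_zero_of_analytic
      (fun v => (analyticAt_coord_fst 0 v).sub (analyticAt_coord_fst 1 v))
      (x₀ := fun i => if i = 0 then ((1, 0), 0) else 0) ?_
    simp [h01.symm]
  have hCo : IsOpen {v : Fin m → Space | (v 0).1.1 - (v 1).1.1 ≠ 0} :=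
    open_of _ fun v => (analyticAt_coord_fst 0 v).sub (analyticAt_coord_fst 1 v)
  have hAB := hA.inter_of_isOpen_right hB (isOpen_iInter_of_finite hBo)
  refine (hAB.inter_of_isOpen_right hC hCo).mono ?_
  rintro v ⟨⟨hvA, hvB⟩, hvC⟩
  rw [Set.mem_iInter] at hvA hvB
  exact ⟨fun i k a b => hvA ⟨(i, k), a, b⟩,
    fun i k l a b c d e f g h j => hvB ⟨(i, k, l), a, b, c, d, e, f, g, h, j⟩,
    fun h => hvC (sub_eq_zero.2 h)⟩

theorem eq_of_mem_adjacent {a b c x : ℝ × ℝ} (h : side a b c ≠ 0) (h1 : x ∈ segment ℝ a b)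
    (h2 : x ∈ segment ℝ b c) : x = b := by
  obtain ⟨t, -, -, rfl⟩ := mem_segment_iff_lineMap.1 h2
  have h3 := side_eq_zero_of_mem h1
  rw [side_lineMap, side_right, mul_zero, zero_add] at h3
  rcases mul_eq_zero.1 h3 with h4 | h4
  · simp [h4]
  · exact absurd h4 h

/-- If two of the three edges are adjacent, they meet only at their common vertex, which is off the
line of the third. Otherwise the determinant `concur` decides. -/
theorem IsGeneralPosition.no_triple (hm : 3 ≤ m) {v : Fin m → Space} (hv : IsGeneralPosition v)
    {i k l : Fin m} (hik : i ≠ k) (hil : i ≠ l) (hkl : k ≠ l) {x : ℝ × ℝ}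
    (hi : x ∈ segment ℝ (v i).1 (v (i + 1)).1) (hk : x ∈ segment ℝ (v k).1 (v (k + 1)).1)
    (hl : x ∈ segment ℝ (v l).1 (v (l + 1)).1) : False := by
  have adj : ∀ a c : Fin m, c ≠ a → c ≠ a + 1 → x ∈ segment ℝ (v a).1 (v (a + 1)).1 →
      x ∈ segment ℝ (v (a + 1)).1 (v (a + 1 + 1)).1 → x ∈ segment ℝ (v c).1 (v (c + 1)).1 →
      False := by
    intro a c h1 h2 ha ha' hc
    have h3 : a + 1 + 1 ≠ a + 1 := fun h => by
      have h4 : a + 1 + 1 = a + 1 + 0 := by rw [h, add_zero]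
      have h5 := congrArg Fin.val (add_left_cancel h4)
      rw [Fin.val_one', Nat.mod_eq_of_lt (by omega)] at h5
      simp at h5
    have hx := eq_of_mem_adjacent (hv.off a (a + 1 + 1) (fin_add_two_ne hm a) h3) ha ha'
    refine hv.off c (a + 1) (Ne.symm h2) (fun h => h1 (add_right_cancel h).symm) ?_
    rw [← hx]; exact side_eq_zero_of_mem hc
  by_cases h1 : i = k + 1
  · subst h1; exact adj k l (Ne.symm hkl) (Ne.symm hil) hk hi hl
  by_cases h2 : k = i + 1
  · subst h2; exact adj i l (Ne.symm hil) (Ne.symm hkl) hi hk hl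
  by_cases h3 : i = l + 1
  · subst h3; exact adj l k hkl (Ne.symm hik) hl hi hk
  by_cases h4 : l = i + 1
  · subst h4; exact adj i k (Ne.symm hik) hkl hi hl hk
  by_cases h5 : k = l + 1
  · subst h5; exact adj l i hil hik hl hk hi
  by_cases h6 : l = k + 1
  · subst h6; exact adj k i hik hil hk hl hi
  exact hv.concur i k l hik hil hkl h1 h2 h3 h4 h5 h6
    (concur_eq_zero (side_eq_zero_of_mem hi) (side_eq_zero_of_mem hk) (side_eq_zero_of_mem hl))

/-- The vertices of a closed polygon, listed cyclically from a given one on. -/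
def unroll (v : Fin m → Space) (i₀ : Fin m) (i : ℕ) : Space := v (i₀ + Fin.ofNat m i)

theorem ofNat_succ (i : ℕ) : Fin.ofNat m (i + 1) = Fin.ofNat m i + 1 := by
  ext; simp [Fin.val_add]

theorem unroll_succ (v : Fin m → Space) (i₀ : Fin m) (i : ℕ) :
    unroll v i₀ (i + 1) = v (i₀ + Fin.ofNat m i + 1) := by
  rw [unroll, ofNat_succ, add_assoc]

theorem ofNat_inj {i k : ℕ} (hi : i < m) (hk : k < m) (i₀ : Fin m)
    (h : i₀ + Fin.ofNat m i = i₀ + Fin.ofNat m k) : i = k := by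
  have := congrArg Fin.val (add_left_cancel h)
  simpa [Nat.mod_eq_of_lt hi, Nat.mod_eq_of_lt hk] using this

theorem ofNat_self : Fin.ofNat m m = 0 := by ext; simp

theorem IsGeneralPosition.isGeneric {v : Fin m → Space} (hs : IsSimplePolygon v)
    (hv : IsGeneralPosition v) (i₀ : Fin m) : IsGeneric (unroll v i₀) (m - 1) := by
  have hm := hs.three_le
  have hsucc : ∀ i, i₀ + Fin.ofNat m i + 1 = i₀ + Fin.ofNat m (i + 1) := by
    intro i; rw [ofNat_succ, add_assoc]
  have hlast : ∀ i k, i ≤ m - 1 → k ≤ m - 1 → i₀ + Fin.ofNat m k = i₀ + Fin.ofNat m i + 1 →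
      k = i + 1 ∨ (i = m - 1 ∧ k = 0) := by
    intro i k hi hk h
    rw [hsucc] at h
    rcases Nat.lt_or_ge i (m - 1) with h1 | h1
    · exact Or.inl (ofNat_inj (by omega) (by omega) i₀ h)
    · right
      have h2 : i + 1 = m := by omega
      refine ⟨by omega, ofNat_inj (m := m) (by omega) (by omega) i₀ ?_⟩
      rw [h, h2, ofNat_self]; rfl
  refine ⟨by omega, ?_, ?_, ?_, ?_⟩
  · rw [Nat.sub_add_cancel (by omega), unroll, unroll, ofNat_self]; rfl
  · intro i hi k hk h1 h2 h3
    rw [unroll_succ]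
    refine hv.off _ _ (fun h => h1 (ofNat_inj (by omega) (by omega) i₀ h)) fun h => ?_
    rcases hlast i k hi hk h with h | h
    · exact h2 h
    · exact h3 h
  · intro i k l hik hkl hl x h1 h2 h3
    rw [unroll_succ] at h1 h2 h3
    exact hv.no_triple hm
      (fun h => hik.ne (ofNat_inj (by omega) (by omega) i₀ h))
      (fun h => (hik.trans hkl).ne (ofNat_inj (by omega) (by omega) i₀ h))
      (fun h => hkl.ne (ofNat_inj (by omega) (by omega) i₀ h)) h1 h2 h3
  · intro i k hik hk x h1 h2
    rw [unroll_succ] at h1 h2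
    rcases hs.inter_edge (fun h => hik.ne (ofNat_inj (by omega) (by omega) i₀ h)) h1 h2 with h | h
    · rcases hlast i k (by omega) hk h.1 with h3 | h3
      · exact Or.inl ⟨h3, h.2⟩
      · omega
    · rcases hlast k i hk (by omega) h.1 with h3 | h3
      · omega
      · refine Or.inr ⟨h3.2, h3.1, ?_⟩
        rw [h.2, unroll, h3.2]

theorem initialEdges_unroll (v : Fin m → Space) (i₀ : Fin m) :
    initialEdges (unroll v i₀) m = carrier v := by
  ext x
  simp only [initialEdges, carrier, Set.mem_iUnion]
  constructor
  · rintro ⟨i, hi, h⟩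
    rw [unroll_succ] at h
    exact ⟨_, h⟩
  · rintro ⟨a, h⟩
    refine ⟨(a - i₀).val, (a - i₀).isLt, ?_⟩
    have e : i₀ + Fin.ofNat m (a - i₀).val = a := by
      rw [show Fin.ofNat m (a - i₀).val = a - i₀ by ext; simp]
      abel
    rw [unroll_succ, unroll, e]
    exact h

/-- Otherwise `x` would be nonincreasing once around the cycle, hence `x 1 ≥ x 0 ≥ x 1`. -/
theorem exists_lt_succ {x : Fin m → ℝ} (h : x 0 ≠ x 1) : ∃ i, x i < x (i + 1) := by
  by_contra hcon
  push Not at hcon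
  have h1 : ∀ i, x (Fin.ofNat m (i + 1)) ≤ x (Fin.ofNat m 1) := by
    intro i
    induction i with
    | zero => rfl
    | succ i ih =>
      rw [ofNat_succ]
      exact (hcon _).trans ih
  have h2 := h1 (m - 1)
  rw [Nat.sub_add_cancel (NeZero.pos m), ofNat_self] at h2
  have h3 := hcon 0
  rw [zero_add] at h3
  exact h (le_antisymm h2 h3)

end Generic

/-- Every simple polygon is isotopic to one in general position, with first edge running from left
to right. -/
theorem exists_isGeneric {m : ℕ} [NeZero m] {v : Fin m → Space} (hv : IsSimplePolygon v) :
    ∃ w n, IsGeneric w n ∧ (w 0).1.1 < (w 1).1.1 ∧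
      AmbientIsotopic (carrier v) (initialEdges w (n + 1)) := by
  obtain ⟨ε, hε, hd⟩ := hv.exists_perturb
  obtain ⟨v', hv', hdist⟩ := (dense_isGeneralPosition hv.three_le).exists_dist_lt v hε
  have hv'' : v + (v' - v) = v' := by abel
  obtain ⟨h1, h2⟩ := hd (v' - v) (by rwa [← dist_eq_norm, dist_comm])
  rw [hv''] at h1 h2
  obtain ⟨i₀, hi₀⟩ := exists_lt_succ (x := fun i => (v' i).1.1) hv'.ne
  refine ⟨unroll v' i₀, m - 1, hv'.isGeneric h1 i₀, ?_, ?_⟩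
  · have h3 : unroll v' i₀ 0 = v' i₀ := by
      rw [unroll, show Fin.ofNat m 0 = 0 by ext; simp, add_zero]
    have h4 : unroll v' i₀ 1 = v' (i₀ + 1) := by
      rw [show 1 = 0 + 1 from rfl, unroll_succ, show Fin.ofNat m 0 = 0 by ext; simp, add_zero]
    rw [h3, h4]; exact hi₀
  · rw [Nat.sub_add_cancel (NeZero.pos m), initialEdges_unroll]; exact h2

/-! ### Monotone returns give contained straight diagrams -/

/-- A closed polygon whose first edge is projected to the horizontal axis and such that a function
`F` on the plane is increasing along the projection of the other edges. -/
structure IsMonotoneReturn (w : ℕ → Space) (N : ℕ) (F : ℝ × ℝ → ℝ) : Prop where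
  two_le : 2 ≤ N
  closed : w (N + 1) = w 0
  axis_zero : (w 0).1.2 = 0
  axis_one : (w 1).1.2 = 0
  left_lt_right : (w 0).1.1 < (w 1).1.1
  off_axis : ∀ i, 2 ≤ i → i ≤ N → (w i).1.2 ≠ 0
  affine : ∀ i, 1 ≤ i → i ≤ N → ∀ t : ℝ, 0 ≤ t → t ≤ 1 →
    F (AffineMap.lineMap (w i) (w (i + 1)) t).1 = (1 - t) * F (w i).1 + t * F (w (i + 1)).1
  lt_succ : ∀ i, 1 ≤ i → i ≤ N → F (w i).1 < F (w (i + 1)).1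
  disj : ∀ i, 1 ≤ i → i ≤ N → ∀ x ∈ segment ℝ (w 0) (w 1), x ∈ segment ℝ (w i) (w (i + 1)) →
    x = w 0 ∨ x = w 1
  inside : ∀ i, 1 ≤ i → i ≤ N → ∀ x ∈ segment ℝ (w i) (w (i + 1)), x.1.2 = 0 →
    (w 0).1.1 ≤ x.1.1 ∧ x.1.1 ≤ (w 1).1.1

namespace IsMonotoneReturn

variable {w : ℕ → Space} {N : ℕ} {F : ℝ × ℝ → ℝ}

theorem le_of_le (h : IsMonotoneReturn w N F) {i k : ℕ} (hi : 1 ≤ i) (hik : i ≤ k)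
    (hk : k ≤ N + 1) : F (w i).1 ≤ F (w k).1 := by
  induction k, hik using Nat.le_induction with
  | base => exact le_rfl
  | succ k hik ih => exact (ih (by omega)).trans (h.lt_succ k (by omega) (by omega)).le

/-- The values of `F` on successive edges fill successive intervals, which overlap at most in a
common end. In the proof, equality of the values makes a sum of three nonnegative terms vanish. -/
theorem eq_of_lt (h : IsMonotoneReturn w N F) {i k : ℕ} (hi : 1 ≤ i) (hik : i < k) (hk : k ≤ N)
    {x y : Space} (hx : x ∈ segment ℝ (w i) (w (i + 1))) (hy : y ∈ segment ℝ (w k) (w (k + 1)))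
    (e : x.1 = y.1) : k = i + 1 ∧ x = w k ∧ y = w k := by
  obtain ⟨t, ht0, ht1, rfl⟩ := mem_segment_iff_lineMap.1 hx
  obtain ⟨s, hs0, hs1, rfl⟩ := mem_segment_iff_lineMap.1 hy
  have e' := congrArg F e
  rw [h.affine i hi (by omega) t ht0 ht1, h.affine k (by omega) hk s hs0 hs1] at e'
  have h1 := h.lt_succ i hi (by omega)
  have h2 := h.lt_succ k (by omega) hk
  have h3 := h.le_of_le (i := i + 1) (k := k) (by omega) hik (by omega)
  have h4 : (1 - t) * (F (w (i + 1)).1 - F (w i).1) + (F (w k).1 - F (w (i + 1)).1) +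
      s * (F (w (k + 1)).1 - F (w k).1) = 0 := by linear_combination -e'
  have h5 : 0 ≤ (1 - t) * (F (w (i + 1)).1 - F (w i).1) := mul_nonneg (by linarith) (by linarith)
  have h6 : 0 ≤ s * (F (w (k + 1)).1 - F (w k).1) := mul_nonneg hs0 (by linarith)
  have ht : t = 1 := by
    rcases mul_eq_zero.1 (by linarith : (1 - t) * (F (w (i + 1)).1 - F (w i).1) = 0) with h | h <;>
      linarith
  have hs : s = 0 := by
    rcases mul_eq_zero.1 (by linarith : s * (F (w (k + 1)).1 - F (w k).1) = 0) with h | h <;>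
      linarith
  have hki : k = i + 1 := by
    by_contra hne
    have := h.le_of_le (i := i + 1 + 1) (k := k) (by omega) (by omega) (by omega)
    have := h.lt_succ (i + 1) (by omega) (by omega)
    linarith
  subst hki ht hs
  simp

theorem injOn (h : IsMonotoneReturn w N F) {i k : ℕ} (hi : 1 ≤ i) (hi' : i ≤ N) (hk : 1 ≤ k)
    (hk' : k ≤ N) {x y : Space} (hx : x ∈ segment ℝ (w i) (w (i + 1)))
    (hy : y ∈ segment ℝ (w k) (w (k + 1))) (e : x.1 = y.1) : x = y := by
  rcases lt_trichotomy i k with hik | rfl | hik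
  · obtain ⟨-, h1, h2⟩ := h.eq_of_lt hi hik hk' hx hy e
    rw [h1, h2]
  · obtain ⟨t, ht0, ht1, rfl⟩ := mem_segment_iff_lineMap.1 hx
    obtain ⟨s, hs0, hs1, rfl⟩ := mem_segment_iff_lineMap.1 hy
    have e' := congrArg F e
    rw [h.affine i hi (by omega) t ht0 ht1, h.affine i hi (by omega) s hs0 hs1] at e'
    have h1 := h.lt_succ i hi hi'
    rcases mul_eq_zero.1 (by linear_combination e' :
      (t - s) * (F (w (i + 1)).1 - F (w i).1) = 0) with h2 | h2
    · rw [sub_eq_zero.1 h2]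
    · linarith
  · obtain ⟨-, h1, h2⟩ := h.eq_of_lt hk hik hi' hy hx e.symm
    rw [h1, h2]

theorem eq_of_mem_first (h : IsMonotoneReturn w N F) {x y : Space}
    (hx : x ∈ segment ℝ (w 0) (w 1)) (hy : y ∈ segment ℝ (w 0) (w 1)) (e : x.1 = y.1) : x = y := by
  obtain ⟨t, ht0, ht1, rfl⟩ := mem_segment_iff_lineMap.1 hx
  obtain ⟨s, hs0, hs1, rfl⟩ := mem_segment_iff_lineMap.1 hy
  have h1 := h.left_lt_right
  have e' := congrArg Prod.fst e
  simp only [AffineMap.lineMap_apply_module', Prod.fst_add, Prod.smul_fst, Prod.fst_sub,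
    smul_eq_mul] at e'
  rcases mul_eq_zero.1 (by linear_combination e' :
    (t - s) * ((w 1).1.1 - (w 0).1.1) = 0) with h2 | h2
  · rw [sub_eq_zero.1 h2]
  · linarith

theorem simple (h : IsMonotoneReturn w N F) {i k : ℕ} (hik : i < k) (hk : k ≤ N) {x : Space}
    (hx : x ∈ segment ℝ (w i) (w (i + 1))) (hy : x ∈ segment ℝ (w k) (w (k + 1))) :
    (k = i + 1 ∧ x = w k) ∨ (i = 0 ∧ k = N ∧ x = w 0) := by
  have h2 := h.two_le
  have ne : ∀ i, 1 ≤ i → i ≤ N → w i ≠ w (i + 1) := fun i hi hi' e =>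
    (h.lt_succ i hi hi').ne (by rw [← e])
  rcases Nat.eq_zero_or_pos i with rfl | hi
  · rcases h.disj k (by omega) hk x hx hy with rfl | rfl
    · by_cases hkN : k = N
      · exact Or.inr ⟨rfl, hkN, rfl⟩
      · have h3 : w 0 ∈ segment ℝ (w N) (w (N + 1)) := by
          rw [h.closed]; exact right_mem_segment ℝ _ _
        have h4 := (h.eq_of_lt (by omega) (by omega : k < N) le_rfl hy h3 rfl).2.1
        exact absurd (h.closed.trans h4).symm (ne N (by omega) le_rfl)
    · by_cases hk1 : k = 1
      · exact Or.inl ⟨hk1, by rw [hk1]⟩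
      · obtain ⟨h3, h4, -⟩ := h.eq_of_lt le_rfl (by omega : 1 < k) hk
          (left_mem_segment ℝ (w 1) (w (1 + 1))) hy rfl
        subst h3
        exact absurd h4 (ne 1 le_rfl (by omega))
  · obtain ⟨h3, h4, -⟩ := h.eq_of_lt hi hik hk hx hy rfl
    exact Or.inl ⟨h3, h4⟩

/-- An edge with an end off the axis meets it at most once. Hence there are at most `N` crossings,
as all of them lie on the axis. -/
theorem fst_subsingleton (h : IsMonotoneReturn w N F) {i : ℕ} (hi : 1 ≤ i) (hi' : i ≤ N) :
    {q : ℝ × ℝ | ∃ x ∈ segment ℝ (w i) (w (i + 1)), x.1 = q ∧ q.2 = 0}.Subsingleton := by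
  have h2 := h.two_le
  have key : (w i).1.2 ≠ 0 ∨ (w (i + 1)).1.2 ≠ 0 := by
    by_cases h1 : i = 1
    · exact Or.inr (h.off_axis _ (by omega) (by omega))
    · exact Or.inl (h.off_axis _ (by omega) (by omega))
  rintro _ ⟨x, hx, rfl, hx0⟩ _ ⟨y, hy, rfl, hy0⟩
  obtain ⟨t, -, -, rfl⟩ := mem_segment_iff_lineMap.1 hx
  obtain ⟨s, -, -, rfl⟩ := mem_segment_iff_lineMap.1 hy
  have e : ∀ t : ℝ, (AffineMap.lineMap (w i) (w (i + 1)) t).1.2 =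
      (1 - t) * (w i).1.2 + t * (w (i + 1)).1.2 := fun t => by
    simp only [AffineMap.lineMap_apply_module', Prod.fst_add, Prod.snd_add, Prod.smul_fst,
      Prod.smul_snd, Prod.fst_sub, Prod.snd_sub, smul_eq_mul]
    ring
  rw [e] at hx0 hy0
  rw [affine_zero_unique key hx0 hy0]

theorem hasContainedStraightDiagram (h : IsMonotoneReturn w N F) :
    ∃ n, HasContainedStraightDiagram (initialEdges w (N + 1)) n := by
  have h2 := h.two_le
  let v : Fin (N + 1) → Space := fun i => w i
  have hsucc : ∀ i : Fin (N + 1), v (i + 1) = w (i + 1) := by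
    intro i
    simp only [v, Fin.val_add_one]
    split_ifs with hi
    · rw [hi, Fin.val_last, h.closed]
    · rfl
  have hedge : ∀ i : Fin (N + 1), edge v i = segment ℝ (w i) (w (i + 1)) := fun i => by
    rw [edge, hsucc]
  have hcar : carrier v = initialEdges w (N + 1) := by
    ext x
    simp only [carrier, initialEdges, mem_iUnion, hedge]
    exact ⟨fun ⟨i, hi⟩ => ⟨i, i.2, hi⟩, fun ⟨i, hi, hx⟩ => ⟨⟨i, hi⟩, hx⟩⟩
  have hmem : ∀ x ∈ carrier v, x ∈ segment ℝ (w 0) (w 1) ∨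
      ∃ i, 1 ≤ i ∧ i ≤ N ∧ x ∈ segment ℝ (w i) (w (i + 1)) := by
    intro x hx
    rw [hcar, initialEdges, mem_iUnion₂] at hx
    obtain ⟨i, hi, hx⟩ := hx
    rcases Nat.eq_zero_or_pos i with rfl | hi0
    · exact Or.inl hx
    · exact Or.inr ⟨i, hi0, by omega, hx⟩
  have haxis : ∀ x ∈ segment ℝ (w 0) (w 1),
      x.1.2 = 0 ∧ (w 0).1.1 ≤ x.1.1 ∧ x.1.1 ≤ (w 1).1.1 := by
    intro x hx
    obtain ⟨t, ht0, ht1, rfl⟩ := mem_segment_iff_lineMap.1 hx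
    have h3 := h.left_lt_right
    simp only [AffineMap.lineMap_apply_module', Prod.fst_add, Prod.snd_add, Prod.smul_fst,
      Prod.smul_snd, Prod.fst_sub, Prod.snd_sub, smul_eq_mul, h.axis_zero, h.axis_one]
    refine ⟨by ring, ?_, ?_⟩ <;> nlinarith
  have hcross : ∀ q ∈ crossings (carrier v), ∃ x ∈ segment ℝ (w 0) (w 1), ∃ i, 1 ≤ i ∧ i ≤ N ∧
      ∃ y ∈ segment ℝ (w i) (w (i + 1)), x.1 = q ∧ y.1 = q ∧ x ≠ y := by
    rintro q ⟨x, ⟨hx, hxq⟩, y, ⟨hy, hyq⟩, hxy⟩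
    rw [mem_preimage, mem_singleton_iff] at hxq hyq
    rcases hmem x hx with hx | ⟨i, hi, hi', hx⟩ <;> rcases hmem y hy with hy | ⟨k, hk, hk', hy⟩
    · exact absurd (h.eq_of_mem_first hx hy (hxq.trans hyq.symm)) hxy
    · exact ⟨x, hx, k, hk, hk', y, hy, hxq, hyq, hxy⟩
    · exact ⟨y, hy, i, hi, hi', x, hx, hyq, hxq, hxy.symm⟩
    · exact absurd (h.injOn hi hi' hk hk' hx hy (hxq.trans hyq.symm)) hxy
  have hend : w 0 ∈ segment ℝ (w N) (w (N + 1)) := by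
    rw [h.closed]; exact right_mem_segment ℝ _ _
  have hone : ((1 : Fin (N + 1)) : ℕ) = 1 := by
    rw [Fin.val_one', Nat.mod_eq_of_lt (by omega)]
  -- The straight strand is the single edge from `w 0` to `w 1`.
  refine ⟨_, N + 1, inferInstance, v, 1, ?_, hcar ▸ AmbientIsotopic.refl _, ⟨?_, ?_, ?_⟩,
    ⟨?_, ?_, ?_, ?_⟩, ?_, rfl⟩
  · refine isSimplePolygon_of_inter_edge (fun i => ?_) fun i k hik x hx hy => ?_
    · rw [hsucc]
      rcases Nat.eq_zero_or_pos (i : ℕ) with hi | hi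
      · intro e
        simp only [v, hi] at e
        exact h.left_lt_right.ne (by rw [e])
      · exact fun e => (h.lt_succ i hi (by omega)).ne (by rw [← e])
    · rw [hedge] at hx hy
      have key : ∀ i k : Fin (N + 1), i < k → x ∈ segment ℝ (w i) (w (i + 1)) →
          x ∈ segment ℝ (w k) (w (k + 1)) → (k = i + 1 ∧ x = v k) ∨ (i = k + 1 ∧ x = v i) := by
        intro i k hik hx hy
        rcases h.simple (Fin.lt_def.1 hik) (by omega) hx hy with ⟨h3, h4⟩ | ⟨h3, h4, h5⟩
        · refine Or.inl ⟨Fin.ext ?_, h4⟩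
          rw [Fin.val_add_one_of_lt (lt_of_lt_of_le hik (Fin.le_last k)), h3]
        · refine Or.inr ⟨?_, by simp only [v, h3, h5]⟩
          rw [show k = Fin.last N from Fin.ext h4, Fin.last_add_one]
          exact Fin.ext h3
      rcases lt_or_gt_of_ne hik with hik | hik
      · exact key i k hik hx hy
      · exact (key k i hik hy hx).symm
  · refine ((Set.finite_Icc 1 N).biUnion (t := fun i =>
      {q : ℝ × ℝ | ∃ x ∈ segment ℝ (w i) (w (i + 1)), x.1 = q ∧ q.2 = 0})
      fun i hi => (h.fst_subsingleton hi.1 hi.2).finite).subset fun q hq => ?_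
    obtain ⟨x, hx, i, hi, hi', y, hy, hxq, hyq, -⟩ := hcross q hq
    exact mem_iUnion₂.2 ⟨i, ⟨hi, hi'⟩, y, hy, hyq, by rw [← hxq]; exact (haxis x hx).1⟩
  · intro q
    have hsub : carrier v ∩ Prod.fst ⁻¹' {q} ⊆ (segment ℝ (w 0) (w 1) ∩ Prod.fst ⁻¹' {q}) ∪
        {x | (∃ i, 1 ≤ i ∧ i ≤ N ∧ x ∈ segment ℝ (w i) (w (i + 1))) ∧ x.1 = q} := by
      rintro x ⟨hx, hxq⟩
      rcases hmem x hx with hx | hx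
      · exact Or.inl ⟨hx, hxq⟩
      · exact Or.inr ⟨hx, hxq⟩
    refine (encard_le_encard hsub).trans ((encard_union_le _ _).trans ?_)
    rw [show (2 : ℕ∞) = 1 + 1 by norm_num]
    refine add_le_add (encard_le_one_iff.2 ?_) (encard_le_one_iff.2 ?_)
    · rintro x y ⟨hx, hxq⟩ ⟨hy, hyq⟩
      exact h.eq_of_mem_first hx hy (Eq.trans hxq (Eq.symm hyq))
    · rintro x y ⟨⟨i, hi, hi', hx⟩, hxq⟩ ⟨⟨k, hk, hk', hy⟩, hyq⟩
      exact h.injOn hi hi' hk hk' hx hy (hxq.trans hyq.symm)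
  -- A vertex over a crossing lies over the axis, so it is `w 0` or `w 1`. These belong both to the
  -- strand and to the return, so injectivity on each makes both preimages equal to that vertex.
  · intro i hi
    obtain ⟨x, hx, k, hk, hk', y, hy, hxq, hyq, hxy⟩ := hcross _ hi
    have h0 : (w i).1.2 = 0 := by
      have := (haxis x hx).1
      rwa [hxq] at this
    have hi2 : (i : ℕ) = 0 ∨ (i : ℕ) = 1 := by
      by_contra hcon
      exact h.off_axis i (by omega) (by omega) h0
    rcases hi2 with hi2 | hi2 <;> simp only [v, hi2] at hxq hyq
    · exact hxy ((h.eq_of_mem_first hx (left_mem_segment ℝ _ _) hxq).trans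
        (h.injOn hk hk' (by omega) le_rfl hy hend hyq).symm)
    · exact hxy ((h.eq_of_mem_first hx (right_mem_segment ℝ _ _) hxq).trans
        (h.injOn hk hk' le_rfl (by omega) hy (left_mem_segment ℝ _ _) hyq).symm)
  · rw [Fin.lt_def, hone]; simp
  · intro i hi
    rw [Fin.le_def, hone] at hi
    have hi2 : (i : ℕ) = 0 ∨ (i : ℕ) = 1 := by omega
    rcases hi2 with hi2 | hi2 <;> simp only [v, hi2]
    exacts [h.axis_zero, h.axis_one]
  · intro i k hik hk
    rw [Fin.le_def, hone] at hk
    rw [Fin.lt_def] at hik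
    have e1 : (i : ℕ) = 0 := by omega
    have e2 : (k : ℕ) = 1 := by omega
    simp only [v, e1, e2]
    exact h.left_lt_right
  · intro x hx y hy e
    simp only [mem_iUnion, hedge, Fin.le_def, hone] at hx hy
    obtain ⟨i, hi, hx⟩ := hx
    obtain ⟨k, hk, hy⟩ := hy
    exact h.injOn hi (by omega) hk (by omega) hx hy e
  · rw [IsContained, Set.disjoint_left]
    rintro _ ⟨x, hx, rfl⟩ ⟨h0, hout⟩
    simp only [v, hone, Fin.val_zero] at hout
    rcases hmem x hx with hx | ⟨i, hi, hi', hx⟩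
    · rcases hout with ho | ho <;> linarith [haxis x hx]
    · rcases hout with ho | ho <;> linarith [h.inside i hi hi' x hx h0]

end IsMonotoneReturn

/-! ### Piecewise linear functions -/

section PiecewiseLinear

/-- The hypothesis says that the bend `m` of the ramp is not strictly between `p` and `q`.
Conditions of this product form are used throughout to say that a segment does not cross a node. -/
theorem max_zero_affine {m p q : ℝ} (h : 0 ≤ (p - m) * (q - m)) {t : ℝ} (ht0 : 0 ≤ t)
    (ht1 : t ≤ 1) : max 0 ((1 - t) * p + t * q - m) =
      (1 - t) * max 0 (p - m) + t * max 0 (q - m) := by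
  rcases mul_nonneg_iff.1 h with ⟨h1, h2⟩ | ⟨h1, h2⟩
  · rw [max_eq_right h1, max_eq_right h2, max_eq_right (by nlinarith)]
    ring
  · rw [max_eq_left h1, max_eq_left h2, max_eq_left (by nlinarith)]
    ring

/-- Piecewise linear interpolation, extended by constants. -/
theorem exists_piecewiseLinear (X : Finset ℝ) (φ : ℝ → ℝ) : ∃ h : ℝ → ℝ, (∀ c ∈ X, h c = φ c) ∧
    (∀ m ∈ X, (∀ c ∈ X, m ≤ c) → ∀ x ≤ m, h x = φ m) ∧
    (∀ m ∈ X, (∀ c ∈ X, c ≤ m) → ∀ x, m ≤ x → h x = φ m) ∧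
    ∀ p q, (∀ c ∈ X, 0 ≤ (p - c) * (q - c)) → ∀ t : ℝ, 0 ≤ t → t ≤ 1 →
      h ((1 - t) * p + t * q) = (1 - t) * h p + t * h q := by
  induction X using Finset.induction_on_max with
  | empty => exact ⟨0, by simp⟩
  | insert M X hM ih =>
    obtain ⟨h, h1, h2, h3, h4⟩ := ih
    rcases X.eq_empty_or_nonempty with rfl | hne
    · exact ⟨fun _ => φ M, by simp, by simp, by simp, fun p q _ t _ _ => by ring⟩
    · set m := X.max' hne with hm
      have hmX : m ∈ X := X.max'_mem hne
      have hmM := hM m hmX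
      have hle : ∀ c ∈ X, c ≤ m := fun c hc => X.le_max' c hc
      -- The new node `M` lies to the right of all others. The added multiple of a ramp rises only
      -- between `m` and `M`: it changes nothing up to `m` and is constant after `M`.
      set κ := (φ M - φ m) / (M - m) with hκ
      have hκ' : κ * (M - m) = φ M - φ m := div_mul_cancel₀ _ (by linarith)
      have low : ∀ x ≤ m, h x + κ * (max 0 (x - m) - max 0 (x - M)) = h x := by
        intro x hx
        rw [max_eq_left (by linarith), max_eq_left (by linarith)]; ring
      have high : ∀ x, M ≤ x → h x + κ * (max 0 (x - m) - max 0 (x - M)) = φ M := by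
        intro x hx
        rw [max_eq_right (by linarith), max_eq_right (by linarith), h3 m hmX hle x (by linarith)]
        linear_combination hκ'
      refine ⟨fun x => h x + κ * (max 0 (x - m) - max 0 (x - M)), ?_, ?_, ?_, ?_⟩
      · intro c hc
        rcases Finset.mem_insert.1 hc with rfl | hc
        · exact high c le_rfl
        · exact (low c (hle c hc)).trans (h1 c hc)
      · intro c hc hmin x hx
        rcases Finset.mem_insert.1 hc with rfl | hc
        · exact absurd (hmin m (Finset.mem_insert_of_mem hmX)) (by linarith)
        · exact (low x (hx.trans (hle c hc))).trans
            (h2 c hc (fun d hd => hmin d (Finset.mem_insert_of_mem hd)) x hx)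
      · intro c hc hmax x hx
        rcases Finset.mem_insert.1 hc with rfl | hc
        · exact high x hx
        · exact absurd (hmax M (Finset.mem_insert_self _ _)) (by linarith [hM c hc])
      · intro p q hpq t ht0 ht1
        dsimp only
        rw [h4 p q (fun c hc => hpq c (Finset.mem_insert_of_mem hc)) t ht0 ht1,
          max_zero_affine (hpq m (Finset.mem_insert_of_mem hmX)) ht0 ht1,
          max_zero_affine (hpq M (Finset.mem_insert_self _ _)) ht0 ht1]
        ring

end PiecewiseLinear

/-! ### Subdivision of paths -/

section Refinement

theorem segment_union_segment {E : Type*} [AddCommGroup E] [Module ℝ E] (p q : E) {t : ℝ}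
    (h0 : 0 ≤ t) (h1 : t ≤ 1) : segment ℝ p (AffineMap.lineMap p q t) ∪
      segment ℝ (AffineMap.lineMap p q t) q = segment ℝ p q := by
  have e0 : AffineMap.lineMap p q (0 : ℝ) = p := AffineMap.lineMap_apply_zero _ _
  have e1 : AffineMap.lineMap p q (1 : ℝ) = q := AffineMap.lineMap_apply_one _ _
  have key : ∀ x y : ℝ, x ≤ y → segment ℝ (AffineMap.lineMap p q x) (AffineMap.lineMap p q y) =
      AffineMap.lineMap p q '' Icc x y := fun x y hxy => by
    rw [← segment_eq_Icc hxy, image_segment]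
  have k0 := key 0 t h0
  have k1 := key t 1 h1
  have k := key 0 1 zero_le_one
  rw [e0] at k0
  rw [e1] at k1
  rw [e0, e1] at k
  rw [k0, k1, k, ← image_union, Icc_union_Icc_eq_Icc h0 h1]

theorem isArc_insert {E : Type*} [AddCommGroup E] [Module ℝ E] {p q : E} {L : List E} {t : ℝ}
    (h0 : 0 < t) (h1 : t < 1) (h : IsArc (p :: q :: L)) :
    IsArc (p :: AffineMap.lineMap p q t :: q :: L) := by
  obtain ⟨hne, h2, h3⟩ := h
  have e0 : AffineMap.lineMap p q (0 : ℝ) = p := AffineMap.lineMap_apply_zero _ _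
  have e1 : AffineMap.lineMap p q (1 : ℝ) = q := AffineMap.lineMap_apply_one _ _
  have hseg := segment_union_segment p q h0.le h1.le
  have left : ∀ x ∈ segment ℝ p (AffineMap.lineMap p q t),
      ∃ s, 0 ≤ s ∧ s ≤ t ∧ x = AffineMap.lineMap p q s := fun x hx =>
    segment_lineMap_subset h0.le (by rwa [e0])
  have right : ∀ x ∈ segment ℝ (AffineMap.lineMap p q t) q,
      ∃ s, t ≤ s ∧ s ≤ 1 ∧ x = AffineMap.lineMap p q s := fun x hx =>
    segment_lineMap_subset h1.le (by rwa [e1])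
  have htq : AffineMap.lineMap p q t ≠ q := fun e => h1.ne (lineMap_inj hne (e.trans e1.symm))
  refine ⟨fun e => h0.ne (lineMap_inj hne (e0.trans e)), ?_, htq, ?_, h3⟩
  · rintro x ⟨hx, hx' | hx'⟩
    · obtain ⟨s, -, hs, rfl⟩ := left x hx
      obtain ⟨s', hs', -, e⟩ := right _ hx'
      have := lineMap_inj hne e
      rw [mem_singleton_iff, show s = t by linarith]
    · have hxq : x = q := h2 ⟨hseg ▸ Or.inl hx, hx'⟩
      obtain ⟨s, -, hs, e⟩ := left x hx
      linarith [lineMap_inj hne (e1.trans (hxq.symm.trans e))]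
  · rintro x ⟨hx, hx'⟩
    exact h2 ⟨hseg ▸ Or.inr hx, hx'⟩

/-- Inserting the zeros of an affine function as new vertices of a path. -/
theorem exists_refinement (f : Space → ℝ)
    (hf : ∀ p q (t : ℝ), f (AffineMap.lineMap p q t) = (1 - t) * f p + t * f q) (T : List Space)
    (hT : IsArc (T.map Prod.fst)) : ∃ T' : List Space, IsArc (T'.map Prod.fst) ∧
      pathSet T' = pathSet T ∧ T'.head? = T.head? ∧ T'.getLast? = T.getLast? ∧
      T'.IsChain (fun p q => 0 ≤ f p * f q) ∧
      ∀ R : Space → Space → Prop, (∀ p q (t : ℝ), R p q → f p * f q < 0 → 0 < t → t < 1 →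
        R p (AffineMap.lineMap p q t) ∧ R (AffineMap.lineMap p q t) q) →
        T.IsChain R → T'.IsChain R := by
  induction T with
  | nil => exact ⟨[], trivial, rfl, rfl, rfl, by simp, fun _ _ h => h⟩
  | cons p T ih =>
    cases T with
    | nil => exact ⟨[p], trivial, rfl, rfl, rfl, by simp, fun _ _ h => h⟩
    | cons q L =>
      obtain ⟨T', h1, h2, h3, h4, h5, h6⟩ := ih hT.2.2
      obtain ⟨L', rfl⟩ := List.head?_eq_some_iff.1 h3
      have h2' : pathSet ((q :: L').map Prod.fst) = pathSet ((q :: L).map Prod.fst) := by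
        rw [pathSet_map_fst, pathSet_map_fst, h2]
      have harc : IsArc ((p :: q :: L').map Prod.fst) := by
        refine ⟨hT.1, ?_, h1⟩
        have := hT.2.1
        simp only [List.map_cons] at h2'
        rw [h2']
        exact this
      have hlast : (q :: L').getLast? = (q :: L).getLast? := h4
      rcases le_or_gt 0 (f p * f q) with hpq | hpq
      · refine ⟨p :: q :: L', harc, ?_, rfl, ?_, ?_, fun R hR hL => ?_⟩
        · rw [pathSet_cons_cons, h2, pathSet_cons_cons]
        · rw [List.getLast?_cons_cons, hlast, List.getLast?_cons_cons]
        · exact List.isChain_cons_cons.2 ⟨hpq, h5⟩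
        · rw [List.isChain_cons_cons] at hL ⊢
          exact ⟨hL.1, h6 R hR hL.2⟩
      · set t := f p / (f p - f q) with ht
        have hd : f p - f q ≠ 0 := fun h => by
          rw [sub_eq_zero.1 h] at hpq; nlinarith [mul_self_nonneg (f q)]
        have ht' : t * (f p - f q) = f p := div_mul_cancel₀ _ hd
        have htt : 0 < t ∧ t < 1 := by
          rcases mul_neg_iff.1 hpq with ⟨a, b⟩ | ⟨a, b⟩
          · constructor <;> nlinarith
          · constructor <;> nlinarith
        have hft : f (AffineMap.lineMap p q t) = 0 := by rw [hf]; linear_combination -ht'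
        refine ⟨p :: AffineMap.lineMap p q t :: q :: L', ?_, ?_, rfl, ?_, ?_, fun R hR hL => ?_⟩
        · have := isArc_insert htt.1 htt.2 harc
          simpa using this
        · rw [pathSet_cons_cons, pathSet_cons_cons, h2, pathSet_cons_cons, ← union_assoc,
            segment_union_segment p q htt.1.le htt.2.le]
        · rw [List.getLast?_cons_cons, List.getLast?_cons_cons, hlast, List.getLast?_cons_cons]
        · simp only [List.isChain_cons_cons, hft, mul_zero, zero_mul, le_refl, true_and]
          exact h5
        · simp only [List.isChain_cons_cons] at hL ⊢
          obtain ⟨h7, h8⟩ := hR p q t hL.1 hpq htt.1 htt.2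
          exact ⟨h7, h8, h6 R hR hL.2⟩

theorem finite_zeros_inter_pathSet (f : Space → ℝ)
    (hf : ∀ p q (t : ℝ), f (AffineMap.lineMap p q t) = (1 - t) * f p + t * f q) (T : List Space)
    (hT : T.IsChain fun p q => ¬(f p = 0 ∧ f q = 0)) : ({x | f x = 0} ∩ pathSet T).Finite := by
  induction T with
  | nil => simp
  | cons p T ih =>
    cases T with
    | nil => exact (Set.finite_singleton p).subset (by simp)
    | cons q L =>
      rw [List.isChain_cons_cons] at hT
      rw [pathSet_cons_cons, inter_union_distrib_left]
      refine Set.Finite.union (Set.Subsingleton.finite ?_) (ih hT.2)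
      rintro x ⟨hx, hx'⟩ y ⟨hy, hy'⟩
      obtain ⟨t, -, -, rfl⟩ := mem_segment_iff_lineMap.1 hx'
      obtain ⟨s, -, -, rfl⟩ := mem_segment_iff_lineMap.1 hy'
      rw [mem_ofPred_eq, hf] at hx hy
      rw [affine_zero_unique (by tauto) hx hy]

/-- The functions are treated one at a time. The clause about `R` carries through later subdivisions
whatever was already achieved for consecutive vertices, in particular the sign conditions for the
earlier functions. -/
theorem exists_refinement_finset {ι : Type*} (X : Finset ι) (f : ι → Space → ℝ)
    (hf : ∀ c p q (t : ℝ), f c (AffineMap.lineMap p q t) = (1 - t) * f c p + t * f c q)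
    (T : List Space) (hT : IsArc (T.map Prod.fst)) : ∃ T' : List Space, IsArc (T'.map Prod.fst) ∧
      pathSet T' = pathSet T ∧ T'.head? = T.head? ∧ T'.getLast? = T.getLast? ∧
      (∀ c ∈ X, T'.IsChain (fun p q => 0 ≤ f c p * f c q)) ∧
      ∀ R : Space → Space → Prop, (∀ p q (t : ℝ), R p q → 0 < t → t < 1 →
        R p (AffineMap.lineMap p q t) ∧ R (AffineMap.lineMap p q t) q) →
        T.IsChain R → T'.IsChain R := by
  classical
  induction X using Finset.induction_on with
  | empty => exact ⟨T, hT, rfl, rfl, rfl, by simp, fun _ _ h => h⟩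
  | insert c X hc ih =>
    obtain ⟨T₁, h1, h2, h3, h4, h5, h6⟩ := ih
    obtain ⟨T₂, k1, k2, k3, k4, k5, k6⟩ := exists_refinement (f c) (hf c) T₁ h1
    refine ⟨T₂, k1, k2.trans h2, k3.trans h3, k4.trans h4, fun d hd => ?_, fun R hR hL =>
      k6 R (fun p q t h _ => hR p q t h) (h6 R hR hL)⟩
    rcases Finset.mem_insert.1 hd with rfl | hd
    · exact k5
    · refine k6 _ (fun p q t h _ h0 h1 => ?_) (h5 d hd)
      simp only [hf]
      have h1' : 0 ≤ 1 - t := by linarith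
      constructor
      · nlinarith [mul_nonneg h1' (mul_self_nonneg (f d p)), mul_nonneg h0.le h]
      · nlinarith [mul_nonneg h0.le (mul_self_nonneg (f d q)), mul_nonneg h1' h]

end Refinement

section Index

variable {E : Type*} [AddCommGroup E] [Module ℝ E]

theorem pathSet_eq_iUnion (L : List E) (hL : 2 ≤ L.length) :
    pathSet L = ⋃ i < L.length - 1, segment ℝ (L.getD i 0) (L.getD (i + 1) 0) := by
  induction L with
  | nil => simp at hL
  | cons p L ih =>
    cases L with
    | nil => simp at hL
    | cons q L =>
      rw [pathSet_cons_cons]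
      cases L with
      | nil =>
        ext x
        simp only [pathSet_singleton, mem_union, mem_singleton_iff, mem_iUnion]
        constructor
        · rintro (h | rfl)
          · exact ⟨0, by simp, by simpa using h⟩
          · exact ⟨0, by simp, by simpa using right_mem_segment ℝ _ _⟩
        · rintro ⟨i, hi, hx⟩
          simp only [List.length_cons, List.length_nil] at hi
          obtain rfl : i = 0 := by omega
          exact Or.inl (by simpa using hx)
      | cons r L =>
        rw [ih (by simp)]
        ext x
        simp only [mem_union, mem_iUnion, List.length_cons]
        constructor
        · rintro (h | ⟨i, hi, h⟩)
          · exact ⟨0, by omega, by simpa using h⟩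
          · exact ⟨i + 1, by omega, by simpa using h⟩
        · rintro ⟨i, hi, hx⟩
          rcases i with _ | i
          · exact Or.inl (by simpa using hx)
          · exact Or.inr ⟨i, by omega, by simpa using hx⟩

theorem IsArc.getD_ne {L : List E} (h : IsArc L) {i : ℕ} (hi : i + 1 < L.length) :
    L.getD i 0 ≠ L.getD (i + 1) 0 := by
  rw [List.getD_eq_getElem _ _ hi, List.getD_eq_getElem _ _ (by omega)]
  intro e
  have := h.nodup.getElem_inj_iff.1 e
  omega

theorem IsArc.inter_getD {L : List E} (h : IsArc L) {i k : ℕ} (hik : i < k)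
    (hk : k + 1 < L.length) {x : E} (hx : x ∈ segment ℝ (L.getD i 0) (L.getD (i + 1) 0))
    (hy : x ∈ segment ℝ (L.getD k 0) (L.getD (k + 1) 0)) : k = i + 1 ∧ x = L.getD k 0 := by
  induction L generalizing i k with
  | nil => simp at hk
  | cons p L ih =>
    obtain ⟨k, rfl⟩ : ∃ k', k = k' + 1 := ⟨k - 1, by omega⟩
    rw [List.length_cons] at hk
    rw [List.getD_cons_succ, List.getD_cons_succ] at hy
    rw [List.getD_cons_succ] at hx ⊢
    have hL : 2 ≤ L.length := by omega
    rcases i with _ | i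
    · obtain ⟨q, L, rfl⟩ := List.exists_cons_of_length_pos (by omega : 0 < L.length)
      rw [List.getD_cons_zero, List.getD_cons_zero] at hx
      have hmem : ∀ k, k + 1 < (q :: L).length → ∀ x,
          x ∈ segment ℝ ((q :: L).getD k 0) ((q :: L).getD (k + 1) 0) → x ∈ pathSet (q :: L) := by
        intro k hk x hx
        rw [pathSet_eq_iUnion _ hL]
        exact mem_iUnion₂.2 ⟨k, by omega, hx⟩
      have hxq : x = q := h.2.1 ⟨hx, hmem k (by omega) x hy⟩
      rcases k with _ | k
      · exact ⟨rfl, by simpa using hxq⟩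
      · exfalso
        have h0 : x ∈ segment ℝ ((q :: L).getD 0 0) ((q :: L).getD (0 + 1) 0) := by
          rw [hxq]; exact left_mem_segment ℝ _ _
        obtain ⟨h1, h2⟩ := ih h.2.2 (by omega : 0 < k + 1) (by omega) h0 hy
        have h3 := h.2.2.getD_ne (i := 0) (by omega)
        rw [← h1, ← h2] at h3
        exact h3 hxq.symm
    · have h' : IsArc L := by
        obtain ⟨q, L, rfl⟩ := List.exists_cons_of_length_pos (by omega : 0 < L.length)
        exact h.2.2
      rw [List.getD_cons_succ] at hx
      obtain ⟨h1, h2⟩ := ih h' (by omega : i < k) (by omega) hx hy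
      exact ⟨by omega, h2⟩

end Index

/-! ### The view from the side -/

/-- A path from `b` to `a` with injective projection, subdivided at its crossings with the
segment from `a` to `b` and above the abscissas in `X` of these crossings. -/
structure IsSubdivided (a b : Space) (u : ℕ → Space) (N : ℕ) (X : Finset ℝ) : Prop where
  left_lt_right : a.1.1 < b.1.1
  head : u 0 = b
  last : u N = a
  ne : ∀ i < N, (u i).1 ≠ (u (i + 1)).1
  inter : ∀ i k, i < k → k < N → ∀ x ∈ segment ℝ (u i).1 (u (i + 1)).1,
    x ∈ segment ℝ (u k).1 (u (k + 1)).1 → k = i + 1 ∧ x = (u k).1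
  nonneg : ∀ i < N, 0 ≤ side a.1 b.1 (u i).1 * side a.1 b.1 (u (i + 1)).1
  off : ∀ i < N, ¬(side a.1 b.1 (u i).1 = 0 ∧ side a.1 b.1 (u (i + 1)).1 = 0)
  column : ∀ i < N, ∀ c ∈ X, 0 ≤ ((u i).1.1 - c) * ((u (i + 1)).1.1 - c)
  mem : ∀ i ≤ N, side a.1 b.1 (u i).1 = 0 → a.1.1 ≤ (u i).1.1 → (u i).1.1 ≤ b.1.1 →
    (u i).1.1 ∈ X
  bounds : ∀ c ∈ X, a.1.1 ≤ c ∧ c ≤ b.1.1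
  disj : ∀ i < N, ∀ x ∈ segment ℝ a b, x ∈ segment ℝ (u i) (u (i + 1)) → x = a ∨ x = b

theorem lineMap_coord (p q : Space) (t : ℝ) : AffineMap.lineMap p q t =
    (((1 - t) * p.1.1 + t * q.1.1, (1 - t) * p.1.2 + t * q.1.2), (1 - t) * p.2 + t * q.2) := by
  ext <;> simp only [AffineMap.lineMap_apply_module', Prod.fst_add, Prod.snd_add, Prod.smul_fst,
    Prod.smul_snd, Prod.fst_sub, Prod.snd_sub, smul_eq_mul] <;> ring

theorem lineMap_fst (p q : Space) (t : ℝ) :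
    (AffineMap.lineMap p q t).1 = AffineMap.lineMap p.1 q.1 t := by
  simp

theorem IsReturn.exists_isSubdivided {w : ℕ → Space} {T : List Space} (hT : IsReturn w 1 T)
    (hlt : (w 0).1.1 < (w 1).1.1) : ∃ u N X, IsSubdivided (w 0) (w 1) u N X ∧
      pathSet T = ⋃ i < N, segment ℝ (u i) (u (i + 1)) := by
  classical
  set η : Space → ℝ := fun p => side (w 0).1 (w 1).1 p.1 with hη
  have hηl : ∀ p q (t : ℝ), η (AffineMap.lineMap p q t) = (1 - t) * η p + t * η q :=
    fun p q t => by simp only [hη, lineMap_fst, side_lineMap]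
  have hξl : ∀ (c : ℝ) (p q : Space) (t : ℝ), (AffineMap.lineMap p q t).1.1 - c =
      (1 - t) * (p.1.1 - c) + t * (q.1.1 - c) := fun c p q t => by rw [lineMap_coord]; ring
  have hne : w 0 ≠ w 1 := fun e => hlt.ne (by rw [e])
  have hdisj : ∀ x ∈ segment ℝ (w 0) (w 1), x ∈ pathSet T → x = w 0 ∨ x = w 1 := fun x hx hx' =>
    hT.disj 0 one_pos x hx hx'
  have hzero : ∀ p ∈ T, η p = 0 → p = w 0 ∨ p = w 1 := by
    intro p hp h0
    by_contra hcon
    push Not at hcon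
    exact hT.off p hp hcon.2 hcon.1 0 one_pos h0
  -- An edge of `T` lying along the line would join `w 0` and `w 1`, the only vertices of `T` on it.
  -- It would then be the first edge itself, against `disj` at the midpoint.
  have hchain : T.IsChain fun p q => ¬(η p = 0 ∧ η q = 0) := by
    rw [List.isChain_iff_getElem]
    rintro i hi ⟨h1, h2⟩
    have hpq : T[i] ≠ T[i + 1] := fun e => by
      have := ((List.Nodup.of_map _ hT.arc.nodup).getElem_inj_iff).1 e
      omega
    have hseg : segment ℝ T[i] T[i + 1] ⊆ pathSet T := by
      rw [pathSet_eq_iUnion _ (by omega)]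
      intro x hx
      refine mem_iUnion₂.2 ⟨i, by omega, ?_⟩
      rwa [List.getD_eq_getElem _ _ (by omega), List.getD_eq_getElem _ _ hi]
    have hmid : AffineMap.lineMap (w 0) (w 1) (1 / 2 : ℝ) ∈ segment ℝ (w 0) (w 1) :=
      mem_segment_iff_lineMap.2 ⟨_, by norm_num, by norm_num, rfl⟩
    have hmid' : AffineMap.lineMap (w 0) (w 1) (1 / 2 : ℝ) ∈ pathSet T := by
      apply hseg
      rcases hzero _ (List.getElem_mem _) h1 with h1 | h1 <;>
        rcases hzero _ (List.getElem_mem _) h2 with h2 | h2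
      · exact absurd (h1.trans h2.symm) hpq
      · rwa [h1, h2]
      · rw [h1, h2, segment_symm]; exact hmid
      · exact absurd (h1.trans h2.symm) hpq
    rcases hdisj _ hmid hmid' with h | h
    · have := lineMap_inj hne (h.trans (AffineMap.lineMap_apply_zero (w 0) (w 1)).symm)
      norm_num at this
    · have := lineMap_inj hne (h.trans (AffineMap.lineMap_apply_one (w 0) (w 1)).symm)
      norm_num at this
  have hfin := ((finite_zeros_inter_pathSet η hηl T hchain).image fun p => p.1.1)
  obtain ⟨T₁, h1, h2, h3, h4, h5, h6⟩ := exists_refinement η hηl T hT.arc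
  have hchain₁ : T₁.IsChain fun p q => 0 ≤ η p * η q ∧ ¬(η p = 0 ∧ η q = 0) := by
    have h7 := h6 (fun p q => ¬(η p = 0 ∧ η q = 0)) (fun p q t _ hn _ _ =>
      ⟨fun h => by rw [h.1, zero_mul] at hn; exact hn.false,
        fun h => by rw [h.2, mul_zero] at hn; exact hn.false⟩) hchain
    rw [List.isChain_iff_getElem] at h5 h7 ⊢
    exact fun i hi => ⟨h5 i hi, h7 i hi⟩
  -- Only zeros whose abscissa lies between the ends of the strand count: beyond them the function
  -- interpolated on `X` must be constant. The later cuts at these abscissas do not change the path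
  -- as a set, so `X` stays complete.
  set X : Finset ℝ := hfin.toFinset.filter fun c => (w 0).1.1 ≤ c ∧ c ≤ (w 1).1.1 with hX
  obtain ⟨U, k1, k2, k3, k4, k5, k6⟩ := exists_refinement_finset X (fun c p => p.1.1 - c) hξl T₁ h1
  have hchainU := k6 _ (fun p q t h t0 t1 => by
    rw [hηl]
    have t1' : 0 < 1 - t := by linarith
    refine ⟨⟨?_, ?_⟩, ?_, ?_⟩
    · nlinarith [mul_nonneg t1'.le (mul_self_nonneg (η p)), mul_nonneg t0.le h.1]
    · rintro ⟨h8, h9⟩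
      rw [h8, mul_zero, zero_add] at h9
      exact h.2 ⟨h8, (mul_eq_zero.1 h9).resolve_left t0.ne'⟩
    · nlinarith [mul_nonneg t0.le (mul_self_nonneg (η q)), mul_nonneg t1'.le h.1]
    · rintro ⟨h8, h9⟩
      rw [h9, mul_zero, add_zero] at h8
      exact h.2 ⟨(mul_eq_zero.1 h8).resolve_left t1'.ne', h9⟩) hchain₁
  have hhead : U.head? = some (w 1) := (k3.trans h3).trans hT.head
  have hlast : U.getLast? = some (w 0) := (k4.trans h4).trans hT.last
  have hpath : pathSet U = pathSet T := k2.trans h2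
  obtain ⟨U', hU'⟩ := List.head?_eq_some_iff.1 hhead
  have hlen : 2 ≤ U.length := by
    rcases U' with _ | ⟨p, U'⟩
    · rw [hU'] at hlast
      exact absurd (Option.some.inj hlast).symm hne
    · rw [hU']; simp
  have hgetm : ∀ i, (U.map Prod.fst).getD i (0 : ℝ × ℝ) = (U.getD i (0 : Space)).1 := fun i =>
    List.getD_map (f := Prod.fst) (d := (0 : Space)) ..
  have hget : ∀ i (hi : i < U.length), U.getD i (0 : Space) = U[i] := fun i hi =>
    List.getD_eq_getElem _ _ hi
  have hlen' : (U.map Prod.fst).length = U.length := List.length_map _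
  have hpathU := pathSet_eq_iUnion U hlen
  refine ⟨fun i => U.getD i 0, U.length - 1, X, ⟨hlt, ?_, ?_, ?_, ?_, ?_, ?_, ?_, ?_, ?_, ?_⟩,
    hpath ▸ hpathU⟩
  · simp [hU']
  · rw [hget _ (by omega)]
    rw [List.getLast?_eq_getElem?, List.getElem?_eq_getElem (by omega)] at hlast
    exact Option.some.inj hlast
  · intro i hi
    have := k1.getD_ne (i := i) (by omega)
    rwa [hgetm, hgetm] at this
  · intro i k hik hk x hx hy
    have := k1.inter_getD hik (by omega) (x := x)
    simp only [hgetm] at this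
    exact this hx hy
  · intro i hi
    rw [List.isChain_iff_getElem] at hchainU
    have := (hchainU i (by omega)).1
    simpa only [hget i (by omega), hget (i + 1) (by omega)] using this
  · intro i hi
    rw [List.isChain_iff_getElem] at hchainU
    have := (hchainU i (by omega)).2
    simpa only [hget i (by omega), hget (i + 1) (by omega)] using this
  · intro i hi c hc
    have := List.isChain_iff_getElem.1 (k5 c hc) i (by omega)
    simpa only [hget i (by omega), hget (i + 1) (by omega)] using this
  · intro i hi h0 ha hb
    rw [hX, Finset.mem_filter, Finite.mem_toFinset]
    refine ⟨⟨U.getD i 0, ⟨h0, ?_⟩, rfl⟩, ha, hb⟩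
    rw [← hpath, hget i (by omega)]
    exact mem_pathSet_of_mem (List.getElem_mem _)
  · intro c hc
    exact (Finset.mem_filter.1 hc).2
  · intro i hi x hx hx'
    refine hdisj x hx ?_
    rw [← hpath, hpathU]
    exact mem_iUnion₂.2 ⟨i, hi, hx'⟩

/-- A compact set with injective projection lies on the graph of a continuous function. -/
theorem exists_continuous_graph {S : Set Space} (hS : IsCompact S)
    (hinj : InjOn (Prod.fst : Space → ℝ × ℝ) S) :
    ∃ G : ℝ × ℝ → ℝ, Continuous G ∧ ∀ x ∈ S, G x.1 = x.2 := by
  have : CompactSpace S := isCompact_iff_compactSpace.1 hS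
  have he : IsClosedEmbedding fun x : S => (x : Space).1 :=
    Continuous.isClosedEmbedding (by fun_prop) fun x y h => Subtype.ext (hinj x.2 y.2 h)
  obtain ⟨G, hG⟩ := ContinuousMap.exists_extension' he
    (⟨fun x : S => (x : Space).2, by fun_prop⟩ : C(S, ℝ))
  exact ⟨G, G.continuous, fun x hx => congrFun hG ⟨x, hx⟩⟩

namespace IsSubdivided

variable {a b : Space} {u : ℕ → Space} {N : ℕ} {X : Finset ℝ}

theorem eq_of_fst_eq (h : IsSubdivided a b u N X) {i k : ℕ} (hi : i ≤ N) (hk : k ≤ N)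
    (e : (u i).1 = (u k).1) : i = k := by
  have key : ∀ i k, i < k → k ≤ N → (u i).1 ≠ (u k).1 := by
    intro i k hik hk e
    obtain ⟨k, rfl⟩ : ∃ k', k = k' + 1 := ⟨k - 1, by omega⟩
    rcases Nat.eq_or_lt_of_le (Nat.lt_succ_iff.1 hik) with rfl | hik'
    · exact h.ne i (by omega) e
    · have h1 := h.inter i k hik' (by omega) (u i).1 (left_mem_segment ℝ _ _)
        (by rw [e]; exact right_mem_segment ℝ _ _)
      exact h.ne k (by omega) (h1.2.symm.trans e)
  rcases lt_trichotomy i k with hik | rfl | hik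
  · exact absurd e (key i k hik hk)
  · rfl
  · exact absurd e.symm (key k i hik hi)

/-- The two ends are weakly on the same side of the line and not both on it, so the edge meets the
line at most at an end. The proof multiplies the equation by the side of each end in turn. -/
theorem side_eq_zero (h : IsSubdivided a b u N X) {i : ℕ} (hi : i < N) {t : ℝ} (ht0 : 0 ≤ t)
    (ht1 : t ≤ 1) (e : side a.1 b.1 (AffineMap.lineMap (u i) (u (i + 1)) t).1 = 0) :
    (t = 0 ∧ side a.1 b.1 (u i).1 = 0) ∨ (t = 1 ∧ side a.1 b.1 (u (i + 1)).1 = 0) := by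
  rw [lineMap_fst, side_lineMap] at e
  have h1 := h.nonneg i hi
  have h2 := h.off i hi
  set p := side a.1 b.1 (u i).1
  set q := side a.1 b.1 (u (i + 1)).1
  have hp : (1 - t) * (p * p) = 0 := by
    nlinarith [mul_nonneg (sub_nonneg.2 ht1) (mul_self_nonneg p), mul_nonneg ht0 h1,
      congrArg (· * p) e]
  have hq : t * (q * q) = 0 := by
    nlinarith [mul_nonneg ht0 (mul_self_nonneg q), mul_nonneg (sub_nonneg.2 ht1) h1,
      congrArg (· * q) e]
  rcases mul_eq_zero.1 hp with hp | hp <;> rcases mul_eq_zero.1 hq with hq | hq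
  · linarith
  · exact Or.inr ⟨by linarith, mul_self_eq_zero.1 hq⟩
  · exact Or.inl ⟨hq, mul_self_eq_zero.1 hp⟩
  · exact absurd ⟨mul_self_eq_zero.1 hp, mul_self_eq_zero.1 hq⟩ h2

theorem exists_lineMap (h : IsSubdivided a b u N X) {i : ℕ} (h0 : side a.1 b.1 (u i).1 = 0)
    (ha : a.1.1 ≤ (u i).1.1) (hb : (u i).1.1 ≤ b.1.1) :
    ∃ t : ℝ, 0 ≤ t ∧ t ≤ 1 ∧ (AffineMap.lineMap a b t).1 = (u i).1 := by
  have hlt := h.left_lt_right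
  have hd : 0 < b.1.1 - a.1.1 := by linarith
  refine ⟨((u i).1.1 - a.1.1) / (b.1.1 - a.1.1), div_nonneg (by linarith) hd.le,
    (div_le_one hd).2 (by linarith), ?_⟩
  rw [lineMap_coord]
  simp only [side] at h0
  ext
  · simp only; field_simp; ring
  · simp only; field_simp; linear_combination -h0

/-- The heights of the vertices, in an order compatible with their position along the path. -/
theorem exists_heights (h : IsSubdivided a b u N X) : ∃ (η : ℝ → ℝ) (H : ℕ → ℝ),
    (∀ x ≤ a.1.1, η x = N) ∧ (∀ x, b.1.1 ≤ x → η x = 0) ∧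
    (∀ i < N, ∀ t : ℝ, 0 ≤ t → t ≤ 1 → η (AffineMap.lineMap (u i) (u (i + 1)) t).1.1 =
      (1 - t) * η (u i).1.1 + t * η (u (i + 1)).1.1) ∧
    (∀ i < N, H i < H (i + 1)) ∧ H 0 = 0 ∧ H N = N ∧
    (∀ i ≤ N, ∀ t : ℝ, 0 ≤ t → t ≤ 1 → (AffineMap.lineMap a b t).1 = (u i).1 →
      H i - η (u i).1.1 = (u i).2 - (AffineMap.lineMap a b t).2) ∧
    ∀ i, 0 < i → i < N → H i - η (u i).1.1 ≠ 0 := by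
  classical
  have hlt := h.left_lt_right
  -- The height of the line through `a` and `b` in space above the abscissa `x`.
  set ζ : ℝ → ℝ := fun x => a.2 + (x - a.1.1) / (b.1.1 - a.1.1) * (b.2 - a.2) with hζ
  have hd : b.1.1 - a.1.1 ≠ 0 := by linarith
  have hζl : ∀ t : ℝ, ζ (AffineMap.lineMap a b t).1.1 = (AffineMap.lineMap a b t).2 := by
    intro t
    rw [lineMap_coord]
    simp only [hζ]
    field_simp
    ring
  have hNpos : 0 < N := by
    rcases Nat.eq_zero_or_pos N with rfl | hN
    · have := h.head.symm.trans h.last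
      rw [this] at hlt
      exact absurd hlt (lt_irrefl _)
    · exact hN
  let P : ℕ → ℝ → Prop := fun i c => i ≤ N ∧ side a.1 b.1 (u i).1 = 0 ∧ (u i).1.1 = c
  have hPu : ∀ i k c, P i c → P k c → i = k := by
    rintro i k c ⟨hi, hi0, hic⟩ ⟨hk, hk0, hkc⟩
    refine h.eq_of_fst_eq hi hk (Prod.ext (hic.trans hkc.symm) ?_)
    simp only [side, hic, hkc] at hi0 hk0
    exact mul_left_cancel₀ hd (by linear_combination hi0 - hk0)
  -- Since `H i = i` at a vertex on the line, this value makes `H i - η` equal to the height of the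
  -- path above the strand. The vertex over `c` is unique by `hPu`; the default value plays no role.
  let φ : ℝ → ℝ := fun c => if hc : ∃ i, P i c then hc.choose - ((u hc.choose).2 - ζ c) else 0
  have hφ : ∀ i c, P i c → φ c = i - ((u i).2 - ζ c) := by
    intro i c hi
    have hc : ∃ i, P i c := ⟨i, hi⟩
    simp only [φ, dif_pos hc]
    rw [hPu _ _ _ hc.choose_spec hi]
  obtain ⟨η, hη, hηmin, hηmax, hηl⟩ := exists_piecewiseLinear X φ
  have hP0 : P 0 b.1.1 := ⟨Nat.zero_le _, by rw [h.head, side_right], by rw [h.head]⟩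
  have hPN : P N a.1.1 := ⟨le_rfl, by rw [h.last, side_left], by rw [h.last]⟩
  have hbX : b.1.1 ∈ X := by
    have := h.mem 0 (Nat.zero_le _) hP0.2.1
    rw [hP0.2.2] at this
    exact this hlt.le le_rfl
  have haX : a.1.1 ∈ X := by
    have := h.mem N le_rfl hPN.2.1
    rw [hPN.2.2] at this
    exact this le_rfl hlt.le
  have hφa : φ a.1.1 = N := by
    rw [hφ N _ hPN, h.last]
    simp [hζ]
  have hφb : φ b.1.1 = 0 := by
    rw [hφ 0 _ hP0, h.head]
    simp [hζ, div_self hd]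
  have hηa : ∀ x ≤ a.1.1, η x = N := fun x hx => by
    rw [hηmin _ haX (fun c hc => (h.bounds c hc).1) x hx, hφa]
  have hηb : ∀ x, b.1.1 ≤ x → η x = 0 := fun x hx => by
    rw [hηmax _ hbX (fun c hc => (h.bounds c hc).2) x hx, hφb]
  -- `ε < 1` keeps `H` increasing, and avoiding finitely many values keeps the vertices off the line
  -- of `ab` away from the axis in the new view.
  obtain ⟨ε, ⟨hε0, hε1⟩, hε⟩ := ((Set.Ioo_infinite (zero_lt_one' ℝ)).sdiff
    ((Set.finite_lt_nat N).image fun i => η (u i).1.1 - i)).nonempty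
  set H : ℕ → ℝ := fun i => i + if side a.1 b.1 (u i).1 = 0 then 0 else ε with hH
  have hon : ∀ i ≤ N, ∀ t : ℝ, 0 ≤ t → t ≤ 1 → (AffineMap.lineMap a b t).1 = (u i).1 →
      H i - η (u i).1.1 = (u i).2 - (AffineMap.lineMap a b t).2 := by
    intro i hi t ht0 ht1 e
    have h0 : side a.1 b.1 (u i).1 = 0 := by
      rw [← e, lineMap_fst, side_lineMap]; simp
    have hx : a.1.1 ≤ (u i).1.1 ∧ (u i).1.1 ≤ b.1.1 := by
      rw [← e, lineMap_coord]
      constructor <;> simp only <;> nlinarith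
    rw [hη _ (h.mem i hi h0 hx.1 hx.2), hφ i _ ⟨hi, h0, rfl⟩, ← hζl, e]
    simp only [hH, if_pos h0]
    ring
  refine ⟨η, H, hηa, hηb, ?_, ?_, ?_, ?_, hon, ?_⟩
  · intro i hi t ht0 ht1
    rw [← hηl _ _ (h.column i hi) t ht0 ht1, lineMap_coord]
  · intro i hi
    simp only [hH]
    push_cast
    split_ifs <;> linarith
  · simp [hH, hP0.2.1]
  · simp [hH, hPN.2.1]
  -- For a vertex on the line, the new height is `i - N` left of `a`, `i` right of `b`, and in
  -- between the height above the strand, which is nonzero because the path meets the strand only at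
  -- its ends.
  · intro i hi hiN e
    by_cases h0 : side a.1 b.1 (u i).1 = 0
    · have hHi : H i = i := by simp [hH, h0]
      rcases lt_or_ge (u i).1.1 a.1.1 with hxa | hxa
      · rw [hηa _ hxa.le, hHi, sub_eq_zero] at e
        have : i = N := by exact_mod_cast e
        omega
      rcases lt_or_ge b.1.1 (u i).1.1 with hxb | hxb
      · rw [hηb _ hxb.le, hHi, sub_zero] at e
        have : i = 0 := by exact_mod_cast e
        omega
      obtain ⟨t, ht0, ht1, ht⟩ := h.exists_lineMap h0 hxa hxb
      rw [hon i hiN.le t ht0 ht1 ht] at e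
      have hu : u i ∈ segment ℝ a b := mem_segment_iff_lineMap.2
        ⟨t, ht0, ht1, Prod.ext ht (by linarith)⟩
      rcases h.disj i hiN _ hu (left_mem_segment ℝ _ _) with h1 | h1
      · have := h.eq_of_fst_eq hiN.le le_rfl (by rw [h1, h.last])
        omega
      · have := h.eq_of_fst_eq hiN.le (Nat.zero_le _) (by rw [h1, h.head])
        omega
    · refine hε ⟨i, hiN, ?_⟩
      simp only [hH, if_neg h0] at e
      simp only
      linarith

/-- The heights are the values of a continuous function on the plane. -/
theorem exists_shear (h : IsSubdivided a b u N X) (Ψ : ℕ → ℝ)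
    (hΨ : ∀ i ≤ N, ∀ t : ℝ, 0 ≤ t → t ≤ 1 → (AffineMap.lineMap a b t).1 = (u i).1 →
      Ψ i = (u i).2 - (AffineMap.lineMap a b t).2) : ∃ G : ℝ × ℝ → ℝ, Continuous G ∧
    (∀ t : ℝ, 0 ≤ t → t ≤ 1 →
      G (AffineMap.lineMap a b t).1 = -(AffineMap.lineMap a b t).2) ∧
    ∀ i < N, ∀ t : ℝ, 0 ≤ t → t ≤ 1 → G (AffineMap.lineMap (u i) (u (i + 1)) t).1 =
      (1 - t) * Ψ i + t * Ψ (i + 1) - (AffineMap.lineMap (u i) (u (i + 1)) t).2 := by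
  -- The wanted shear is prescribed on the projections of the path and of the strand, and `hΨ` says
  -- that the two prescriptions agree where these cross. Its graph `S` thus has injective
  -- projection, and Tietze's theorem extends it to the plane.
  let s : ℕ → Space := fun i => ((u i).1, Ψ i - (u i).2)
  let a' : Space := (a.1, -a.2)
  let b' : Space := (b.1, -b.2)
  have hab : a.1 ≠ b.1 := fun e => h.left_lt_right.ne (by rw [e])
  set S : Set Space := segment ℝ a' b' ∪ ⋃ i < N, segment ℝ (s i) (s (i + 1)) with hS
  have hSc : IsCompact S := (isCompact_segment _ _).union
    ((Set.finite_lt_nat N).isCompact_biUnion fun _ _ => isCompact_segment _ _)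
  have hmix : ∀ x ∈ segment ℝ a' b', ∀ i < N, ∀ y ∈ segment ℝ (s i) (s (i + 1)), x.1 = y.1 →
      x = y := by
    intro x hx i hi y hy e
    obtain ⟨t, ht0, ht1, rfl⟩ := mem_segment_iff_lineMap.1 hx
    obtain ⟨r, hr0, hr1, rfl⟩ := mem_segment_iff_lineMap.1 hy
    have e' : (AffineMap.lineMap a b t).1 = (AffineMap.lineMap (u i) (u (i + 1)) r).1 := by
      rw [lineMap_fst, lineMap_fst] at e ⊢
      exact e
    have h0 : side a.1 b.1 (AffineMap.lineMap (u i) (u (i + 1)) r).1 = 0 := by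
      rw [← e', lineMap_fst, side_lineMap]; simp
    have hneg : (AffineMap.lineMap a' b' t).2 = -(AffineMap.lineMap a b t).2 := by
      rw [lineMap_coord, lineMap_coord]; simp only [a', b']; ring
    refine Prod.ext e ?_
    rcases h.side_eq_zero hi hr0 hr1 h0 with ⟨rfl, -⟩ | ⟨rfl, -⟩
    · rw [AffineMap.lineMap_apply_zero] at e' ⊢
      have := hΨ i hi.le t ht0 ht1 e'
      rw [hneg]; simp only [s]; linarith
    · rw [AffineMap.lineMap_apply_one] at e' ⊢
      have := hΨ (i + 1) hi t ht0 ht1 e'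
      rw [hneg]; simp only [s]; linarith
  have hlt : ∀ i k, i < k → k < N → ∀ x ∈ segment ℝ (s i) (s (i + 1)),
      ∀ y ∈ segment ℝ (s k) (s (k + 1)), x.1 = y.1 → x = y := by
    intro i k hik hk x hx y hy e
    obtain ⟨h1, h2⟩ := h.inter i k hik hk x.1 (fst_mem_segment (p := s i) (q := s (i + 1)) hx)
      (e ▸ fst_mem_segment (p := s k) (q := s (k + 1)) hy)
    subst h1
    obtain ⟨t, ht0, ht1, rfl⟩ := mem_segment_iff_lineMap.1 hx
    obtain ⟨r, hr0, hr1, rfl⟩ := mem_segment_iff_lineMap.1 hy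
    rw [lineMap_fst] at h2 e
    have ht : t = 1 := lineMap_inj (h.ne i (by omega))
      (h2.trans (AffineMap.lineMap_apply_one _ _).symm)
    rw [h2, lineMap_fst] at e
    have hr : r = 0 := lineMap_inj (h.ne (i + 1) hk)
      (e.symm.trans (AffineMap.lineMap_apply_zero _ _).symm)
    rw [ht, hr, AffineMap.lineMap_apply_one, AffineMap.lineMap_apply_zero]
  have hinj : InjOn (Prod.fst : Space → ℝ × ℝ) S := by
    rintro x (hx | hx) y (hy | hy) e
    · obtain ⟨t, -, -, rfl⟩ := mem_segment_iff_lineMap.1 hx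
      obtain ⟨r, -, -, rfl⟩ := mem_segment_iff_lineMap.1 hy
      rw [lineMap_fst, lineMap_fst] at e
      rw [lineMap_inj hab e]
    · obtain ⟨i, hi, hy⟩ := mem_iUnion₂.1 hy
      exact hmix x hx i hi y hy e
    · obtain ⟨i, hi, hx⟩ := mem_iUnion₂.1 hx
      exact (hmix y hy i hi x hx e.symm).symm
    · obtain ⟨i, hi, hx⟩ := mem_iUnion₂.1 hx
      obtain ⟨k, hk, hy⟩ := mem_iUnion₂.1 hy
      rcases lt_trichotomy i k with hik | rfl | hik
      · exact hlt i k hik hk x hx y hy e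
      · obtain ⟨t, -, -, rfl⟩ := mem_segment_iff_lineMap.1 hx
        obtain ⟨r, -, -, rfl⟩ := mem_segment_iff_lineMap.1 hy
        rw [lineMap_fst, lineMap_fst] at e
        rw [lineMap_inj (h.ne i hi) e]
      · exact (hlt k i hik hi y hy x hx e.symm).symm
  obtain ⟨G, hGc, hG⟩ := exists_continuous_graph hSc hinj
  refine ⟨G, hGc, fun t ht0 ht1 => ?_, fun i hi t ht0 ht1 => ?_⟩
  · have := hG (AffineMap.lineMap a' b' t) (Or.inl (mem_segment_iff_lineMap.2 ⟨t, ht0, ht1, rfl⟩))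
    rw [lineMap_fst, lineMap_coord] at this
    rw [lineMap_fst, lineMap_coord]
    refine this.trans ?_
    simp only [a', b']; ring
  · have := hG (AffineMap.lineMap (s i) (s (i + 1)) t)
      (Or.inr (mem_iUnion₂.2 ⟨i, hi, mem_segment_iff_lineMap.2 ⟨t, ht0, ht1, rfl⟩⟩))
    rw [lineMap_fst, lineMap_coord] at this
    rw [lineMap_fst, lineMap_coord]
    refine this.trans ?_
    simp only [s]; ring

theorem exists_diagram (h : IsSubdivided a b u N X) :
    ∃ n, HasContainedStraightDiagram
      (segment ℝ a b ∪ ⋃ i < N, segment ℝ (u i) (u (i + 1))) n := by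
  obtain ⟨η, H, hηa, hηb, hηl, hHlt, hH0, hHN, hon, hoff⟩ := h.exists_heights
  obtain ⟨G, hGc, hGe, hGT⟩ := h.exists_shear (fun i => H i - η (u i).1.1) hon
  -- The shear by `G`, which turns heights into `H - η` on the path and into `0` on the strand,
  -- followed by the quarter turn. It is affine on each segment of the knot, so the image is again a
  -- polygon.
  let Φ : Space → Space := fun p => ((p.1.1, p.2 + G p.1), -p.1.2)
  have hΦinj : ∀ p q, Φ p = Φ q → p = q := by
    intro p q e
    simp only [Φ, Prod.mk.injEq, neg_inj] at e
    have h1 : p.1 = q.1 := Prod.ext e.1.1 e.2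
    refine Prod.ext h1 ?_
    have := e.1.2
    rw [h1] at this
    exact add_right_cancel this
  have hΦa : Φ a = ((a.1.1, 0), -a.1.2) := by
    have := hGe 0 le_rfl zero_le_one
    rw [AffineMap.lineMap_apply_zero] at this
    simp [Φ, this]
  have hΦb : Φ b = ((b.1.1, 0), -b.1.2) := by
    have := hGe 1 zero_le_one le_rfl
    rw [AffineMap.lineMap_apply_one] at this
    simp [Φ, this]
  have hNpos : 0 < N := by
    rcases Nat.eq_zero_or_pos N with rfl | hN
    · have h1 := h.left_lt_right
      rw [h.head.symm.trans h.last] at h1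
      exact absurd h1 (lt_irrefl _)
    · exact hN
  have hΦu : ∀ i ≤ N, Φ (u i) = (((u i).1.1, H i - η (u i).1.1), -(u i).1.2) := by
    intro i hi
    rcases Nat.lt_or_ge i N with hi' | hi'
    · have := hGT i hi' 0 le_rfl zero_le_one
      rw [AffineMap.lineMap_apply_zero] at this
      simp [Φ, this]
    · obtain ⟨k, rfl⟩ : ∃ k, i = k + 1 := ⟨i - 1, by omega⟩
      have := hGT k (by omega) 1 zero_le_one le_rfl
      rw [AffineMap.lineMap_apply_one] at this
      simp [Φ, this]
  have hΦe : ∀ t : ℝ, 0 ≤ t → t ≤ 1 →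
      Φ (AffineMap.lineMap a b t) = AffineMap.lineMap (Φ a) (Φ b) t := by
    intro t ht0 ht1
    have := hGe t ht0 ht1
    rw [hΦa, hΦb]
    simp only [lineMap_coord] at this
    simp only [Φ, lineMap_coord, this]
    ext <;> simp only <;> ring
  have hΦT : ∀ i < N, ∀ t : ℝ, 0 ≤ t → t ≤ 1 →
      Φ (AffineMap.lineMap (u i) (u (i + 1)) t) =
        AffineMap.lineMap (Φ (u i)) (Φ (u (i + 1))) t := by
    intro i hi t ht0 ht1
    have := hGT i hi t ht0 ht1
    rw [hΦu i hi.le, hΦu (i + 1) hi]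
    simp only [lineMap_coord] at this
    simp only [Φ, lineMap_coord, this]
    ext <;> simp only <;> ring
  have image_seg : ∀ p q : Space, (∀ t : ℝ, 0 ≤ t → t ≤ 1 →
      Φ (AffineMap.lineMap p q t) = AffineMap.lineMap (Φ p) (Φ q) t) →
      Φ '' segment ℝ p q = segment ℝ (Φ p) (Φ q) := by
    intro p q hpq
    ext x
    rw [mem_segment_iff_lineMap]
    constructor
    · rintro ⟨y, hy, rfl⟩
      obtain ⟨t, ht0, ht1, rfl⟩ := mem_segment_iff_lineMap.1 hy
      exact ⟨t, ht0, ht1, (hpq t ht0 ht1).symm⟩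
    · rintro ⟨t, ht0, ht1, rfl⟩
      exact ⟨_, mem_segment_iff_lineMap.2 ⟨t, ht0, ht1, rfl⟩, hpq t ht0 ht1⟩
  have hsege := image_seg a b hΦe
  have hsegT : ∀ i < N, Φ '' segment ℝ (u i) (u (i + 1)) =
    segment ℝ (Φ (u i)) (Φ (u (i + 1))) := fun i hi => image_seg _ _ (hΦT i hi)
  let w : ℕ → Space := fun j => Nat.casesOn j (Φ a) fun i => Φ (u i)
  have hw0 : w 0 = Φ a := rfl
  have hws : ∀ i, w (i + 1) = Φ (u i) := fun _ => rfl
  have hw1 : w 1 = Φ b := by rw [show (1 : ℕ) = 0 + 1 from rfl, hws, h.head]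
  have himage : Φ '' (segment ℝ a b ∪ ⋃ i < N, segment ℝ (u i) (u (i + 1))) =
      initialEdges w (N + 1) := by
    rw [image_union, hsege, initialEdges]
    ext x
    simp only [image_iUnion, mem_union, mem_iUnion]
    constructor
    · rintro (hx | ⟨i, hi, hx⟩)
      · exact ⟨0, by omega, by rwa [hw0, zero_add, hw1]⟩
      · exact ⟨i + 1, by omega, by rwa [hws, hws, ← hsegT i hi]⟩
    · rintro ⟨i, hi, hx⟩
      rcases i with _ | i
      · exact Or.inl (by rwa [hw0, zero_add, hw1] at hx)
      · exact Or.inr ⟨i, by omega, by rwa [hws, hws, ← hsegT i (by omega)] at hx⟩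
  have hisotopic : AmbientIsotopic (segment ℝ a b ∪ ⋃ i < N, segment ℝ (u i) (u (i + 1)))
      (initialEdges w (N + 1)) := by
    have := (ambientIsotopic_shear G hGc
      (segment ℝ a b ∪ ⋃ i < N, segment ℝ (u i) (u (i + 1)))).trans (ambientIsotopic_rotate _)
    rw [image_image] at this
    rw [← himage]
    exact this
  have hHle : ∀ i k, i ≤ k → k ≤ N → H i ≤ H k := by
    intro i k hik
    induction k, hik using Nat.le_induction with
    | base => exact fun _ => le_rfl
    | succ k _ ih => exact fun hk => (ih (by omega)).trans (hHlt k hk).le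
  -- On the new projection of the path this undoes the subtraction of `η`, leaving the increasing
  -- function `H`.
  let F : ℝ × ℝ → ℝ := fun q => q.2 + η q.1
  have hFu : ∀ i ≤ N, F (Φ (u i)).1 = H i := by
    intro i hi
    rw [hΦu i hi]; simp [F]
  have hFl : ∀ i < N, ∀ t : ℝ, 0 ≤ t → t ≤ 1 →
      F (AffineMap.lineMap (Φ (u i)) (Φ (u (i + 1))) t).1 = (1 - t) * H i + t * H (i + 1) := by
    intro i hi t ht0 ht1
    have h1 := hηl i hi t ht0 ht1
    rw [lineMap_coord] at h1
    rw [hΦu i hi.le, hΦu (i + 1) hi, lineMap_coord]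
    simp only [F] at h1 ⊢
    rw [h1]; ring
  have hmono : IsMonotoneReturn w N F := by
    refine ⟨?_, ?_, ?_, ?_, ?_, ?_, ?_, ?_, ?_, ?_⟩
    -- A path with a single edge would run along the line of `ab`.
    · by_contra hcon
      obtain rfl : N = 1 := by omega
      refine h.off 0 one_pos ⟨by rw [h.head, side_right], ?_⟩
      rw [zero_add, h.last, side_left]
    · rw [hws, h.last, hw0]
    · rw [hw0, hΦa]
    · rw [hw1, hΦb]
    · rw [hw0, hw1, hΦa, hΦb]; exact h.left_lt_right
    · intro i hi hiN
      obtain ⟨k, rfl⟩ : ∃ k, i = k + 1 := ⟨i - 1, by omega⟩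
      rw [hws, hΦu k (by omega)]
      exact hoff k (by omega) (by omega)
    · intro i hi hiN t ht0 ht1
      obtain ⟨k, rfl⟩ : ∃ k, i = k + 1 := ⟨i - 1, by omega⟩
      rw [hws, hws, hFl k (by omega) t ht0 ht1, hFu k (by omega), hFu (k + 1) (by omega)]
    · intro i hi hiN
      obtain ⟨k, rfl⟩ : ∃ k, i = k + 1 := ⟨i - 1, by omega⟩
      rw [hws, hws, hFu k (by omega), hFu (k + 1) (by omega)]
      exact hHlt k (by omega)
    · intro i hi hiN x hx hx'
      obtain ⟨k, rfl⟩ : ∃ k, i = k + 1 := ⟨i - 1, by omega⟩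
      rw [hw0, hw1, ← hsege] at hx
      rw [hws, hws, ← hsegT k (by omega)] at hx'
      obtain ⟨p, hp, rfl⟩ := hx
      obtain ⟨q, hq, e⟩ := hx'
      rw [hΦinj _ _ e] at hq
      rcases h.disj k (by omega) p hp hq with rfl | rfl
      · exact Or.inl rfl
      · exact Or.inr hw1.symm
    · intro i hi hiN x hx hx0
      obtain ⟨k, rfl⟩ : ∃ k, i = k + 1 := ⟨i - 1, by omega⟩
      rw [hws, hws] at hx
      obtain ⟨t, ht0, ht1, rfl⟩ := mem_segment_iff_lineMap.1 hx
      have h1 := hFl k (by omega) t ht0 ht1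
      have hF : F (AffineMap.lineMap (Φ (u k)) (Φ (u (k + 1))) t).1 =
          η (AffineMap.lineMap (Φ (u k)) (Φ (u (k + 1))) t).1.1 := by
        simp only [F, hx0, zero_add]
      rw [hF] at h1
      have hx1 : (AffineMap.lineMap (Φ (u k)) (Φ (u (k + 1))) t).1.1 =
          (1 - t) * (u k).1.1 + t * (u (k + 1)).1.1 := by
        rw [lineMap_coord]
      have hk := hHlt k (by omega)
      have hab := h.left_lt_right
      rw [hw0, hw1, hΦa, hΦb]
      constructor
      -- On the axis `F` equals `η`, which is `N` to the left of `a`. The value `N = H N` is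
      -- attained only at the end `u N = a`, which is not to the left of `a`. The right-hand side is
      -- symmetric, with `H 0 = 0` and `u 0 = b`.
      · by_contra hcon
        push Not at hcon
        rw [hηa _ hcon.le, ← hHN] at h1
        have h2 := hHle (k + 1) N (by omega) le_rfl
        have ht : t = 1 := by nlinarith
        rw [ht] at h1 hx1
        have hkN : k + 1 = N := by
          by_contra hne
          have h3 := hHlt (k + 1) (by omega)
          have h4 := hHle (k + 1 + 1) N (by omega) le_rfl
          linarith
        rw [ht, hx1, hkN, h.last] at hcon
        simp at hcon
      · by_contra hcon
        push Not at hcon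
        rw [hηb _ hcon.le, ← hH0] at h1
        have h2 := hHle 0 k (by omega) (by omega)
        have ht : t = 0 := by nlinarith
        rw [ht] at h1 hx1
        have hk0 : k = 0 := by
          by_contra hne
          have h3 := hHlt 0 (by omega)
          have h4 := hHle (0 + 1) k (by omega) (by omega)
          linarith
        rw [ht, hx1, hk0, h.head] at hcon
        simp at hcon
  obtain ⟨n, hn⟩ := hmono.hasContainedStraightDiagram
  exact ⟨n, (hasContainedStraightDiagram_iff hisotopic n).2 hn⟩

end IsSubdivided

/-! ### Conclusion -/

theorem exists_hasContainedStraightDiagram {K : Set Space} (hK : IsTameKnot K) :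
    ∃ n, HasContainedStraightDiagram K n := by
  obtain ⟨-, m, hm, v, hv, hKv⟩ := hK
  obtain ⟨w, n, hw, hlt, hiso⟩ := exists_isGeneric hv
  obtain ⟨T, hT, hiso'⟩ := hw.exists_return
  obtain ⟨u, N, X, hu, hTu⟩ := hT.exists_isSubdivided hlt
  have hseg : initialEdges w 1 = segment ℝ (w 0) (w 1) := by
    ext x
    simp [initialEdges]
  rw [hseg, hTu] at hiso'
  obtain ⟨c, hc⟩ := hu.exists_diagram
  exact ⟨c, (hasContainedStraightDiagram_iff (hKv.trans (hiso.trans hiso')) c).2 hc⟩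

end StraightKnots


theorem theorem2p3 (K : Set StraightKnots.Space) (hK : StraightKnots.IsTameKnot K) :
    (∃ n, StraightKnots.HasContainedStraightDiagram K n) ∧
    IsLeast {n | StraightKnots.HasContainedStraightDiagram K n} (StraightKnots.cstr K) ∧
    ∀ L, StraightKnots.AmbientIsotopic K L → StraightKnots.cstr L = StraightKnots.cstr K := by
  have h := StraightKnots.exists_hasContainedStraightDiagram hK
  refine ⟨h, ⟨Nat.sInf_mem h, fun n hn => Nat.sInf_le hn⟩, fun L hL => ?_⟩
  unfold StraightKnots.cstr
  simp only [StraightKnots.hasContainedStraightDiagram_iff hL]
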